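/- **Setting.** Let $N\ge 3$, $\mathcal V=\{1,\dots,N\}$, $\alpha>0$, $\mu\in(0,N]$, $T>0$. Let $\mathcal G_1,\dots,\mathcal G_m$ be graphs on $\mathcal V$ with Laplacians $\mathsf L_q$, and let $\sigma:[0,\infty)\to\{1,\dots,m\}$ be right-continuous and piecewise constant with finitely many switches in bounded intervals. With initial time $t_0\ge 0$, let $t_0<t_1<t_2<\cdots\to\infty$ contain all switching times after $t_0$. Let $Q\in\mathbb R^{(N-1)\times N}$ satisfy $Q\mathbf 1=0$, $QQ^\top=I$, $Q^\top Q=I-\frac1N\mathbf 1\mathbf 1^\top$. The network is $(\mu,T)$-PE connected: $\frac1T\int_t^{t+T}Q\mathsf L_{\sigma(\tau)}Q^\top d\tau\ge\mu I$ for all $t\ge0$. For $\delta>0$ the aggregated graph has the edges $\{i,j\}$, $i\ne j$, with $\frac1T\int_t^{t+T}a^{\sigma(\tau)}_{ij}d\tau\ge\delta$ for all $t\ge 0$ ($a_{ij}$ the adjacency entries); $\kappa$ and $r$ are its vertex connectivity and robustness ($r$ is the largest integer $\le\lceil N/2\rceil$ such that of any two disjoint nonempty vertex sets at least one contains a vertex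 with at least $r$ neighbours outside the set). **Plant.** $x=(\tilde p,v)\in\mathbb R^{2N}$ solves $\dot{\tilde p}=v$, $\dot v=-\alpha\mathsf L_\sigma\tilde p-\gamma v+I_{\mathcal A}u$ for $t\ge t_0$, where $I_{\mathcal A}$ has the unit vectors of the attacked agents $\mathcal A\subseteq\mathcal V$ as columns, and $u\in L_{pe}$ (that is, $u\in L_p$ on bounded intervals) with $p\in[1,\infty]$. For some $\delta>0$ and $F\ge 0$, $\mathcal A$ is $F$-total ($|\mathcal A|\le F$) with $F\le\kappa-1$, or $F$-local (every agent outside $\mathcal A$ has at most $F$ neighbours in $\mathcal A$ in the aggregated graph) with $F\le r-1$. **Observer of agent $i$.** In mode $q$ let $\mathcal I=\mathcal I_q$ consist of $i$ and the endpoints of paths of length $1$ or $2$ starting at $i$, and let $\mathsf L''_q$ be the Laplacian of the graph on $\mathcal I$ formed by the edges inside the closed $1$-hop neighbourhood of $i$ and the edges between $1$-hop and $2$-hop neighbours. Put $$A_q=\begin{pmatrix}0&I\\-\alpha\mathsf L''_q&-\gamma I\end{pmatrix},\quad C_q=\begin{pmatrix}I&0\\0&\mathfrak e_i^\top\end{pmatrix},\quad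 \mathbf H_q=\begin{pmatrix}0&0\\H_q&h_q\mathfrak e_i\end{pmatrix},\quad \bar A_q=A_q-\mathbf H_qC_q .$$ The gains ($H_q$ symmetric positive definite, $h_q>0$, for each $q$) are called admissible if every $\bar A_q$ is Hurwitz. With $x_{\mathcal I}$ the positions and velocities of the agents in $\mathcal I$, the observer is $\dot{\hat x}_{\mathcal I}=A_\sigma\hat x_{\mathcal I}+\mathbf H_\sigma r^i$, with residual $r^i=C_\sigma(x_{\mathcal I}-\hat x_{\mathcal I})$ and error $e=x_{\mathcal I}-\hat x_{\mathcal I}$. At $t_0$, and at each $t_k$ where the set $\mathcal I$ changes, it is reset to $\hat x_{\mathcal I}(t_k)=\mathrm{diag}(I,\mathfrak e_i\mathfrak e_i^\top)x_{\mathcal I}(t_k)$; at all other $t_k$ it is continuous. All norms are Euclidean or the induced matrix norms. **Constants.** $\eta=-\frac1{2T}\ln\!\big(1-\frac{(\alpha/\gamma)\mu T}{1+(\alpha/\gamma)^2N^2T^2}\big)$, $\lambda_\chi=\eta e^{-2\eta T}$, $C=\begin{pmatrix}\frac1\gamma I&-\frac1\gamma Q\\0&I\end{pmatrix}$ and, for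 $\beta>0$, $\kappa_x=\|C\|\sqrt{\frac{\max\{\lambda_\chi^{-1},\beta\}}{\min\{\gamma/(\alpha N),\beta\}}}\,\|C^{-1}\|$. **Theorem.** There is $\gamma_0>0$, depending only on $N,\alpha,\mu,T$, such that for every $\gamma\ge\gamma_0$, all graphs $\mathcal G_1,\dots,\mathcal G_m$ and every agent $i$ the following hold, where $\sigma,t_0,(t_k),\mathcal A,u,x,\hat x_{\mathcal I}$ are arbitrary as above. (I) For all admissible gains: 1. For every mode $q$ there are $\kappa_e,\lambda_e>0$ with $\|e^{\bar A_qs}\|\le\kappa_ee^{-\lambda_es}$ for all $s\ge0$; that is, the unforced error system of each mode is exponentially stable. 2. In each mode the error system is finite-gain $L_p$ stable: for every $p\in[1,\infty]$ there are $c,b,b'\ge0$, independent of $\sigma,t_0,(t_k),\mathcal A,u,x,\hat x_{\mathcal I}$, such that whenever $\|e(t_k)\|<w$ and $t_k\le T_d<t_{k+1}$, the $L_p$ norms of $e$ and of $r^i$ on $[t_k,T_d]$ are at most $c\|u\|_{L_p[t_0,T_d]}+b\|x(t_0)\|+b'w$. 3. Let $\beta>0$, $0<\lambda_x<\lambda_\chi$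 and $\|e(t_k)\|<w$, let $\kappa_e,\lambda_e$ be as in 1 for $q=\sigma(t_k)$, and put $\kappa_r=\alpha\kappa_x\kappa_e$. For all $T_d$, all $t\in[t_k,t_{k+1})$ with $t\le T_d$, and every component $j$, $$|r^{i,j}(t)|\le\kappa_ewe^{-\lambda_e(t-t_k)}+\Big(\tfrac{\kappa_r}{\lambda_e}\|x(t_0)\|e^{-\lambda_x(t_k-t_0)}+\tfrac{1+\kappa_r}{\lambda_e}\sup_{t_0\le s\le T_d}\|u(s)\|\Big)\big(1-e^{-\lambda_e(t-t_k)}\big).$$ If $\mathcal A=\emptyset$, then on $[t_k,t_{k+1})$ $$|r^{i,j}(t)|\le\epsilon(t):=\kappa_ewe^{-\lambda_e(t-t_k)}+\tfrac{\kappa_r}{\lambda_e}\|x(t_0)\|e^{-\lambda_x(t_k-t_0)}\big(1-e^{-\lambda_e(t-t_k)}\big),$$ which is the detection threshold, and $\|e(t)\|$ obeys the same bound with $w$ replaced by $\|e(t_k)\|$. 4. Suppose $\kappa_e,\lambda_e$ are as in 1 for all modes at once, $n\ge0$ is an integer, and $\tau>0$ satisfies $\ln\kappa_e<\lambda_e\tau$.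 Restrict to switching signals for which, for all $a\le b$ such that no reset occurs at $t_{a+1},\dots,t_b$, at most $n+(t_b-t_a)/\tau$ of these times are mode changes. (This holds, for instance, if every mode change changes $\mathcal I$.) Then, with constants independent of $\sigma,t_0,(t_k),\mathcal A,u,x,\hat x_{\mathcal I}$: (a) for every $p\in[1,\infty]$ there are $c,b\ge0$ such that for all $T_d\ge t_0$ the $L_p$ norms of $e$ and $r^i$ on $[t_0,T_d]$ are at most $c\|u\|_{L_p[t_0,T_d]}+b\|x(t_0)\|$; (b) there are $M,\nu>0$ such that, if $\mathcal A=\emptyset$, $\|e(t)\|\le M\|x(t_0)\|e^{-\nu(t-t_0)}$ for all $t\ge t_0$. (II) There are admissible gains, with all entries of every $H_q$ positive, for which 4(a) and 4(b) hold without any restriction on the switching signal. -/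

import Mathlib

open MeasureTheory Filter Topology
open scoped ENNReal

namespace MultiAgent

noncomputable section

/-! ## Graphs -/

open Classical in
/-- Laplacian matrix of a graph on a finite vertex set. -/
def lap {ι : Type*} [Fintype ι] (G : SimpleGraph ι) : Matrix ι ι ℝ := G.lapMatrix ℝ

open Classical in
/-- Adjacency entry `a_{ij}`. -/
def adjEntry {N : ℕ} (G : SimpleGraph (Fin N)) (i j : Fin N) : ℝ := if G.Adj i j then 1 else 0

open Classical in
theorem adjEntry_comm {N : ℕ} (G : SimpleGraph (Fin N)) (i j : Fin N) :
    adjEntry G i j = adjEntry G j i := by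
  unfold adjEntry
  exact if_congr (G.adj_comm i j) rfl rfl

open Classical in
/-- The `k`-hop neighbours of `i`: the endpoints of the paths of length `k` that start at `i`. -/
def kHop {N : ℕ} (G : SimpleGraph (Fin N)) (i : Fin N) (k : ℕ) : Finset (Fin N) :=
  Finset.univ.filter fun j => ∃ w : G.Walk i j, w.IsPath ∧ w.length = k

/-- The agent together with its `1`-hop neighbours. -/
def hood1 {N : ℕ} (G : SimpleGraph (Fin N)) (i : Fin N) : Finset (Fin N) := insert i (kHop G i 1)

/-- The agent together with its `1`-hop and `2`-hop neighbours. -/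
def hood2 {N : ℕ} (G : SimpleGraph (Fin N)) (i : Fin N) : Finset (Fin N) := hood1 G i ∪ kHop G i 2

/-- The agent `i`, as a member of its own `2`-hop neighbourhood. -/
def self {N : ℕ} (G : SimpleGraph (Fin N)) (i : Fin N) : hood2 G i :=
  ⟨i, Finset.mem_union_left _ (Finset.mem_insert_self _ _)⟩

/-- The `2`-hop proximity graph of `i`: all edges inside the closed `1`-hop neighbourhood, and all
edges between `1`-hop and `2`-hop neighbours. -/
def proxGraph {N : ℕ} (G : SimpleGraph (Fin N)) (i : Fin N) : SimpleGraph (hood2 G i) where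
  Adj a b := G.Adj a b ∧
    (((a : Fin N) ∈ hood1 G i ∧ (b : Fin N) ∈ hood1 G i) ∨
      ((a : Fin N) ∈ kHop G i 1 ∧ (b : Fin N) ∈ kHop G i 2) ∨
      ((a : Fin N) ∈ kHop G i 2 ∧ (b : Fin N) ∈ kHop G i 1))
  symm := ⟨fun a b h => ⟨h.1.symm, by tauto⟩⟩
  loopless := ⟨fun a h => G.loopless.irrefl _ h.1⟩

/-- Vertex connectivity: the largest `k ≤ N - 1` such that deleting fewer than `k` vertices never
disconnects the graph. It is `N - 1` for a complete graph and otherwise the least size of a vertex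
cutset. -/
def vertexConnectivity {N : ℕ} (G : SimpleGraph (Fin N)) : ℕ :=
  sSup {k | k ≤ N - 1 ∧
    ∀ S : Finset (Fin N), S.card < k → (G.induce {v | v ∉ S}).Connected}

open Classical in
/-- `r`-robustness of a static graph. -/
def IsRobust {N : ℕ} (G : SimpleGraph (Fin N)) (r : ℕ) : Prop :=
  ∀ S₁ S₂ : Finset (Fin N), S₁.Nonempty → S₂.Nonempty → Disjoint S₁ S₂ →
    (∃ i ∈ S₁, r ≤ (Finset.univ.filter fun j => G.Adj i j ∧ j ∉ S₁).card) ∨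
    (∃ i ∈ S₂, r ≤ (Finset.univ.filter fun j => G.Adj i j ∧ j ∉ S₂).card)

/-- The robustness `r(G)`, with `0 ≤ r(G) ≤ ⌈N/2⌉`. -/
def robustness {N : ℕ} (G : SimpleGraph (Fin N)) : ℕ :=
  sSup {r | r ≤ (N + 1) / 2 ∧ IsRobust G r}

/-! ## Switching networks -/

/-- `ts` lists, in increasing order and without accumulation, the initial time `t₀` and the
switching times of `σ` after `t₀`; `σ` is constant on every `[ts k, ts (k+1))`. Equal consecutive
modes are allowed, so a signal with finitely many switches is included. -/
structure IsSwitchingSequence {m : ℕ} (σ : ℝ → Fin m) (t₀ : ℝ) (ts : ℕ → ℝ) : Prop where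
  start : ts 0 = t₀
  strictMono : StrictMono ts
  unbounded : Tendsto ts atTop atTop
  const : ∀ k, ∀ t ∈ Set.Ico (ts k) (ts (k + 1)), σ t = σ (ts k)

/-- `Q 1 = 0`, `Q Qᵀ = I`, `Qᵀ Q = I - (1/N) 1 1ᵀ`. -/
structure IsDisagreementMatrix {N : ℕ} (Q : Matrix (Fin (N - 1)) (Fin N) ℝ) : Prop where
  mulVec_one : Q.mulVec (fun _ => 1) = 0
  mul_transpose : Q * Q.transpose = 1
  transpose_mul : Q.transpose * Q = 1 - (1 / (N : ℝ)) • Matrix.of fun _ _ => 1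

/-- `(μ,T)`-persistence-of-excitation connectivity. -/
def IsPEConnected {N m : ℕ} (G : Fin m → SimpleGraph (Fin N)) (σ : ℝ → Fin m)
    (Q : Matrix (Fin (N - 1)) (Fin N) ℝ) (μ T : ℝ) : Prop :=
  ∀ t : ℝ, 0 ≤ t →
    ((1 / T) • (Matrix.of fun a b =>
      ∫ τ in t..(t + T), (Q * lap (G (σ τ)) * Q.transpose) a b) - μ • 1).PosSemidef

/-- The aggregated static graph: the edges present for at least a fraction `δ` of the time in
every window `[t, t + T)`. -/
def aggGraph {N m : ℕ} (G : Fin m → SimpleGraph (Fin N)) (σ : ℝ → Fin m) (T δ : ℝ) :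
    SimpleGraph (Fin N) where
  Adj i j := i ≠ j ∧ ∀ t : ℝ, 0 ≤ t → δ ≤ (1 / T) * ∫ τ in t..(t + T), adjEntry (G (σ τ)) i j
  symm := ⟨fun i j h => ⟨h.1.symm, fun t ht => by
    simp only [adjEntry_comm _ j i]; exact h.2 t ht⟩⟩
  loopless := ⟨fun i h => h.1 rfl⟩

/-- `F`-total adversary set. -/
def IsFTotal {N : ℕ} (A : Finset (Fin N)) (F : ℕ) : Prop := A.card ≤ F

open Classical in
/-- `F`-local adversary set with respect to the aggregated neighbourhoods in `G`. -/
def IsFLocal {N : ℕ} (G : SimpleGraph (Fin N)) (A : Finset (Fin N)) (F : ℕ) : Prop :=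
  ∀ i, i ∉ A → (A.filter fun j => G.Adj i j).card ≤ F

/-! ## Dynamics -/

/-- Multiplication of a Euclidean vector by a matrix. -/
def act {m n : Type*} [Fintype m] [Fintype n] [DecidableEq n] (M : Matrix m n ℝ)
    (x : EuclideanSpace ℝ n) : EuclideanSpace ℝ m := Matrix.toEuclideanLin M x

/-- Spectral norm: the matrix norm induced by the Euclidean norms. -/
def opNorm {m n : Type*} [Fintype m] [Fintype n] [DecidableEq n] (M : Matrix m n ℝ) : ℝ :=
  ‖(Matrix.toEuclideanLin M).toContinuousLinearMap‖

/-- The system matrix `[0, I; -α L, -γ I]`. -/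
def sysMat {ι : Type*} [DecidableEq ι] (α γ : ℝ) (L : Matrix ι ι ℝ) : Matrix (ι ⊕ ι) (ι ⊕ ι) ℝ :=
  Matrix.fromBlocks 0 1 (-(α • L)) (-(γ • (1 : Matrix ι ι ℝ)))

/-- The attack input matrix `[0; I_A]`. -/
def inputMat {N : ℕ} (A : Finset (Fin N)) : Matrix (Fin N ⊕ Fin N) A ℝ :=
  Matrix.fromRows 0 (Matrix.of fun j a => if j = (a : Fin N) then 1 else 0)

/-- The signal `u` on `[t₀, ∞)` belongs to the extended space `L_{pe}`. -/
def InLpe {E : Type*} [NormedAddCommGroup E] (p : ℝ≥0∞) (t₀ : ℝ) (u : ℝ → E) : Prop :=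
  ∀ Td : ℝ, MemLp u p (volume.restrict (Set.Icc t₀ Td))

/-- `x = (p̃, v)` solves `ẋ = A_σ x + B_A u` on `[t₀, ∞)` (in integrated form). -/
structure IsPlantSolution {N m : ℕ} (α γ : ℝ) (G : Fin m → SimpleGraph (Fin N)) (σ : ℝ → Fin m)
    (A : Finset (Fin N)) (t₀ : ℝ) (u : ℝ → EuclideanSpace ℝ A)
    (x : ℝ → EuclideanSpace ℝ (Fin N ⊕ Fin N)) : Prop where
  cont : ContinuousOn x (Set.Ici t₀)
  eqn : ∀ t, t₀ ≤ t →
    x t = x t₀ + ∫ s in t₀..t, (act (sysMat α γ (lap (G (σ s)))) (x s) + act (inputMat A) (u s))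

/-- The positions and velocities of the agents in `S`. -/
def restr {N : ℕ} (S : Finset (Fin N)) (x : EuclideanSpace ℝ (Fin N ⊕ Fin N)) :
    EuclideanSpace ℝ (S ⊕ S) :=
  WithLp.toLp 2 fun a => x (Sum.map Subtype.val Subtype.val a)

/-! ## The local observer of agent `i` -/

/-- `A^I = [0, I; -α L'', -γ I]`. -/
def locMat {N : ℕ} (α γ : ℝ) (G : SimpleGraph (Fin N)) (i : Fin N) :
    Matrix (hood2 G i ⊕ hood2 G i) (hood2 G i ⊕ hood2 G i) ℝ :=
  sysMat α γ (lap (proxGraph G i))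

/-- `C^I`: the positions in the `2`-hop neighbourhood and the own velocity are measured. -/
def outMat {N : ℕ} (G : SimpleGraph (Fin N)) (i : Fin N) :
    Matrix (hood2 G i ⊕ Unit) (hood2 G i ⊕ hood2 G i) ℝ :=
  Matrix.fromBlocks 1 0 0 (Matrix.of fun _ b => if b = self G i then 1 else 0)

/-- The observer gain `[0, 0; H, h e_i]`. -/
def gainMat {N : ℕ} (G : SimpleGraph (Fin N)) (i : Fin N)
    (H : Matrix (hood2 G i) (hood2 G i) ℝ) (h : ℝ) :
    Matrix (hood2 G i ⊕ hood2 G i) (hood2 G i ⊕ Unit) ℝ :=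
  Matrix.fromBlocks 0 0 H (Matrix.of fun b _ => if b = self G i then h else 0)

/-- `Ā = A^I - H^I C^I`. -/
def errMat {N : ℕ} (α γ : ℝ) (G : SimpleGraph (Fin N)) (i : Fin N)
    (H : Matrix (hood2 G i) (hood2 G i) ℝ) (h : ℝ) :
    Matrix (hood2 G i ⊕ hood2 G i) (hood2 G i ⊕ hood2 G i) ℝ :=
  locMat α γ G i - gainMat G i H h * outMat G i

/-- The reset matrix `diag(I, e_i e_iᵀ)`. -/
def resetMat {N : ℕ} (G : SimpleGraph (Fin N)) (i : Fin N) :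
    Matrix (hood2 G i ⊕ hood2 G i) (hood2 G i ⊕ hood2 G i) ℝ :=
  Matrix.fromBlocks 1 0 0
    (Matrix.of fun a b => if a = self G i ∧ b = self G i then 1 else 0)

/-- A real square matrix is Hurwitz: its complex eigenvalues have negative real part. -/
def IsHurwitz {ι : Type*} [Fintype ι] [DecidableEq ι] (M : Matrix ι ι ℝ) : Prop :=
  ∀ z ∈ spectrum ℂ (M.map (algebraMap ℝ ℂ)), z.re < 0

/-- The mode-dependent gains `H_q`, `h_q` of agent `i` are admissible. -/
structure AdmissibleGains {N m : ℕ} (α γ : ℝ) (G : Fin m → SimpleGraph (Fin N)) (i : Fin N)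
    (H : ∀ q, Matrix (hood2 (G q) i) (hood2 (G q) i) ℝ) (h : Fin m → ℝ) : Prop where
  posDef : ∀ q, (H q).PosDef
  pos : ∀ q, 0 < h q
  hurwitz : ∀ q, IsHurwitz (errMat α γ (G q) i (H q) (h q))

/-- The `2`-hop neighbourhood of `i` that is active at time `t`. -/
def activeHood {N m : ℕ} (G : Fin m → SimpleGraph (Fin N)) (i : Fin N) (σ : ℝ → Fin m) (t : ℝ) :
    Finset (Fin N) := hood2 (G (σ t)) i

/-- `xh` is a trajectory of the observer of agent `i` fed by the plant state `x`. Only the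
coordinates of `xh t` in the active `2`-hop neighbourhood are meaningful. The observer is reset at
`k = 0` and whenever the `2`-hop neighbourhood changes; otherwise its state is continuous. -/
structure IsObserverTrajectory {N m : ℕ} (α γ : ℝ) (G : Fin m → SimpleGraph (Fin N)) (i : Fin N)
    (H : ∀ q, Matrix (hood2 (G q) i) (hood2 (G q) i) ℝ) (h : Fin m → ℝ) (σ : ℝ → Fin m)
    (ts : ℕ → ℝ) (x xh : ℝ → EuclideanSpace ℝ (Fin N ⊕ Fin N)) : Prop where
  reset : ∀ k, (k = 0 ∨ activeHood G i σ (ts k) ≠ activeHood G i σ (ts (k - 1))) →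
    restr (hood2 (G (σ (ts k))) i) (xh (ts k)) =
      act (resetMat (G (σ (ts k))) i) (restr (hood2 (G (σ (ts k))) i) (x (ts k)))
  noReset : ∀ k, activeHood G i σ (ts (k + 1)) = activeHood G i σ (ts k) →
    Tendsto (fun t => restr (activeHood G i σ (ts (k + 1))) (xh t)) (𝓝[<] (ts (k + 1)))
      (𝓝 (restr (activeHood G i σ (ts (k + 1))) (xh (ts (k + 1)))))
  cont : ∀ k, ContinuousOn (fun t => restr (hood2 (G (σ (ts k))) i) (xh t))
    (Set.Ico (ts k) (ts (k + 1)))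
  eqn : ∀ k, ∀ t ∈ Set.Ico (ts k) (ts (k + 1)),
    restr (hood2 (G (σ (ts k))) i) (xh t) = restr (hood2 (G (σ (ts k))) i) (xh (ts k)) +
      ∫ s in (ts k)..t,
        (act (locMat α γ (G (σ (ts k))) i) (restr (hood2 (G (σ (ts k))) i) (xh s)) +
          act (gainMat (G (σ (ts k))) i (H (σ (ts k))) (h (σ (ts k))))
            (act (outMat (G (σ (ts k))) i) (restr (hood2 (G (σ (ts k))) i) (x s)) -
              act (outMat (G (σ (ts k))) i) (restr (hood2 (G (σ (ts k))) i) (xh s))))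

/-- Estimation error `e = x_I - x̂_I` of agent `i` in mode `q`. -/
def err {N m : ℕ} (G : Fin m → SimpleGraph (Fin N)) (i : Fin N) (q : Fin m)
    (x xh : ℝ → EuclideanSpace ℝ (Fin N ⊕ Fin N)) (t : ℝ) :
    EuclideanSpace ℝ (hood2 (G q) i ⊕ hood2 (G q) i) :=
  restr (hood2 (G q) i) (x t) - restr (hood2 (G q) i) (xh t)

/-- Residual `r = y - ŷ` of agent `i` in mode `q`. -/
def residual {N m : ℕ} (G : Fin m → SimpleGraph (Fin N)) (i : Fin N) (q : Fin m)
    (x xh : ℝ → EuclideanSpace ℝ (Fin N ⊕ Fin N)) (t : ℝ) :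
    EuclideanSpace ℝ (hood2 (G q) i ⊕ Unit) :=
  act (outMat (G q) i) (restr (hood2 (G q) i) (x t)) -
    act (outMat (G q) i) (restr (hood2 (G q) i) (xh t))

/-- `‖e^{Ā_q s}‖ ≤ κ e^{-λ s}` for all `s ≥ 0`, with `κ, λ > 0`. -/
structure ModeDecay {N m : ℕ} (α γ : ℝ) (G : Fin m → SimpleGraph (Fin N)) (i : Fin N)
    (H : ∀ q, Matrix (hood2 (G q) i) (hood2 (G q) i) ℝ) (h : Fin m → ℝ) (q : Fin m)
    (κ lam : ℝ) : Prop where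
  pos_const : 0 < κ
  pos_rate : 0 < lam
  bound : ∀ s : ℝ, 0 ≤ s →
    opNorm (NormedSpace.exp (s • errMat α γ (G q) i (H q) (h q))) ≤ κ * Real.exp (-lam * s)

/-- A run: the plant over a `(μ,T)`-PE connected switching network, subject to an input in `L_{pe}`
of an adversary set which is `F`-total with `F ≤ κ - 1`, or `F`-local with `F ≤ r - 1`, where `κ`
and `r` are the vertex connectivity and the robustness of the aggregated network; and the observer
of agent `i`. -/
structure IsRun {N m : ℕ} (α γ μ T : ℝ) (Q : Matrix (Fin (N - 1)) (Fin N) ℝ)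
    (G : Fin m → SimpleGraph (Fin N)) (i : Fin N)
    (H : ∀ q, Matrix (hood2 (G q) i) (hood2 (G q) i) ℝ) (h : Fin m → ℝ)
    (σ : ℝ → Fin m) (t₀ : ℝ) (ts : ℕ → ℝ) (A : Finset (Fin N)) (p : ℝ≥0∞)
    (u : ℝ → EuclideanSpace ℝ A) (x xh : ℝ → EuclideanSpace ℝ (Fin N ⊕ Fin N)) : Prop where
  nonneg : 0 ≤ t₀
  piecewise : ∃ τ, IsSwitchingSequence σ 0 τ
  switching : IsSwitchingSequence σ t₀ ts
  pe : IsPEConnected G σ Q μ T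
  adversary : ∃ (δ : ℝ) (F : ℕ), 0 < δ ∧
    ((IsFTotal A F ∧ F + 1 ≤ vertexConnectivity (aggGraph G σ T δ)) ∨
      (IsFLocal (aggGraph G σ T δ) A F ∧ F + 1 ≤ robustness (aggGraph G σ T δ)))
  one_le : 1 ≤ p
  input : InLpe p t₀ u
  plant : IsPlantSolution α γ G σ A t₀ u x
  observer : IsObserverTrajectory α γ G i H h σ ts x xh

/-! ## Constants -/

/-- `η = -(1/(2T)) ln(1 - (α/γ) μ T / (1 + (α/γ)² N² T²))`. -/
def eta (N : ℕ) (α γ μ T : ℝ) : ℝ :=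
  -(1 / (2 * T)) * Real.log (1 - (α / γ) * μ * T / (1 + (α / γ) ^ 2 * (N : ℝ) ^ 2 * T ^ 2))

/-- `λ_χ = η e^{-2 η T}`. -/
def lamChi (N : ℕ) (α γ μ T : ℝ) : ℝ :=
  eta N α γ μ T * Real.exp (-2 * eta N α γ μ T * T)

/-- The matrix `[(1/γ) I, -(1/γ) Q; 0, I]`. -/
def coordMat {N : ℕ} (γ : ℝ) (Q : Matrix (Fin (N - 1)) (Fin N) ℝ) :
    Matrix (Fin (N - 1) ⊕ Fin N) (Fin (N - 1) ⊕ Fin N) ℝ :=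
  Matrix.fromBlocks ((1 / γ) • 1) (-((1 / γ) • Q)) 0 1

/-- `κ_x = ‖C‖ √(max{1/λ_χ, β} / min{γ/(αN), β}) ‖C⁻¹‖`. -/
def kappaX {N : ℕ} (α γ μ T β : ℝ) (Q : Matrix (Fin (N - 1)) (Fin N) ℝ) : ℝ :=
  opNorm (coordMat γ Q) *
    Real.sqrt (max (lamChi N α γ μ T)⁻¹ β / min (γ / (α * N)) β) *
    opNorm (coordMat γ Q)⁻¹

/-! ## Stability over the whole time axis -/

open Classical in
/-- Average dwell time for the switches without reset: a time stretch without reset of the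
observer of agent `i` has at most `n` mode changes plus one per `τ` units of time. -/
def HasAverageDwellTime {N m : ℕ} (G : Fin m → SimpleGraph (Fin N)) (i : Fin N) (n : ℕ) (τ : ℝ)
    (σ : ℝ → Fin m) (ts : ℕ → ℝ) : Prop :=
  ∀ a b : ℕ, a ≤ b →
    (∀ l ∈ Finset.Ioc a b, activeHood G i σ (ts l) = activeHood G i σ (ts (l - 1))) →
    (((Finset.Ioc a b).filter fun l => σ (ts l) ≠ σ (ts (l - 1))).card : ℝ)
      ≤ n + (ts b - ts a) / τ

/-- Over the whole time axis and along all switching signals in the class `S`, with constants that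
do not depend on the run: the error system is finite-gain `L_p` stable for every `p ∈ [1, ∞]`, and
without attackers the error decays exponentially to zero. -/
def GloballyStable {N m : ℕ} (α γ μ T : ℝ) (Q : Matrix (Fin (N - 1)) (Fin N) ℝ)
    (G : Fin m → SimpleGraph (Fin N)) (i : Fin N)
    (H : ∀ q, Matrix (hood2 (G q) i) (hood2 (G q) i) ℝ) (h : Fin m → ℝ)
    (S : (ℝ → Fin m) → (ℕ → ℝ) → Prop) : Prop :=
  (∀ p : ℝ≥0∞, 1 ≤ p → ∃ c b : ℝ, 0 ≤ c ∧ 0 ≤ b ∧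
    ∀ σ t₀ ts A u x xh, S σ ts → IsRun α γ μ T Q G i H h σ t₀ ts A p u x xh →
      ∀ Td, t₀ ≤ Td →
        eLpNorm (fun t => ‖err G i (σ t) x xh t‖) p (volume.restrict (Set.Icc t₀ Td)) ≤
            ENNReal.ofReal c * eLpNorm u p (volume.restrict (Set.Icc t₀ Td)) +
              ENNReal.ofReal (b * ‖x t₀‖) ∧
        eLpNorm (fun t => ‖residual G i (σ t) x xh t‖) p (volume.restrict (Set.Icc t₀ Td)) ≤
            ENNReal.ofReal c * eLpNorm u p (volume.restrict (Set.Icc t₀ Td)) +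
              ENNReal.ofReal (b * ‖x t₀‖)) ∧
  ∃ M ν : ℝ, 0 < M ∧ 0 < ν ∧
    ∀ σ t₀ ts p u x xh, S σ ts → IsRun α γ μ T Q G i H h σ t₀ ts ∅ p u x xh →
      ∀ t, t₀ ≤ t → ‖err G i (σ t) x xh t‖ ≤ M * ‖x t₀‖ * Real.exp (-ν * (t - t₀))

end

end MultiAgent

/-!
In the coordinates `z = Q p + Q v / γ` and `v / γ` the plant separates, for large `γ`, into a slow
part `z' = -(α/γ) Q L_σ p + …`, on which the damping does not act, and a fast part that decays at
the rate `γ`. Over a window of length `T`, the slow coordinate changes only to the order `1/γ`, so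
persistence of excitation contracts it by a factor `1 - (3/4) (α/γ) μ T`; the smallness conditions
are collected in `IsLargeDamping`. Chaining the windows bounds the disagreement `Q p` and the
velocities by an exponentially weighted integral of the input with the rate `(3/4) (α/γ) μ`
(`IsPlantSolution.norm_le`). This rate is at least `lamChi` (`lamChi_le`), and `kappaX` is at least
`γ` (`le_kappaX`), which leaves room for all numerical constants in the detection threshold.

Within one mode the estimation error solves `e' = Ā e + d`, where `d` consists of the couplings that
the local model misses and of the attack. Laplacians do not see the mean, so `d` is bounded by the
disagreement and the input (`IsDisagreementMatrix.norm_restr_sysMat_sub_le`). A Hurwitz `Ā`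
generates an exponentially decaying semigroup, by Gelfand's formula
(`IsHurwitz.exists_opNorm_exp_le`), and variation of constants gives the bounds in one mode. The
`L_p` bounds follow from the Schur test for the exponential kernel (`eLpNorm_expConv_le`).

Over many modes the error is measured by the decay of its whole future under the unforced flow of
the active mode (`FlowBound`). This costs the constant `κ` of the modes only where the flow changes
without a reset, and a slow average rate of such changes is absorbed by the decay
(`IsRun.exists_flowBound`). A reset leaves an error that is at most the velocity of the plant, and
so is already controlled. For arbitrary switching the gains `commonGain` cancel the local Laplacian:
then the error flow depends on the `2`-hop neighbourhood only, and it cannot change without a reset.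
-/

namespace MultiAgent

/-! ### Variation of constants for integrable forcing -/

theorem absolutelyContinuousOnInterval_of_dist_le {X Y : Type*} [PseudoMetricSpace X]
    [PseudoMetricSpace Y] {g : ℝ → X} {F : ℝ → Y} {a b : ℝ}
    (hF : AbsolutelyContinuousOnInterval F a b)
    (h : ∀ r ∈ Set.uIcc a b, ∀ s ∈ Set.uIcc a b, dist (g r) (g s) ≤ dist (F r) (F s)) :
    AbsolutelyContinuousOnInterval g a b := by
  rw [absolutelyContinuousOnInterval_iff] at hF ⊢
  intro ε hε
  obtain ⟨δ, hδ, H⟩ := hF ε hε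
  refine ⟨δ, hδ, fun E hE hlt => lt_of_le_of_lt ?_ (H E hE hlt)⟩
  exact Finset.sum_le_sum fun i hi => h _ (hE.1 i hi).1 _ (hE.1 i hi).2

theorem norm_intervalIntegral_sub_le {E : Type*} [NormedAddCommGroup E] [NormedSpace ℝ E]
    {f : ℝ → E} {a b r s : ℝ}
    (hf : IntervalIntegrable f volume a b) (hr : r ∈ Set.uIcc a b) (hs : s ∈ Set.uIcc a b) :
    ‖(∫ x in a..r, f x) - ∫ x in a..s, f x‖ ≤ |(∫ x in a..r, ‖f x‖) - ∫ x in a..s, ‖f x‖| := by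
  have h1 : IntervalIntegrable f volume a r :=
    hf.mono_set (Set.uIcc_subset_uIcc_left hr)
  have h2 : IntervalIntegrable f volume a s :=
    hf.mono_set (Set.uIcc_subset_uIcc_left hs)
  rw [intervalIntegral.integral_interval_sub_left h1 h2,
    intervalIntegral.integral_interval_sub_left h1.norm h2.norm]
  exact intervalIntegral.norm_integral_le_abs_integral_norm

section VariationOfConstants

variable {E : Type*} [NormedAddCommGroup E] [NormedSpace ℝ E] [CompleteSpace E]

theorem hasDerivAt_exp_sub_smul (A : E →L[ℝ] E) (t s : ℝ) :
    HasDerivAt (fun s : ℝ => NormedSpace.exp ((t - s) • A))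
      (-(NormedSpace.exp ((t - s) • A) * A)) s := by
  have h1 := hasDerivAt_exp_smul_const (𝕂 := ℝ) A (t - s)
  have h2 : HasDerivAt (fun s : ℝ => t - s) (-1) s := by
    simpa using (hasDerivAt_id s).const_sub t
  exact (h1.scomp s h2).congr_deriv (by simp)

theorem continuous_exp_sub_smul (A : E →L[ℝ] E) (t : ℝ) :
    Continuous fun s : ℝ => NormedSpace.exp ((t - s) • A) :=
  continuous_iff_continuousAt.2 fun s => (hasDerivAt_exp_sub_smul A t s).continuousAt

/-- Variation of constants for the integrated equation `e' = A e + d` with merely integrable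
forcing `d`: `s ↦ exp ((t - s) A) e s - ∫ exp ((t - r) A) d r` is absolutely continuous with
derivative zero almost everywhere. -/
theorem eq_exp_add_integral {A : E →L[ℝ] E} {e d : ℝ → E} {a b : ℝ} (hab : a ≤ b)
    (hc : ContinuousOn e (Set.Icc a b)) (hd : IntervalIntegrable d volume a b)
    (he : ∀ t ∈ Set.Icc a b, e t = e a + ∫ s in a..t, (A (e s) + d s)) :
    e b = NormedSpace.exp ((b - a) • A) (e a) +
      ∫ s in a..b, NormedSpace.exp ((b - s) • A) (d s) := by
  have hu : Set.uIcc a b = Set.Icc a b := Set.uIcc_of_le hab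
  set Φ : ℝ → E →L[ℝ] E := fun s => NormedSpace.exp ((b - s) • A) with hΦ
  have hΦc : Continuous Φ := continuous_exp_sub_smul A b
  set f : ℝ → E := fun s => A (e s) + d s with hf
  have hfi : IntervalIntegrable f volume a b := by
    refine IntervalIntegrable.add ?_ hd
    exact (A.continuous.comp_continuousOn (hu ▸ hc)).intervalIntegrable
  have hΦd : IntervalIntegrable (fun s => Φ s (d s)) volume a b := by
    obtain ⟨K, hK⟩ := isCompact_Icc.exists_bound_of_continuousOn
      (s := Set.uIcc a b) hΦc.continuousOn
    refine IntervalIntegrable.mono_fun (hd.norm.const_mul K) ?_ ?_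
    · exact (ContinuousLinearMap.id ℝ (E →L[ℝ] E)).aestronglyMeasurable_comp₂
        hΦc.aestronglyMeasurable hd.def'.aestronglyMeasurable
    · refine (ae_restrict_iff' measurableSet_uIoc).2 (ae_of_all _ fun s hs => ?_)
      have hs' := hK s (Set.uIoc_subset_uIcc hs)
      have : 0 ≤ K := (norm_nonneg _).trans hs'
      simp only [norm_mul, norm_norm, Real.norm_of_nonneg this]
      exact (Φ s).le_of_opNorm_le hs' _
  -- bounds on the compact interval
  obtain ⟨K, hK⟩ := isCompact_Icc.exists_bound_of_continuousOn
    (s := Set.Icc a b) hΦc.continuousOn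
  obtain ⟨M, hM⟩ := isCompact_Icc.exists_bound_of_continuousOn hc
  have hK0 : 0 ≤ K := (norm_nonneg _).trans (hK a ⟨le_rfl, hab⟩)
  have hM0 : 0 ≤ M := (norm_nonneg _).trans (hM a ⟨le_rfl, hab⟩)
  have hΦL : ∀ r ∈ Set.Icc a b, ∀ s ∈ Set.Icc a b, ‖Φ r - Φ s‖ ≤ K * ‖A‖ * |r - s| := by
    intro r hr s hs
    have := (convex_Icc a b).norm_image_sub_le_of_norm_hasDerivWithin_le
      (f := Φ) (f' := fun s => -(Φ s * A)) (C := K * ‖A‖)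
      (fun x hx => (hasDerivAt_exp_sub_smul A b x).hasDerivWithinAt)
      (fun x hx => by
        rw [norm_neg]
        exact (norm_mul_le _ _).trans (by gcongr; exact hK x hx)) hs hr
    simpa using this
  set F : ℝ → ℝ := fun x => ∫ s in a..x,
    (K * ‖f s‖ + K * ‖A‖ * M + ‖Φ s (d s)‖) with hF
  have hFi : IntervalIntegrable
      (fun s => K * ‖f s‖ + K * ‖A‖ * M + ‖Φ s (d s)‖) volume a b :=
    ((hfi.norm.const_mul K).add intervalIntegrable_const).add hΦd.norm
  have hFac : AbsolutelyContinuousOnInterval F a b :=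
    hFi.absolutelyContinuousOnInterval_intervalIntegral (by simp)
  set g : ℝ → E := fun s => Φ s (e s) - ∫ r in a..s, Φ r (d r) with hg
  have hsub : ∀ {h : ℝ → ℝ} {r : ℝ}, IntervalIntegrable h volume a b → r ∈ Set.uIcc a b →
      IntervalIntegrable h volume a r := fun hh hr =>
    hh.mono_set (Set.uIcc_subset_uIcc_left hr)
  have hgac : AbsolutelyContinuousOnInterval g a b := by
    refine absolutelyContinuousOnInterval_of_dist_le hFac fun r hr s hs => ?_
    have key : ∀ r ∈ Set.uIcc a b, ∀ s ∈ Set.uIcc a b, s ≤ r →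
        dist (g r) (g s) ≤ dist (F r) (F s) := by
      intro r hr s hs hsr
      have hr' := hu ▸ hr
      have hs' := hu ▸ hs
      have e1 : ‖e r - e s‖ ≤ ∫ x in s..r, ‖f x‖ := by
        have h := norm_intervalIntegral_sub_le hfi hr hs
        rw [intervalIntegral.integral_interval_sub_left (hsub hfi.norm hr)
          (hsub hfi.norm hs), abs_of_nonneg (intervalIntegral.integral_nonneg hsr
            fun _ _ => norm_nonneg _)] at h
        rw [he r hr', he s hs', add_sub_add_left_eq_sub]
        exact h
      have e2 : ‖(∫ x in a..r, Φ x (d x)) - ∫ x in a..s, Φ x (d x)‖ ≤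
          ∫ x in s..r, ‖Φ x (d x)‖ := by
        have h := norm_intervalIntegral_sub_le hΦd hr hs
        rwa [intervalIntegral.integral_interval_sub_left (hsub hΦd.norm hr)
          (hsub hΦd.norm hs), abs_of_nonneg (intervalIntegral.integral_nonneg hsr
            fun _ _ => norm_nonneg _)] at h
      have e3 : g r - g s = Φ r (e r - e s) + (Φ r - Φ s) (e s) -
          ((∫ x in a..r, Φ x (d x)) - ∫ x in a..s, Φ x (d x)) := by
        simp only [hg, map_sub, _root_.sub_apply]; abel
      have hss : Set.uIcc s r ⊆ Set.uIcc a b := Set.uIcc_subset_uIcc hs hr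
      have e4 : F r - F s = K * (∫ x in s..r, ‖f x‖) + K * ‖A‖ * M * (r - s) +
          ∫ x in s..r, ‖Φ x (d x)‖ := by
        simp only [hF]
        rw [intervalIntegral.integral_interval_sub_left (hsub hFi hr) (hsub hFi hs),
          intervalIntegral.integral_add
            (((hfi.norm.const_mul K).add intervalIntegrable_const).mono_set hss)
            (hΦd.norm.mono_set hss),
          intervalIntegral.integral_add ((hfi.norm.const_mul K).mono_set hss)
            intervalIntegrable_const, intervalIntegral.integral_const_mul,
          intervalIntegral.integral_const, smul_eq_mul]
        ring
      rw [dist_eq_norm, Real.dist_eq, e3]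
      refine le_trans ?_ (le_abs_self _)
      rw [e4]
      refine (norm_sub_le _ _).trans (add_le_add ((norm_add_le _ _).trans
        (add_le_add ?_ ?_)) e2)
      · exact ((Φ r).le_of_opNorm_le (hK r hr') _).trans (by gcongr)
      · refine (ContinuousLinearMap.le_opNorm _ _).trans ?_
        have h1 := hΦL r hr' s hs'
        rw [abs_of_nonneg (sub_nonneg.2 hsr)] at h1
        calc ‖Φ r - Φ s‖ * ‖e s‖ ≤ (K * ‖A‖ * (r - s)) * M :=
              mul_le_mul h1 (hM s hs') (norm_nonneg _) ((norm_nonneg _).trans h1)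
          _ = _ := by ring
    rcases le_total s r with h | h
    · exact key r hr s hs h
    · rw [dist_comm, dist_comm (F r)]; exact key s hs r hr h
  have hg0 : ∀ᵐ x, x ∈ Set.uIcc a b → HasDerivAt g 0 x := by
    have hab0 : ∀ᵐ x : ℝ, x ≠ a ∧ x ≠ b := by
      have h1 : ∀ᵐ x : ℝ, x ≠ a := by simp [ae_iff, measure_singleton]
      have h2 : ∀ᵐ x : ℝ, x ≠ b := by simp [ae_iff, measure_singleton]
      filter_upwards [h1, h2] with x h1 h2 using ⟨h1, h2⟩
    filter_upwards [hfi.ae_hasDerivAt_integral, hΦd.ae_hasDerivAt_integral, hab0]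
      with x h1 h2 h3 hx
    have hx' := hu ▸ hx
    have hnhds : Set.Icc a b ∈ 𝓝 x :=
      Icc_mem_nhds (lt_of_le_of_ne hx'.1 h3.1.symm) (lt_of_le_of_ne hx'.2 h3.2)
    have d1 : HasDerivAt e (f x) x := by
      refine HasDerivAt.congr_of_eventuallyEq ((h1 hx a (by simp)).const_add (e a)) ?_
      filter_upwards [hnhds] with y hy using he y hy
    have d2 := (hasDerivAt_exp_sub_smul A b x).clm_apply d1
    have d3 := d2.sub (h2 hx a (by simp))
    refine d3.congr_deriv ?_
    simp [hf, hΦ]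
  obtain ⟨C, hC⟩ := hgac.const_of_ae_hasDerivAt_zero hg0
  have ha := hC a (by simp)
  have hb := hC b (by simp)
  have : g b = g a := hb.trans ha.symm
  simp only [hg, hΦ, sub_self, zero_smul, NormedSpace.exp_zero, intervalIntegral.integral_same,
    sub_zero, one_apply_eq_self] at this
  rw [← this]; abel

end VariationOfConstants

/-! ### Exponentially weighted integrals -/

/-- The Schur test for a nonnegative kernel whose row and column integrals are at most `c`. -/
theorem lintegral_rpow_lintegral_mul_le {X : Type*} [MeasurableSpace X] {μ : Measure X}
    [SFinite μ] {K : X → X → ℝ≥0∞} (hK : Measurable (Function.uncurry K)) {F : X → ℝ≥0∞}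
    (hF : AEMeasurable F μ) {c : ℝ≥0∞} (h1 : ∀ t, ∫⁻ s, K t s ∂μ ≤ c)
    (h2 : ∀ s, ∫⁻ t, K t s ∂μ ≤ c) {p : ℝ} (hp : 1 ≤ p) :
    ∫⁻ t, (∫⁻ s, K t s * F s ∂μ) ^ p ∂μ ≤ c ^ p * ∫⁻ s, F s ^ p ∂μ := by
  have hp0 : 0 < p := by linarith
  have hKt : ∀ t, Measurable (K t) := fun t => hK.comp measurable_prodMk_left
  have key : ∀ t, (∫⁻ s, K t s * F s ∂μ) ^ p ≤ c ^ (p - 1) * ∫⁻ s, K t s * F s ^ p ∂μ := by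
    intro t
    rcases eq_or_lt_of_le hp with h | h
    · simp [← h]
    have hpq := Real.HolderConjugate.conjExponent h
    set q := p.conjExponent with hq
    have hq0 : 0 < q := hpq.symm.pos
    have hH := ENNReal.lintegral_mul_le_Lp_mul_Lq μ hpq.symm
      (f := fun s => K t s ^ (1 / q)) (g := fun s => K t s ^ (1 / p) * F s)
      ((hKt t).pow_const _).aemeasurable (((hKt t).pow_const _).aemeasurable.mul hF)
    have e1 : (∫⁻ s, K t s * F s ∂μ) =
        ∫⁻ s, ((fun s => K t s ^ (1 / q)) * fun s => K t s ^ (1 / p) * F s) s ∂μ := by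
      refine lintegral_congr fun s => ?_
      simp only [Pi.mul_apply]
      rw [← mul_assoc, ← ENNReal.rpow_add_of_nonneg _ _ (by positivity) (by positivity)]
      have : 1 / q + 1 / p = 1 := by
        simpa [one_div] using hpq.symm.inv_add_inv_eq_one
      rw [this, ENNReal.rpow_one]
    rw [e1]
    refine (ENNReal.rpow_le_rpow hH hp0.le).trans ?_
    rw [ENNReal.mul_rpow_of_nonneg _ _ hp0.le, ← ENNReal.rpow_mul, ← ENNReal.rpow_mul]
    have e2 : 1 / q * p = p - 1 := by
      have := hpq.symm.inv_add_inv_eq_one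
      field_simp at this ⊢
      linarith
    have e3 : 1 / p * p = 1 := by field_simp
    rw [e2, e3, ENNReal.rpow_one]
    refine mul_le_mul' (ENNReal.rpow_le_rpow ?_ (by linarith)) ?_
    · refine le_trans (le_of_eq (lintegral_congr fun s => ?_)) (h1 t)
      rw [← ENNReal.rpow_mul, one_div_mul_cancel hq0.ne', ENNReal.rpow_one]
    · refine le_of_eq (lintegral_congr fun s => ?_)
      rw [ENNReal.mul_rpow_of_nonneg _ _ hp0.le, ← ENNReal.rpow_mul, e3, ENNReal.rpow_one]
  calc ∫⁻ t, (∫⁻ s, K t s * F s ∂μ) ^ p ∂μ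
      ≤ ∫⁻ t, c ^ (p - 1) * ∫⁻ s, K t s * F s ^ p ∂μ ∂μ := lintegral_mono key
    _ = c ^ (p - 1) * ∫⁻ t, ∫⁻ s, K t s * F s ^ p ∂μ ∂μ := by
        refine lintegral_const_mul'' _ ?_
        exact (hK.aemeasurable.mul (hF.pow_const p).comp_snd).lintegral_prod_right'
    _ = c ^ (p - 1) * ∫⁻ s, ∫⁻ t, K t s * F s ^ p ∂μ ∂μ := by
        rw [lintegral_lintegral_swap]
        exact hK.aemeasurable.mul (hF.pow_const p).comp_snd
    _ ≤ c ^ (p - 1) * ∫⁻ s, c * F s ^ p ∂μ := by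
        gcongr with s
        have hKs : Measurable fun t => K t s := hK.comp measurable_prodMk_right
        rw [lintegral_mul_const'' _ hKs.aemeasurable]
        gcongr
        exact h2 s
    _ = c ^ p * ∫⁻ s, F s ^ p ∂μ := by
        rw [lintegral_const_mul'' _ (hF.pow_const p), ← mul_assoc]
        congr 1
        nth_rewrite 2 [← ENNReal.rpow_one c]
        rw [← ENNReal.rpow_add_of_nonneg _ _ (by linarith) zero_le_one, sub_add_cancel]

/-- The causal convolution `∫ₐᵗ e^{-ν(t-s)} f(s) ds`. -/
noncomputable def expConv (ν a : ℝ) (f : ℝ → ℝ) (t : ℝ) : ℝ :=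
  ∫ s in a..t, Real.exp (-ν * (t - s)) * f s

/-- The common envelope of all trajectories: the decaying trace `X e^{-ν(t-t₀)}` of an initial
value plus the exponentially weighted past of the input. -/
noncomputable def envelope (ν t₀ X : ℝ) (f : ℝ → ℝ) (t : ℝ) : ℝ :=
  X * Real.exp (-ν * (t - t₀)) + expConv ν t₀ f t

theorem intervalIntegrable_exp_mul {ν t a b : ℝ} {f : ℝ → ℝ}
    (hf : IntervalIntegrable f volume a b) :
    IntervalIntegrable (fun s => Real.exp (-ν * (t - s)) * f s) volume a b :=
  hf.continuousOn_mul (by fun_prop)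

theorem integral_exp_sub {ν a t : ℝ} (hν : ν ≠ 0) :
    ∫ s in a..t, Real.exp (-ν * (t - s)) = (1 - Real.exp (-ν * (t - a))) / ν := by
  have : ∀ s ∈ Set.uIcc a t, HasDerivAt (fun s => Real.exp (-ν * (t - s)) / ν)
      (Real.exp (-ν * (t - s))) s := by
    intro s _
    have h1 : HasDerivAt (fun s : ℝ => -ν * (t - s)) ν s := by
      simpa using ((hasDerivAt_id s).const_sub t).const_mul (-ν)
    refine (h1.exp.div_const ν).congr_deriv ?_
    field_simp
  rw [intervalIntegral.integral_eq_sub_of_hasDerivAt this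
    ((by fun_prop : Continuous fun s => Real.exp (-ν * (t - s))).intervalIntegrable _ _)]
  simp [sub_div]

section Envelope

variable {ν lam t₀ a s t X : ℝ} {f : ℝ → ℝ}

theorem expConv_nonneg (hf : ∀ s, 0 ≤ f s) (h : a ≤ t) : 0 ≤ expConv ν a f t :=
  intervalIntegral.integral_nonneg h fun s _ => mul_nonneg (Real.exp_pos _).le (hf s)

theorem envelope_nonneg (hX : 0 ≤ X) (hf : ∀ s, 0 ≤ f s) (h : t₀ ≤ t) :
    0 ≤ envelope ν t₀ X f t :=
  add_nonneg (mul_nonneg hX (Real.exp_pos _).le) (expConv_nonneg hf h)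

theorem expConv_add_expConv (h : IntervalIntegrable f volume a s)
    (h' : IntervalIntegrable f volume s t) :
    Real.exp (-ν * (t - s)) * expConv ν a f s + expConv ν s f t = expConv ν a f t := by
  unfold expConv
  rw [← intervalIntegral.integral_const_mul]
  have : ∀ r, Real.exp (-ν * (t - s)) * (Real.exp (-ν * (s - r)) * f r) =
      Real.exp (-ν * (t - r)) * f r := fun r => by
    rw [← mul_assoc, ← Real.exp_add]; ring_nf
  simp only [this]
  exact intervalIntegral.integral_add_adjacent_intervals
    (intervalIntegrable_exp_mul h) (intervalIntegrable_exp_mul h')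

theorem envelope_eq (h : IntervalIntegrable f volume t₀ s)
    (h' : IntervalIntegrable f volume s t) :
    Real.exp (-ν * (t - s)) * envelope ν t₀ X f s + expConv ν s f t = envelope ν t₀ X f t := by
  unfold envelope
  rw [← expConv_add_expConv h h', mul_add, add_assoc, mul_left_comm, ← Real.exp_add]
  ring_nf

theorem exp_mul_envelope_le (hf : ∀ s, 0 ≤ f s) (h : IntervalIntegrable f volume t₀ s)
    (h' : IntervalIntegrable f volume s t) (hst : s ≤ t) :
    Real.exp (-ν * (t - s)) * envelope ν t₀ X f s ≤ envelope ν t₀ X f t := by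
  rw [← envelope_eq h h']
  linarith [expConv_nonneg (ν := ν) hf hst]

theorem expConv_anti (hf : ∀ s, 0 ≤ f s) (hν : ν ≤ lam) (h : t₀ ≤ a) (hat : a ≤ t)
    (h1 : IntervalIntegrable f volume t₀ t) :
    expConv lam a f t ≤ expConv ν t₀ f t := by
  have h2 : IntervalIntegrable f volume a t := h1.mono_set (by
    rw [Set.uIcc_of_le hat, Set.uIcc_of_le (h.trans hat)]
    exact Set.Icc_subset_Icc_left h)
  have h3 : IntervalIntegrable f volume t₀ a := h1.mono_set (by
    rw [Set.uIcc_of_le h, Set.uIcc_of_le (h.trans hat)]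
    exact Set.Icc_subset_Icc_right hat)
  have h4 : expConv lam a f t ≤ expConv ν a f t := by
    refine intervalIntegral.integral_mono_on hat (intervalIntegrable_exp_mul h2)
      (intervalIntegrable_exp_mul h2) fun s hs => ?_
    refine mul_le_mul_of_nonneg_right (Real.exp_le_exp.2 ?_) (hf s)
    nlinarith [hs.2]
  refine h4.trans ?_
  rw [← expConv_add_expConv h3 h2]
  have := mul_nonneg (Real.exp_pos (-ν * (t - a))).le (expConv_nonneg (ν := ν) hf h)
  linarith

theorem envelope_anti (hX : 0 ≤ X) (hf : ∀ s, 0 ≤ f s) (hν : ν ≤ lam) (h : t₀ ≤ t)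
    (h1 : IntervalIntegrable f volume t₀ t) :
    envelope lam t₀ X f t ≤ envelope ν t₀ X f t := by
  refine add_le_add (mul_le_mul_of_nonneg_left (Real.exp_le_exp.2 ?_) hX)
    (expConv_anti hf hν le_rfl h h1)
  nlinarith

theorem expConv_eq (ν a : ℝ) (f : ℝ → ℝ) (t : ℝ) :
    expConv ν a f t = Real.exp (-ν * t) * ∫ s in a..t, Real.exp (ν * s) * f s := by
  rw [← intervalIntegral.integral_const_mul]
  refine intervalIntegral.integral_congr fun s _ => ?_
  change _ = Real.exp (-ν * t) * (Real.exp (ν * s) * f s)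
  rw [← mul_assoc, ← Real.exp_add]
  ring_nf

theorem continuousOn_expConv (hf : IntervalIntegrable f volume a t) (h : a ≤ t) :
    ContinuousOn (expConv ν a f) (Set.Icc a t) := by
  have h1 : ContinuousOn (fun x => ∫ s in a..x, Real.exp (ν * s) * f s) (Set.Icc a t) := by
    have h2 : IntervalIntegrable (fun s => Real.exp (ν * s) * f s) volume a t :=
      hf.continuousOn_mul (by fun_prop)
    have := intervalIntegral.continuousOn_primitive_interval (f := fun s => Real.exp (ν * s) * f s)
      (a := a) (b := t) (μ := volume)
      (by rw [Set.uIcc_of_le h]; exact (intervalIntegrable_iff_integrableOn_Icc_of_le h).1 h2)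
    rwa [Set.uIcc_of_le h] at this
  refine ContinuousOn.congr (f := fun x => Real.exp (-ν * x) *
    ∫ s in a..x, Real.exp (ν * s) * f s) ?_ fun x _ => expConv_eq ν a f x
  exact ContinuousOn.mul (by fun_prop) h1

theorem continuousOn_envelope (hf : IntervalIntegrable f volume t₀ t) (h : t₀ ≤ t) :
    ContinuousOn (envelope ν t₀ X f) (Set.Icc t₀ t) :=
  ContinuousOn.add (by fun_prop) (continuousOn_expConv hf h)

/-- The envelope reproduces itself under convolution with a faster exponential. -/
theorem expConv_envelope_le (hX : 0 ≤ X) (hf : ∀ s, 0 ≤ f s) (hν : ν < lam) (h : t₀ ≤ a)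
    (hat : a ≤ t) (h1 : IntervalIntegrable f volume t₀ t) :
    expConv lam a (envelope ν t₀ X f) t ≤ (lam - ν)⁻¹ * envelope ν t₀ X f t := by
  have hc : ContinuousOn (envelope ν t₀ X f) (Set.Icc a t) :=
    (continuousOn_envelope h1 (h.trans hat)).mono (Set.Icc_subset_Icc_left h)
  have h2 : IntervalIntegrable (envelope ν t₀ X f) volume a t :=
    ContinuousOn.intervalIntegrable (by rwa [Set.uIcc_of_le hat])
  have hpos : 0 < lam - ν := sub_pos.2 hν
  have hE := envelope_nonneg (ν := ν) hX hf (h.trans hat)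
  calc expConv lam a (envelope ν t₀ X f) t
      ≤ ∫ s in a..t, Real.exp (-(lam - ν) * (t - s)) * envelope ν t₀ X f t := by
        refine intervalIntegral.integral_mono_on hat (intervalIntegrable_exp_mul h2)
          (Continuous.intervalIntegrable (by fun_prop) _ _) fun s hs => ?_
        have hs1 : IntervalIntegrable f volume t₀ s := h1.mono_set (by
          rw [Set.uIcc_of_le (h.trans hs.1), Set.uIcc_of_le (h.trans hat)]
          exact Set.Icc_subset_Icc_right hs.2)
        have hs2 : IntervalIntegrable f volume s t := h1.mono_set (by
          rw [Set.uIcc_of_le hs.2, Set.uIcc_of_le (h.trans hat)]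
          exact Set.Icc_subset_Icc_left (h.trans hs.1))
        have := exp_mul_envelope_le (ν := ν) (X := X) hf hs1 hs2 hs.2
        calc Real.exp (-lam * (t - s)) * envelope ν t₀ X f s
            = Real.exp (-(lam - ν) * (t - s)) *
              (Real.exp (-ν * (t - s)) * envelope ν t₀ X f s) := by
              rw [← mul_assoc, ← Real.exp_add]; ring_nf
          _ ≤ _ := by gcongr
    _ = (1 - Real.exp (-(lam - ν) * (t - a))) / (lam - ν) * envelope ν t₀ X f t := by
        rw [intervalIntegral.integral_mul_const, integral_exp_sub hpos.ne']
    _ ≤ (lam - ν)⁻¹ * envelope ν t₀ X f t := by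
        rw [inv_eq_one_div]
        gcongr
        linarith [Real.exp_pos (-(lam - ν) * (t - a))]

theorem expConv_add {g : ℝ → ℝ} (hf : IntervalIntegrable f volume a t)
    (hg : IntervalIntegrable g volume a t) :
    expConv ν a (fun s => f s + g s) t = expConv ν a f t + expConv ν a g t := by
  unfold expConv
  rw [← intervalIntegral.integral_add (intervalIntegrable_exp_mul hf)
    (intervalIntegrable_exp_mul hg)]
  simp only [mul_add]

theorem expConv_const_mul (c : ℝ) :
    expConv ν a (fun s => c * f s) t = c * expConv ν a f t := by
  unfold expConv
  rw [← intervalIntegral.integral_const_mul]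
  simp only [mul_left_comm]

theorem expConv_mono {g : ℝ → ℝ} (hat : a ≤ t) (hf : IntervalIntegrable f volume a t)
    (hg : IntervalIntegrable g volume a t) (h : ∀ s ∈ Set.Icc a t, f s ≤ g s) :
    expConv ν a f t ≤ expConv ν a g t :=
  intervalIntegral.integral_mono_on hat (intervalIntegrable_exp_mul hf)
    (intervalIntegrable_exp_mul hg) fun s hs =>
      mul_le_mul_of_nonneg_left (h s hs) (Real.exp_pos _).le

theorem expConv_le_of_le {U : ℝ} (hν : ν ≠ 0) (hat : a ≤ t) (hf : IntervalIntegrable f volume a t)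
    (h : ∀ s ∈ Set.Icc a t, f s ≤ U) :
    expConv ν a f t ≤ U * ((1 - Real.exp (-ν * (t - a))) / ν) := by
  refine (expConv_mono hat hf intervalIntegrable_const h).trans (le_of_eq ?_)
  unfold expConv
  rw [intervalIntegral.integral_mul_const, integral_exp_sub hν, mul_comm]

end Envelope

/-- Young's inequality for the causal exponential kernel on a bounded interval. -/
theorem eLpNorm_expConv_le {ν a b : ℝ} (hν : 0 < ν) {p : ℝ≥0∞} (hp : 1 ≤ p) {f : ℝ → ℝ}
    (hf : AEStronglyMeasurable f (volume.restrict (Set.Icc a b))) :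
    eLpNorm (expConv ν a f) p (volume.restrict (Set.Icc a b)) ≤
      ENNReal.ofReal (1 / ν) * eLpNorm f p (volume.restrict (Set.Icc a b)) := by
  set μ := volume.restrict (Set.Icc a b) with hμ
  set K : ℝ → ℝ → ℝ≥0∞ := fun t s =>
    (Set.Ici (0 : ℝ)).indicator (fun r => ENNReal.ofReal (Real.exp (-ν * r))) (t - s) with hK
  have hk : Measurable ((Set.Ici (0 : ℝ)).indicator
      (fun r => ENNReal.ofReal (Real.exp (-ν * r)))) :=
    Measurable.indicator (by fun_prop) measurableSet_Ici
  have hKm : Measurable (Function.uncurry K) := hk.comp (measurable_fst.sub measurable_snd)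
  have htot : ∫⁻ r, (Set.Ici (0 : ℝ)).indicator
      (fun r => ENNReal.ofReal (Real.exp (-ν * r))) r = ENNReal.ofReal (1 / ν) := by
    rw [lintegral_indicator measurableSet_Ici, Measure.restrict_congr_set Ioi_ae_eq_Ici.symm,
      ← ofReal_integral_eq_lintegral_ofReal]
    · congr 1
      have := integral_exp_mul_Ioi (a := -ν) (by linarith) 0
      simpa using this
    · exact integrableOn_exp_mul_Ioi (by linarith) 0
    · exact ae_of_all _ fun _ => (Real.exp_pos _).le
  have h1 : ∀ t, ∫⁻ s, K t s ∂μ ≤ ENNReal.ofReal (1 / ν) := fun t => by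
    refine (lintegral_mono' Measure.restrict_le_self le_rfl).trans ?_
    rw [← htot]
    exact (lintegral_sub_left_eq_self (μ := volume) ((Set.Ici (0 : ℝ)).indicator
      (fun r => ENNReal.ofReal (Real.exp (-ν * r)))) t).le
  have h2 : ∀ s, ∫⁻ t, K t s ∂μ ≤ ENNReal.ofReal (1 / ν) := fun s => by
    refine (lintegral_mono' Measure.restrict_le_self le_rfl).trans ?_
    rw [← htot]
    exact (lintegral_sub_right_eq_self (μ := volume) ((Set.Ici (0 : ℝ)).indicator
      (fun r => ENNReal.ofReal (Real.exp (-ν * r)))) s).le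
  have hle : ∀ t ∈ Set.Icc a b, ‖expConv ν a f t‖ₑ ≤ ∫⁻ s, K t s * ‖f s‖ₑ ∂μ := by
    intro t ht
    unfold expConv
    rw [intervalIntegral.integral_of_le ht.1]
    refine (enorm_integral_le_lintegral_enorm _).trans ?_
    rw [hμ]
    calc ∫⁻ s in Set.Ioc a t, ‖Real.exp (-ν * (t - s)) * f s‖ₑ
        = ∫⁻ s in Set.Ioc a t, K t s * ‖f s‖ₑ := by
          refine setLIntegral_congr_fun measurableSet_Ioc fun s hs => ?_
          simp only [hK]
          rw [Set.indicator_of_mem (by simpa using hs.2), enorm_mul,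
            Real.enorm_of_nonneg (Real.exp_pos _).le]
      _ ≤ _ := lintegral_mono_set (Set.Ioc_subset_Icc_self.trans (Set.Icc_subset_Icc_right ht.2))
  rcases eq_or_ne p ⊤ with rfl | hpt
  · rw [eLpNorm_exponent_top, eLpNorm_exponent_top]
    refine eLpNormEssSup_le_of_ae_enorm_bound ?_
    refine (ae_restrict_iff' measurableSet_Icc).2 (ae_of_all _ fun t ht => (hle t ht).trans ?_)
    calc ∫⁻ s, K t s * ‖f s‖ₑ ∂μ ≤ ∫⁻ s, K t s * eLpNormEssSup f μ ∂μ := by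
          refine lintegral_mono_ae ?_
          filter_upwards [ae_le_eLpNormEssSup (f := f) (μ := μ)] with s hs
          gcongr
      _ = (∫⁻ s, K t s ∂μ) * eLpNormEssSup f μ :=
          lintegral_mul_const _ (hKm.comp measurable_prodMk_left)
      _ ≤ _ := by gcongr; exact h1 t
  · have hp0 : p ≠ 0 := (zero_lt_one.trans_le hp).ne'
    have hpr : 1 ≤ p.toReal := by
      have := ENNReal.toReal_mono hpt hp
      simpa using this
    have hpr0 : 0 < p.toReal := by linarith
    rw [eLpNorm_eq_lintegral_rpow_enorm_toReal hp0 hpt,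
      eLpNorm_eq_lintegral_rpow_enorm_toReal hp0 hpt]
    have hS := lintegral_rpow_lintegral_mul_le hKm hf.enorm h1 h2 hpr
    have h3 : ∫⁻ t, ‖expConv ν a f t‖ₑ ^ p.toReal ∂μ ≤
        ENNReal.ofReal (1 / ν) ^ p.toReal * ∫⁻ s, ‖f s‖ₑ ^ p.toReal ∂μ := by
      refine le_trans (setLIntegral_mono_ae' measurableSet_Icc ?_) hS
      exact ae_of_all _ fun t ht => ENNReal.rpow_le_rpow (hle t ht) hpr0.le
    refine (ENNReal.rpow_le_rpow h3 (by positivity)).trans (le_of_eq ?_)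
    rw [ENNReal.mul_rpow_of_nonneg _ _ (by positivity), ← ENNReal.rpow_mul,
      mul_one_div_cancel hpr0.ne', ENNReal.rpow_one]

theorem exists_eLpNorm_exp_le {ν : ℝ} (hν : 0 < ν) (p : ℝ≥0∞) :
    ∃ B : ℝ, 0 ≤ B ∧ ∀ a b : ℝ, eLpNorm (fun t => Real.exp (-ν * (t - a))) p
      (volume.restrict (Set.Icc a b)) ≤ ENNReal.ofReal B := by
  rcases eq_or_ne p 0 with rfl | hp0
  · exact ⟨0, le_rfl, fun a b => by simp⟩
  rcases eq_or_ne p ⊤ with rfl | hpt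
  · refine ⟨1, zero_le_one, fun a b => ?_⟩
    rw [eLpNorm_exponent_top]
    refine eLpNormEssSup_le_of_ae_enorm_bound ((ae_restrict_iff' measurableSet_Icc).2
      (ae_of_all _ fun t ht => ?_))
    rw [Real.enorm_of_nonneg (Real.exp_pos _).le]
    refine ENNReal.ofReal_le_ofReal (Real.exp_le_one_iff.2 ?_)
    nlinarith [ht.1]
  have hpr0 : 0 < p.toReal := ENNReal.toReal_pos hp0 hpt
  refine ⟨(1 / (ν * p.toReal)) ^ (1 / p.toReal), by positivity, fun a b => ?_⟩
  rw [eLpNorm_eq_lintegral_rpow_enorm_toReal hp0 hpt,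
    ← ENNReal.ofReal_rpow_of_pos (by positivity)]
  refine ENNReal.rpow_le_rpow ?_ (by positivity)
  have e1 : ∀ t, ‖Real.exp (-ν * (t - a))‖ₑ ^ p.toReal =
      ENNReal.ofReal (Real.exp (ν * p.toReal * a) * Real.exp (-(ν * p.toReal) * t)) := fun t => by
    rw [Real.enorm_of_nonneg (Real.exp_pos _).le, ENNReal.ofReal_rpow_of_pos (Real.exp_pos _),
      ← Real.exp_mul, ← Real.exp_add]
    ring_nf
  simp only [e1]
  have hneg : -(ν * p.toReal) < 0 := by have := mul_pos hν hpr0; linarith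
  calc ∫⁻ t in Set.Icc a b, ENNReal.ofReal (Real.exp (ν * p.toReal * a) *
          Real.exp (-(ν * p.toReal) * t))
      ≤ ∫⁻ t in Set.Ici a, ENNReal.ofReal (Real.exp (ν * p.toReal * a) *
          Real.exp (-(ν * p.toReal) * t)) := lintegral_mono_set fun t ht => ht.1
    _ = ENNReal.ofReal (1 / (ν * p.toReal)) := by
        rw [Measure.restrict_congr_set Ioi_ae_eq_Ici.symm, ← ofReal_integral_eq_lintegral_ofReal]
        · rw [integral_const_mul, integral_exp_mul_Ioi hneg]
          congr 1
          rw [mul_div_assoc', mul_neg, ← Real.exp_add]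
          rw [show ν * p.toReal * a + -(ν * p.toReal) * a = 0 by ring, Real.exp_zero]
          rw [neg_div_neg_eq]
        · exact (integrableOn_exp_mul_Ioi hneg a).const_mul _
        · exact ae_of_all _ fun _ => by positivity

/-- An envelope is bounded in `L_p` by the input and the initial value. -/
theorem exists_eLpNorm_envelope_le {ν : ℝ} (hν : 0 < ν) {p : ℝ≥0∞} (hp : 1 ≤ p) :
    ∃ B : ℝ, 0 ≤ B ∧ ∀ (t₀ b X : ℝ) (f : ℝ → ℝ), 0 ≤ X → t₀ ≤ b →
      IntervalIntegrable f volume t₀ b →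
      eLpNorm (envelope ν t₀ X f) p (volume.restrict (Set.Icc t₀ b)) ≤
        ENNReal.ofReal (1 / ν) * eLpNorm f p (volume.restrict (Set.Icc t₀ b)) +
          ENNReal.ofReal (B * X) := by
  obtain ⟨B, hB, H⟩ := exists_eLpNorm_exp_le hν p
  refine ⟨B, hB, fun t₀ b X f hX h hf => ?_⟩
  have hfm : AEStronglyMeasurable f (volume.restrict (Set.Icc t₀ b)) :=
    ((intervalIntegrable_iff_integrableOn_Icc_of_le h).1 hf).aestronglyMeasurable
  have e : envelope ν t₀ X f = (X • fun t => Real.exp (-ν * (t - t₀))) + expConv ν t₀ f := by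
    ext t; simp [envelope]
  rw [e, add_comm]
  refine (eLpNorm_add_le ((continuousOn_expConv hf h).aestronglyMeasurable measurableSet_Icc)
    (Continuous.aestronglyMeasurable (by fun_prop)) hp).trans ?_
  refine add_le_add (eLpNorm_expConv_le hν hp hfm) ?_
  rw [eLpNorm_const_smul, Real.enorm_of_nonneg hX, mul_comm B X, ENNReal.ofReal_mul hX]
  gcongr
  exact H t₀ b

/-! ### Hurwitz matrices generate exponentially decaying semigroups -/

/-- If the exponential of `T` has spectral radius below one, then Gelfand's formula makes some power
of it a contraction, and the semigroup generated by `T` decays exponentially. -/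
theorem exists_norm_exp_smul_le {𝔸 : Type*} [NormedRing 𝔸] [NormedAlgebra ℂ 𝔸] [CompleteSpace 𝔸]
    (T : 𝔸) (hT : spectralRadius ℂ (NormedSpace.exp T) < 1) :
    ∃ κ lam : ℝ, 0 < κ ∧ 0 < lam ∧ ∀ s : ℝ, 0 ≤ s →
      ‖NormedSpace.exp (s • T)‖ ≤ κ * Real.exp (-lam * s) := by
  let _ : NormedAlgebra ℚ 𝔸 := NormedAlgebra.restrictScalars ℚ ℂ 𝔸
  have hG := spectrum.pow_nnnorm_pow_one_div_tendsto_nhds_spectralRadius (NormedSpace.exp T)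
  obtain ⟨n, hn1, hn⟩ := ((hG.eventually (gt_mem_nhds hT)).and (eventually_ge_atTop 1)).exists
  have hn0 : (0 : ℝ) < n := by exact_mod_cast hn
  have hlt : ‖NormedSpace.exp T ^ n‖ < 1 := by
    by_contra hcon
    push Not at hcon
    refine absurd hn1 (not_lt.2 ?_)
    refine ENNReal.one_le_rpow ?_ (by positivity)
    exact_mod_cast hcon
  set q : ℝ := max ‖NormedSpace.exp T ^ n‖ (1 / 2) with hq
  have hq0 : 0 < q := lt_max_of_lt_right (by norm_num)
  have hq1 : q < 1 := max_lt hlt (by norm_num)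
  have hc : Continuous fun s : ℝ => NormedSpace.exp (s • T) :=
    NormedSpace.exp_continuous.comp (by fun_prop)
  obtain ⟨K, hK⟩ := isCompact_Icc.exists_bound_of_continuousOn
    (s := Set.Icc (0 : ℝ) n) hc.continuousOn
  have hK0 : 0 ≤ K := (norm_nonneg _).trans (hK 0 ⟨le_rfl, hn0.le⟩)
  set lam : ℝ := -Real.log q / n with hlam
  have hlam0 : 0 < lam := div_pos (neg_pos.2 (Real.log_neg hq0 hq1)) hn0
  refine ⟨(K + 1) * Real.exp (lam * n), lam, by positivity, hlam0, fun s hs => ?_⟩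
  set k : ℕ := ⌊s / n⌋₊ with hk
  set r : ℝ := s - k * n with hr
  have hr0 : 0 ≤ r := by
    have := Nat.floor_le (div_nonneg hs hn0.le)
    rw [le_div_iff₀ hn0] at this
    exact sub_nonneg.2 this
  have hrn : r ≤ n := by
    have := (Nat.lt_floor_add_one (s / n)).le
    rw [div_le_iff₀ hn0] at this
    rw [hr]; linarith
  have hdec : NormedSpace.exp (s • T) = (NormedSpace.exp T ^ n) ^ k * NormedSpace.exp (r • T) := by
    rw [← pow_mul, ← NormedSpace.exp_nsmul, ← NormedSpace.exp_add_of_commute]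
    · congr 1
      rw [← Nat.cast_smul_eq_nsmul ℝ, ← add_smul]
      congr 1
      push_cast
      rw [hr]; ring
    · rw [← Nat.cast_smul_eq_nsmul ℝ]
      exact ((Commute.refl T).smul_left _).smul_right _
  have hexp : q = Real.exp (-lam * n) := by
    rw [hlam]
    have : -(-Real.log q / n) * n = Real.log q := by field_simp
    rw [this, Real.exp_log hq0]
  have hpow : ‖(NormedSpace.exp T ^ n) ^ k * NormedSpace.exp (r • T)‖ ≤ q ^ k * K := by
    have h1 : ∀ k : ℕ, ‖(NormedSpace.exp T ^ n) ^ k * NormedSpace.exp (r • T)‖ ≤ q ^ k * K := by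
      intro k
      induction k with
      | zero => simpa using hK r ⟨hr0, hrn⟩
      | succ k ih =>
        rw [pow_succ', mul_assoc, pow_succ', mul_assoc]
        exact (norm_mul_le _ _).trans
          (mul_le_mul (le_max_left _ _) ih (norm_nonneg _) hq0.le)
    exact h1 k
  rw [hdec]
  refine hpow.trans ?_
  have e1 : q ^ k = Real.exp (lam * r) * Real.exp (-lam * s) := by
    rw [hexp, ← Real.exp_nat_mul, ← Real.exp_add]
    congr 1
    rw [hr]; ring
  have e2 : Real.exp (lam * r) ≤ Real.exp (lam * n) := Real.exp_le_exp.2 (by gcongr)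
  calc q ^ k * K = Real.exp (lam * r) * K * Real.exp (-lam * s) := by rw [e1]; ring
    _ ≤ Real.exp (lam * n) * (K + 1) * Real.exp (-lam * s) := by gcongr; linarith
    _ = _ := by ring

/-- Every spectral value of `exp T` on a finite-dimensional space is the exponential of a spectral
value of `T`: an eigenspace of `exp T` is invariant under `T` and thus contains an eigenvector of
`T`. -/
theorem exists_exp_eq_of_mem_spectrum_exp {V : Type*} [NormedAddCommGroup V] [NormedSpace ℂ V]
    [FiniteDimensional ℂ V] (T : V →L[ℂ] V) {z : ℂ}
    (hz : z ∈ spectrum ℂ (NormedSpace.exp T)) : ∃ w ∈ spectrum ℂ T, z = Complex.exp w := by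
  have : CompleteSpace V := FiniteDimensional.complete ℂ V
  let _ : NormedAlgebra ℚ (V →L[ℂ] V) := NormedAlgebra.restrictScalars ℚ ℂ _
  have hspec : ∀ S : V →L[ℂ] V, spectrum ℂ S = spectrum ℂ (S : V →ₗ[ℂ] V) := fun S =>
    (AlgEquiv.spectrum_eq (Module.End.toContinuousLinearMap V).symm S).symm
  rw [hspec, ← Module.End.hasEigenvalue_iff_mem_spectrum] at hz
  set W := Module.End.eigenspace (NormedSpace.exp T : V →L[ℂ] V).toLinearMap z with hW
  have hcomm : Commute (NormedSpace.exp T : V →L[ℂ] V).toLinearMap T.toLinearMap := by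
    have h : Commute (NormedSpace.exp T) T := (Commute.refl T).exp_left
    exact congrArg ContinuousLinearMap.toLinearMap h.eq
  have hinv : ∀ x ∈ W, T.toLinearMap x ∈ W :=
    Module.End.mapsTo_genEigenspace_of_comm hcomm z 1
  have : Nontrivial W := Submodule.nontrivial_iff_ne_bot.2 hz
  obtain ⟨w, hw⟩ := Module.End.exists_eigenvalue (T.toLinearMap.restrict hinv)
  obtain ⟨x, hx⟩ := hw.exists_hasEigenvector
  have hTx : T x = w • (x : V) := congrArg Subtype.val hx.apply_eq_smul
  have hx0 : (x : V) ≠ 0 := fun h => hx.2 (Subtype.ext h)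
  refine ⟨w, ?_, ?_⟩
  · rw [hspec, ← Module.End.hasEigenvalue_iff_mem_spectrum]
    exact Module.End.hasEigenvalue_of_hasEigenvector
      ((Module.End.hasEigenvector_iff).2 ⟨Module.End.mem_eigenspace_iff.2 hTx, hx0⟩)
  · have hpow : ∀ n : ℕ, (T ^ n) (x : V) = w ^ n • (x : V) := by
      intro n
      induction n with
      | zero => simp
      | succ n ih => rw [pow_succ', mul_apply_eq_comp, ih, map_smul, hTx, smul_smul,
          pow_succ]
    have h1 := (ContinuousLinearMap.apply ℂ V (x : V)).hasSum
      (NormedSpace.exp_series_hasSum_exp' (𝕂 := ℂ) T)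
    have h2 := ((ContinuousLinearMap.id ℂ ℂ).smulRight (x : V)).hasSum
      (NormedSpace.exp_series_hasSum_exp' (𝕂 := ℂ) w)
    have h3 : NormedSpace.exp T (x : V) = NormedSpace.exp w • (x : V) := by
      refine HasSum.unique (L := .unconditional ℕ)
        (f := fun n : ℕ => ((n.factorial : ℂ)⁻¹ * w ^ n) • (x : V)) ?_ ?_
      · simpa [hpow, smul_smul] using h1
      · simpa using h2
    have h4 : NormedSpace.exp T (x : V) = z • (x : V) := Module.End.mem_eigenspace_iff.1 x.2
    rw [Complex.exp_eq_exp_ℂ]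
    exact smul_left_injective ℂ hx0 (h4.symm.trans h3)

section MatrixExponential

variable {ι : Type*} [Fintype ι] [DecidableEq ι]

/-- The continuous linear map `act M` between Euclidean spaces. -/
noncomputable def actL {m n : Type*} [Fintype m] [Fintype n] [DecidableEq n] (M : Matrix m n ℝ) :
    EuclideanSpace ℝ n →L[ℝ] EuclideanSpace ℝ m :=
  (Matrix.toEuclideanLin M).toContinuousLinearMap

theorem actL_exp (M : Matrix ι ι ℝ) : actL (NormedSpace.exp M) = NormedSpace.exp (actL M) := by
  let _ : NormedRing (Matrix ι ι ℝ) := Matrix.linftyOpNormedRing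
  let _ : NormedAlgebra ℚ (Matrix ι ι ℝ) := Matrix.linftyOpNormedAlgebra
  let _ : NormedAlgebra ℝ (Matrix ι ι ℝ) := Matrix.linftyOpNormedAlgebra
  have : CompleteSpace (Matrix ι ι ℝ) := FiniteDimensional.complete ℝ _
  let _ : NormedAlgebra ℚ (EuclideanSpace ℝ ι →L[ℝ] EuclideanSpace ℝ ι) :=
    NormedAlgebra.restrictScalars ℚ ℝ _
  let f := Matrix.toEuclideanCLM (n := ι) (𝕜 := ℝ)
  have hf : Continuous f := LinearMap.continuous_of_finiteDimensional
    (f.toAlgEquiv.toLinearMap)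
  exact NormedSpace.map_exp f hf M

theorem toEuclideanCLM_map_exp (M : Matrix ι ι ℝ) :
    Matrix.toEuclideanCLM (n := ι) (𝕜 := ℂ) ((NormedSpace.exp M).map (algebraMap ℝ ℂ)) =
      NormedSpace.exp (Matrix.toEuclideanCLM (n := ι) (𝕜 := ℂ) (M.map (algebraMap ℝ ℂ))) := by
  let _ : NormedRing (Matrix ι ι ℝ) := Matrix.linftyOpNormedRing
  let _ : NormedAlgebra ℚ (Matrix ι ι ℝ) := Matrix.linftyOpNormedAlgebra
  let _ : NormedAlgebra ℝ (Matrix ι ι ℝ) := Matrix.linftyOpNormedAlgebra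
  have : CompleteSpace (Matrix ι ι ℝ) := FiniteDimensional.complete ℝ _
  let _ : NormedAlgebra ℚ (EuclideanSpace ℂ ι →L[ℂ] EuclideanSpace ℂ ι) :=
    NormedAlgebra.restrictScalars ℚ ℂ _
  let g := Matrix.toEuclideanCLM (n := ι) (𝕜 := ℂ)
  let φ : Matrix ι ι ℝ →+* (EuclideanSpace ℂ ι →L[ℂ] EuclideanSpace ℂ ι) :=
    (g : Matrix ι ι ℂ →+* _).comp (algebraMap ℝ ℂ).mapMatrix
  have hφ : Continuous φ := by
    have h2 : Continuous g := LinearMap.continuous_of_finiteDimensional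
      (g.toAlgEquiv.toLinearMap)
    have h3 : Continuous fun A : Matrix ι ι ℝ => A.map (algebraMap ℝ ℂ) :=
      continuous_id.matrix_map Complex.continuous_ofReal
    exact h2.comp h3
  exact NormedSpace.map_exp φ hφ M

theorem opNorm_le_norm_complex (M : Matrix ι ι ℝ) :
    opNorm M ≤ ‖Matrix.toEuclideanCLM (n := ι) (𝕜 := ℂ) (M.map (algebraMap ℝ ℂ))‖ := by
  refine ContinuousLinearMap.opNorm_le_bound _ (norm_nonneg _) fun x => ?_
  have hn : ∀ y : EuclideanSpace ℝ ι,
      ‖(WithLp.toLp 2 fun i => ((y i : ℝ) : ℂ) : EuclideanSpace ℂ ι)‖ = ‖y‖ := fun y => by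
    simp [EuclideanSpace.norm_eq]
  have h := ContinuousLinearMap.le_opNorm
    (Matrix.toEuclideanCLM (n := ι) (𝕜 := ℂ) (M.map (algebraMap ℝ ℂ)))
    (WithLp.toLp 2 fun i => ((x i : ℝ) : ℂ))
  rw [hn x] at h
  refine le_trans (le_of_eq ?_) h
  rw [← hn]
  congr 1
  ext i
  simp [Matrix.mulVec, dotProduct]

/-- A Hurwitz matrix generates an exponentially decaying semigroup. -/
theorem IsHurwitz.exists_opNorm_exp_le [Nonempty ι] {M : Matrix ι ι ℝ} (hM : IsHurwitz M) :
    ∃ κ lam : ℝ, 0 < κ ∧ 0 < lam ∧ ∀ s : ℝ, 0 ≤ s →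
      opNorm (NormedSpace.exp (s • M)) ≤ κ * Real.exp (-lam * s) := by
  set T := Matrix.toEuclideanCLM (n := ι) (𝕜 := ℂ) (M.map (algebraMap ℝ ℂ)) with hT
  have hrad : spectralRadius ℂ (NormedSpace.exp T) < 1 := by
    refine spectrum.spectralRadius_lt_of_forall_lt (r := 1) _ fun z hz => ?_
    obtain ⟨w, hw, rfl⟩ := exists_exp_eq_of_mem_spectrum_exp T hz
    have hw' : w ∈ spectrum ℂ (M.map (algebraMap ℝ ℂ)) := by
      rw [← AlgEquiv.spectrum_eq (Matrix.toEuclideanCLM (n := ι) (𝕜 := ℂ)).toAlgEquiv]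
      exact hw
    have h1 : ‖Complex.exp w‖ < 1 := by
      rw [Complex.norm_exp, Real.exp_lt_one_iff]
      exact hM w hw'
    exact_mod_cast h1
  obtain ⟨κ, lam, hκ, hlam, H⟩ := exists_norm_exp_smul_le T hrad
  refine ⟨κ, lam, hκ, hlam, fun s hs => ?_⟩
  refine (opNorm_le_norm_complex _).trans ?_
  rw [toEuclideanCLM_map_exp]
  refine le_trans (le_of_eq ?_) (H s hs)
  congr 2
  rw [hT, RCLike.real_smul_eq_coe_smul (K := ℂ) s T, hT, ← map_smul]
  congr 1
  ext i j
  simp [Matrix.map_apply]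

end MatrixExponential

/-! ### Decay of the slow and fast modes of the damped network -/

theorem intervalIntegrable_clm_apply {E F : Type*} [NormedAddCommGroup E] [NormedSpace ℝ E]
    [NormedAddCommGroup F] [NormedSpace ℝ F] {L : ℝ → E →L[ℝ] F} {z : ℝ → E} {a b K : ℝ}
    (hL : IntervalIntegrable L volume a b) (hK : ∀ s, ‖L s‖ ≤ K)
    (hz : IntervalIntegrable z volume a b) :
    IntervalIntegrable (fun s => L s (z s)) volume a b := by
  refine IntervalIntegrable.mono_fun (hz.norm.const_mul K) ?_ ?_
  · exact (ContinuousLinearMap.id ℝ (E →L[ℝ] F)).aestronglyMeasurable_comp₂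
      hL.def'.aestronglyMeasurable hz.def'.aestronglyMeasurable
  · refine ae_of_all _ fun s => ?_
    have : 0 ≤ K := (norm_nonneg _).trans (hK s)
    simp only [norm_mul, norm_norm, Real.norm_of_nonneg this]
    exact (L s).le_of_opNorm_le (hK s) _

/-- Decay of a strongly damped component: variation of constants for `v' = -γ v + d`. -/
theorem norm_le_exp_add_expConv {V : Type*} [NormedAddCommGroup V] [NormedSpace ℝ V]
    [CompleteSpace V] {v d : ℝ → V} {γ a b : ℝ} (hab : a ≤ b)
    (hc : ContinuousOn v (Set.Icc a b)) (hd : IntervalIntegrable d volume a b)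
    (hv : ∀ t ∈ Set.Icc a b, v t = v a + ∫ s in a..t, (-(γ • v s) + d s)) :
    ‖v b‖ ≤ Real.exp (-γ * (b - a)) * ‖v a‖ + expConv γ a (fun s => ‖d s‖) b := by
  have hexp : ∀ (s : ℝ) (z : V), NormedSpace.exp (s • ((-γ) • (1 : V →L[ℝ] V))) z =
      Real.exp (-γ * s) • z := by
    intro s z
    let _ : NormedAlgebra ℚ (V →L[ℝ] V) := NormedAlgebra.restrictScalars ℚ ℝ _
    have h := NormedSpace.map_exp (algebraMap ℝ (V →L[ℝ] V)) (algebraMapCLM ℝ _).continuous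
      (-γ * s)
    rw [← Real.exp_eq_exp_ℝ] at h
    rw [smul_smul, mul_comm s, ← Algebra.algebraMap_eq_smul_one, ← h,
      Algebra.algebraMap_eq_smul_one]
    simp
  have h := eq_exp_add_integral (A := (-γ) • (1 : V →L[ℝ] V)) hab hc hd (fun t ht => by
    rw [hv t ht]; simp)
  simp only [hexp] at h
  rw [h]
  refine (norm_add_le _ _).trans (add_le_add ?_ ?_)
  · rw [norm_smul, Real.norm_of_nonneg (Real.exp_pos _).le]
  · refine (intervalIntegral.norm_integral_le_integral_norm hab).trans (le_of_eq ?_)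
    refine intervalIntegral.integral_congr fun s _ => ?_
    simp only [norm_smul, Real.norm_of_nonneg (Real.exp_pos _).le]

/-- The disagreement `y` and the velocity `v` solve `y' = Q v`, `v' = -γ v - α L y + b` in
integrated form, with a contraction `Q` and time-varying couplings `L` bounded by `Λ`. -/
structure IsDampedFlow {E V : Type*} [NormedAddCommGroup E] [InnerProductSpace ℝ E]
    [NormedAddCommGroup V] [NormedSpace ℝ V] (Q : V →L[ℝ] E) (L : ℝ → E →L[ℝ] V)
    (α γ Λ t₀ : ℝ) (y : ℝ → E) (v b : ℝ → V) : Prop where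
  norm_Q_le : ∀ z, ‖Q z‖ ≤ ‖z‖
  norm_L_le : ∀ s, ‖L s‖ ≤ Λ
  cont_y : ContinuousOn y (Set.Ici t₀)
  cont_v : ContinuousOn v (Set.Ici t₀)
  int_L : ∀ a t, t₀ ≤ a → a ≤ t → IntervalIntegrable L volume a t
  int_b : ∀ a t, t₀ ≤ a → a ≤ t → IntervalIntegrable b volume a t
  eqn_y : ∀ a t, t₀ ≤ a → a ≤ t → y t = y a + ∫ s in a..t, Q (v s)
  eqn_v : ∀ a t, t₀ ≤ a → a ≤ t →
    v t = v a + ∫ s in a..t, (-(γ • v s) + (-(α • L s (y s)) + b s))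

namespace IsDampedFlow

variable {E V : Type*} [NormedAddCommGroup E] [InnerProductSpace ℝ E]
  [NormedAddCommGroup V] [NormedSpace ℝ V] {Q : V →L[ℝ] E} {L : ℝ → E →L[ℝ] V}
  {α γ Λ t₀ μ T : ℝ} {y : ℝ → E} {v b : ℝ → V}

/-- The slow coordinate `y + Q v / γ`, which the strong damping does not act upon. -/
noncomputable def slow (Q : V →L[ℝ] E) (γ : ℝ) (y : ℝ → E) (v : ℝ → V) (t : ℝ) : E :=
  y t + (1 / γ) • Q (v t)

/-- The size of the state in the slow and fast coordinates. -/
noncomputable def size (Q : V →L[ℝ] E) (γ : ℝ) (y : ℝ → E) (v : ℝ → V) (t : ℝ) : ℝ :=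
  ‖slow Q γ y v t‖ + ‖v t‖ / γ

theorem size_nonneg (hγ : 0 < γ) (t : ℝ) : 0 ≤ size Q γ y v t := by
  unfold size; positivity

variable (hF : IsDampedFlow Q L α γ Λ t₀ y v b) (hα : 0 < α) (hγ : 0 < γ)

include hF in
theorem cont_slow : ContinuousOn (slow Q γ y v) (Set.Ici t₀) :=
  hF.cont_y.add ((Q.continuous.comp_continuousOn hF.cont_v).const_smul _)

include hF in
theorem cont_size : ContinuousOn (size Q γ y v) (Set.Ici t₀) :=
  hF.cont_slow.norm.add (hF.cont_v.norm.div_const _)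

include hF hγ in
theorem norm_smul_Q_le (z : V) : ‖(1 / γ) • Q z‖ ≤ ‖z‖ / γ := by
  rw [norm_smul, Real.norm_of_nonneg (by positivity), one_div_mul_eq_div]
  gcongr
  exact hF.norm_Q_le _

include hF hγ in
theorem norm_y_le (t : ℝ) : ‖y t‖ ≤ size Q γ y v t := by
  have e : y t = slow Q γ y v t - (1 / γ) • Q (v t) := by simp [slow]
  rw [e]
  refine (norm_sub_le _ _).trans ?_
  unfold size
  gcongr
  exact hF.norm_smul_Q_le hγ _

include hF in
theorem nonneg_bound : 0 ≤ Λ := (norm_nonneg _).trans (hF.norm_L_le 0)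

theorem _root_.ContinuousOn.intervalIntegrable_of_Ici {F : Type*} [NormedAddCommGroup F]
    {f : ℝ → F} {t₀ a t : ℝ} (hf : ContinuousOn f (Set.Ici t₀)) (ha : t₀ ≤ a) (hat : a ≤ t) :
    IntervalIntegrable f volume a t :=
  (hf.mono (by rw [Set.uIcc_of_le hat]; exact fun s hs => ha.trans hs.1)).intervalIntegrable

include hF in
theorem int_coupling {z : ℝ → E} (hz : ContinuousOn z (Set.Ici t₀)) {a t : ℝ} (ha : t₀ ≤ a)
    (hat : a ≤ t) : IntervalIntegrable (fun s => L s (z s)) volume a t :=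
  intervalIntegrable_clm_apply (hF.int_L a t ha hat) hF.norm_L_le
    (hz.intervalIntegrable_of_Ici ha hat)

include hF hα hγ in
theorem norm_drift_le (s : ℝ) (z : E) :
    ‖-((α / γ) • Q (L s z)) + (1 / γ) • Q (b s)‖ ≤ α / γ * Λ * ‖z‖ + ‖b s‖ / γ := by
  refine (norm_add_le _ _).trans (add_le_add ?_ ?_)
  · rw [norm_neg, norm_smul, Real.norm_of_nonneg (by positivity), mul_assoc]
    gcongr
    exact (hF.norm_Q_le _).trans ((L s).le_of_opNorm_le (hF.norm_L_le s) _)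
  · exact hF.norm_smul_Q_le hγ _

include hF in
theorem int_norm_b {a t : ℝ} (ha : t₀ ≤ a) (hat : a ≤ t) :
    IntervalIntegrable (fun s => ‖b s‖ / γ) volume a t :=
  (hF.int_b a t ha hat).norm.div_const γ

include hF in
theorem int_drive {a t : ℝ} (ha : t₀ ≤ a) (hat : a ≤ t) :
    IntervalIntegrable (fun s => α / γ * Λ * size Q γ y v s + ‖b s‖ / γ) volume a t :=
  ((hF.cont_size.intervalIntegrable_of_Ici ha hat).const_mul _).add (hF.int_norm_b ha hat)

variable [CompleteSpace E] [CompleteSpace V]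

include hF hγ in
theorem slow_eq {a t : ℝ} (ha : t₀ ≤ a) (hat : a ≤ t) :
    slow Q γ y v t = slow Q γ y v a +
      ∫ s in a..t, (-((α / γ) • Q (L s (y s))) + (1 / γ) • Q (b s)) := by
  have i1 := hF.cont_v.intervalIntegrable_of_Ici ha hat
  have i2 := hF.int_coupling hF.cont_y ha hat
  have i3 := hF.int_b a t ha hat
  have j2 : IntervalIntegrable (fun s => -(α • L s (y s)) + b s) volume a t :=
    (i2.smul α).neg.add i3
  have j3 : IntervalIntegrable (fun s => -(γ • v s) + (-(α • L s (y s)) + b s)) volume a t :=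
    (i1.smul γ).neg.add j2
  have hQ : ∀ {g : ℝ → V}, IntervalIntegrable g volume a t →
      IntervalIntegrable (fun s => Q (g s)) volume a t := fun hg => by
    exact ⟨Q.integrable_comp hg.1, Q.integrable_comp hg.2⟩
  have e1 : Q (v t) = Q (v a) + ∫ s in a..t, Q (-(γ • v s) + (-(α • L s (y s)) + b s)) := by
    rw [Q.intervalIntegral_comp_comm j3, ← map_add, ← hF.eqn_v a t ha hat]
  have j4 : IntervalIntegrable
      (fun s => (1 / γ) • Q (-(γ • v s) + (-(α • L s (y s)) + b s))) volume a t :=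
    (hQ j3).smul _
  unfold slow
  rw [hF.eqn_y a t ha hat, e1, smul_add, ← intervalIntegral.integral_smul,
    add_add_add_comm, ← intervalIntegral.integral_add (hQ i1) j4]
  congr 1
  refine intervalIntegral.integral_congr fun s _ => ?_
  simp only [map_add, map_neg, map_smul, smul_add, smul_neg, smul_smul]
  rw [one_div_mul_cancel hγ.ne', one_smul, one_div_mul_eq_div]
  abel

include hF hα hγ in
theorem norm_slow_sub_le {a t : ℝ} (ha : t₀ ≤ a) (hat : a ≤ t) :
    ‖slow Q γ y v t - slow Q γ y v a‖ ≤
      ∫ s in a..t, (α / γ * Λ * size Q γ y v s + ‖b s‖ / γ) := by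
  rw [hF.slow_eq hγ ha hat, add_sub_cancel_left]
  refine intervalIntegral.norm_integral_le_of_norm_le hat
    (ae_of_all _ fun s _ => (hF.norm_drift_le hα hγ s (y s)).trans ?_) (hF.int_drive ha hat)
  have := hF.nonneg_bound
  gcongr
  exact hF.norm_y_le hγ s

omit [CompleteSpace E] in
include hF hα hγ in
theorem norm_fast_le {a t : ℝ} (ha : t₀ ≤ a) (hat : a ≤ t) :
    ‖v t‖ / γ ≤ Real.exp (-γ * (t - a)) * (‖v a‖ / γ) +
      expConv γ a (fun s => α / γ * Λ * size Q γ y v s + ‖b s‖ / γ) t := by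
  have i2 := hF.int_coupling hF.cont_y ha hat
  have i3 := hF.int_b a t ha hat
  have j2 : IntervalIntegrable (fun s => -(α • L s (y s)) + b s) volume a t :=
    (i2.smul α).neg.add i3
  have h := norm_le_exp_add_expConv hat (hF.cont_v.mono fun s hs => ha.trans hs.1) j2
    (fun s hs => hF.eqn_v a s ha hs.1)
  have h2 : expConv γ a (fun s => ‖-(α • L s (y s)) + b s‖) t ≤
      expConv γ a (fun s => γ * (α / γ * Λ * size Q γ y v s + ‖b s‖ / γ)) t := by
    refine expConv_mono hat j2.norm ((hF.int_drive ha hat).const_mul γ) fun s _ => ?_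
    have h3 := hF.nonneg_bound
    have e : γ * (α / γ * Λ * size Q γ y v s + ‖b s‖ / γ) =
        α * (Λ * size Q γ y v s) + ‖b s‖ := by field_simp
    rw [e]
    refine (norm_add_le _ _).trans (add_le_add ?_ le_rfl)
    rw [norm_neg, norm_smul, Real.norm_of_nonneg hα.le]
    gcongr
    exact ((L s).le_of_opNorm_le (hF.norm_L_le s) _).trans (by gcongr; exact hF.norm_y_le hγ s)
  rw [expConv_const_mul] at h2
  rw [div_le_iff₀ hγ]
  calc ‖v t‖ ≤ _ := h
    _ ≤ Real.exp (-γ * (t - a)) * ‖v a‖ + γ *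
      expConv γ a (fun s => α / γ * Λ * size Q γ y v s + ‖b s‖ / γ) t := by gcongr
    _ = _ := by field_simp

include hF hα hγ in
/-- On a window shorter than the slow time scale the state at most doubles, up to the input. -/
theorem size_le_of_window (h1 : α / γ * Λ * T ≤ 1 / 4) {a t : ℝ} (ha : t₀ ≤ a) (hat : a ≤ t)
    (htT : t ≤ a + T) {s : ℝ} (hs : s ∈ Set.Icc a t) :
    size Q γ y v s ≤ 2 * size Q γ y v a + 4 * ∫ r in a..t, ‖b r‖ / γ := by
  have hΛ := hF.nonneg_bound
  obtain ⟨m, hm, hmax⟩ := isCompact_Icc.exists_isMaxOn (Set.nonempty_Icc.2 hat)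
    (hF.cont_size.mono fun s (hs : s ∈ Set.Icc a t) => ha.trans hs.1)
  set S := size Q γ y v m with hS
  have hS0 : 0 ≤ S := size_nonneg hγ m
  have hle : ∀ s ∈ Set.Icc a t, size Q γ y v s ≤ S := fun s hs => hmax hs
  set D : ℝ := ∫ s in a..m, (α / γ * Λ * size Q γ y v s + ‖b s‖ / γ) with hD
  have hDle : D ≤ α / γ * Λ * T * S + ∫ r in a..t, ‖b r‖ / γ := by
    have hi := hF.int_norm_b (γ := γ) ha hm.1
    have e1 : D ≤ ∫ s in a..m, (α / γ * Λ * S + ‖b s‖ / γ) := by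
      refine intervalIntegral.integral_mono_on hm.1 (hF.int_drive ha hm.1)
        (intervalIntegrable_const.add hi) fun s hs => ?_
      gcongr
      exact hle s ⟨hs.1, hs.2.trans hm.2⟩
    rw [intervalIntegral.integral_add intervalIntegrable_const hi,
      intervalIntegral.integral_const, smul_eq_mul] at e1
    have e2 : ∫ s in a..m, ‖b s‖ / γ ≤ ∫ r in a..t, ‖b r‖ / γ :=
      intervalIntegral.integral_mono_interval le_rfl hm.1 hm.2
        (ae_of_all _ fun r => by simp only [Pi.zero_apply]; positivity)
        (hF.int_norm_b ha hat)
    have e3 : (m - a) * (α / γ * Λ * S) ≤ T * (α / γ * Λ * S) := by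
      gcongr
      linarith [hm.2]
    linarith
  have f1 := hF.norm_slow_sub_le hα hγ ha hm.1
  have f2 := hF.norm_fast_le hα hγ ha hm.1
  have f3 : expConv γ a (fun s => α / γ * Λ * size Q γ y v s + ‖b s‖ / γ) m ≤ D := by
    have := expConv_anti (ν := 0) (lam := γ) (f := fun s =>
      α / γ * Λ * size Q γ y v s + ‖b s‖ / γ)
      (fun s => by have := size_nonneg (Q := Q) (y := y) (v := v) hγ s; positivity)
      hγ.le le_rfl hm.1 (hF.int_drive ha hm.1)
    refine this.trans (le_of_eq ?_)
    simp [expConv, hD]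
  have f4 : Real.exp (-γ * (m - a)) * (‖v a‖ / γ) ≤ ‖v a‖ / γ := by
    refine mul_le_of_le_one_left (by positivity) (Real.exp_le_one_iff.2 ?_)
    nlinarith [hm.1]
  have f5 : ‖slow Q γ y v m‖ ≤ ‖slow Q γ y v a‖ + D := by
    have := norm_le_norm_add_norm_sub' (slow Q γ y v m) (slow Q γ y v a)
    linarith
  have f6 : S ≤ size Q γ y v a + 2 * D := by
    rw [hS]; unfold size; linarith
  have f7 : α / γ * Λ * T * S ≤ 1 / 4 * S := by gcongr
  have := hle s hs
  linarith

omit [CompleteSpace E] in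
theorem norm_sub_smul_le_of_inner {J : E} {z : E} {ε c K : ℝ} (hε : 0 ≤ ε)
    (hK : ‖J‖ ≤ K * ‖z‖) (hJ : c * ‖z‖ ^ 2 ≤ inner ℝ z J)
    (h1 : ε * c ≤ 1) (h2 : (ε * K) ^ 2 ≤ ε * c / 4) :
    ‖z - ε • J‖ ≤ (1 - 7 / 8 * (ε * c)) * ‖z‖ := by
  refine le_of_sq_le_sq ?_ (mul_nonneg (by linarith) (norm_nonneg _))
  rw [norm_sub_sq_real, inner_smul_right, norm_smul, Real.norm_of_nonneg hε]
  have e1 : (ε * ‖J‖) ^ 2 ≤ (ε * K) ^ 2 * ‖z‖ ^ 2 := by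
    rw [← mul_pow]
    refine pow_le_pow_left₀ (by positivity) ?_ 2
    rw [mul_assoc]
    gcongr
  have e2 : (ε * K) ^ 2 * ‖z‖ ^ 2 ≤ ε * c / 4 * ‖z‖ ^ 2 := by gcongr
  have e3 : ε * (c * ‖z‖ ^ 2) ≤ ε * inner ℝ z J := by gcongr
  have e4 : 0 ≤ (ε * c) ^ 2 * ‖z‖ ^ 2 := by positivity
  nlinarith [e1, e2, e3, e4]

include hF hα hγ in
/-- One window of persistent excitation contracts the slow coordinate, up to terms of second order
in `α / γ`. -/
theorem size_window_le (hT : 0 < T) (hμ : 0 < μ)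
    (hPE : ∀ t, t₀ ≤ t → ∀ z, μ * T * ‖z‖ ^ 2 ≤ inner ℝ z (∫ s in t..(t + T), Q (L s z)))
    (h1 : α / γ * Λ * T ≤ 1 / 4)
    (h2 : 16 * ((α / γ * Λ * T) ^ 2 + (α / γ * Λ) ^ 2 * T / γ + α / γ * Λ / γ) ≤ α / γ * (μ * T))
    (h3 : α / γ * Λ / γ ≤ 1 / 16) (h4 : Real.exp (-γ * T) ≤ 1 / 2)
    (h5 : α / γ * (μ * T) ≤ 1 / 4) {a : ℝ} (ha : t₀ ≤ a) :
    size Q γ y v (a + T) ≤ (1 - 3 / 4 * (α / γ * (μ * T))) * size Q γ y v a +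
      4 * ∫ s in a..(a + T), ‖b s‖ / γ := by
  have hΛ := hF.nonneg_bound
  have haT : a ≤ a + T := by linarith
  set β := ∫ s in a..(a + T), ‖b s‖ / γ with hβ
  have hβ0 : 0 ≤ β := intervalIntegral.integral_nonneg haT fun s _ => by positivity
  set S := 2 * size Q γ y v a + 4 * β with hS
  have hS0 : 0 ≤ S := by have := size_nonneg (Q := Q) (y := y) (v := v) hγ a; positivity
  have hle : ∀ s ∈ Set.Icc a (a + T), size Q γ y v s ≤ S := fun s hs =>
    hF.size_le_of_window hα hγ h1 ha haT le_rfl hs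
  set e := α / γ * Λ with he
  have he0 : 0 ≤ e := by positivity
  have hbmono : ∀ s ∈ Set.Icc a (a + T), ∫ r in a..s, ‖b r‖ / γ ≤ β := fun s hs =>
    intervalIntegral.integral_mono_interval le_rfl hs.1 hs.2
      (ae_of_all _ fun r => by simp only [Pi.zero_apply]; positivity) (hF.int_norm_b ha haT)
  have f1 : ∀ s ∈ Set.Icc a (a + T), ‖slow Q γ y v s - slow Q γ y v a‖ ≤ e * T * S + β := by
    intro s hs
    refine (hF.norm_slow_sub_le hα hγ ha hs.1).trans ?_
    have hi := hF.int_norm_b (γ := γ) ha hs.1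
    calc ∫ r in a..s, (e * size Q γ y v r + ‖b r‖ / γ)
        ≤ ∫ r in a..s, (e * S + ‖b r‖ / γ) := by
          refine intervalIntegral.integral_mono_on hs.1 (hF.int_drive ha hs.1)
            (intervalIntegrable_const.add hi) fun r hr => ?_
          gcongr
          exact hle r ⟨hr.1, hr.2.trans hs.2⟩
      _ = (s - a) * (e * S) + ∫ r in a..s, ‖b r‖ / γ := by
          rw [intervalIntegral.integral_add intervalIntegrable_const hi,
            intervalIntegral.integral_const, smul_eq_mul]
      _ ≤ T * (e * S) + β := by
          gcongr
          · linarith [hs.2]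
          · exact hbmono s hs
      _ = _ := by ring
  have f2 : ∀ s ∈ Set.Icc a (a + T),
      ‖v s‖ / γ ≤ Real.exp (-γ * (s - a)) * (‖v a‖ / γ) + (e * S / γ + β) := by
    intro s hs
    refine (hF.norm_fast_le hα hγ ha hs.1).trans ?_
    gcongr
    have hi := hF.int_norm_b (γ := γ) ha hs.1
    have hi2 := (hF.cont_size.intervalIntegrable_of_Ici ha hs.1).const_mul (α / γ * Λ)
    rw [expConv_add hi2 hi]
    refine add_le_add ?_ ?_
    · refine (expConv_le_of_le (U := e * S) hγ.ne' hs.1 hi2 fun r hr => ?_).trans ?_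
      · gcongr
        exact hle r ⟨hr.1, hr.2.trans hs.2⟩
      · rw [mul_div_assoc', mul_div_right_comm]
        refine mul_le_of_le_one_right (by positivity) ?_
        linarith [Real.exp_pos (-γ * (s - a))]
    · have := expConv_anti (ν := 0) (lam := γ) (f := fun s => ‖b s‖ / γ)
        (fun s => by positivity) hγ.le le_rfl hs.1 hi
      refine this.trans ?_
      simpa [expConv] using hbmono s hs
  -- freezing the slow coordinate at the start of the window
  set z := slow Q γ y v a with hz
  set J := ∫ s in a..(a + T), Q (L s z) with hJ
  have hQi : ∀ {g : ℝ → V}, IntervalIntegrable g volume a (a + T) →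
      IntervalIntegrable (fun s => Q (g s)) volume a (a + T) := fun hg =>
    ⟨Q.integrable_comp hg.1, Q.integrable_comp hg.2⟩
  have iz : IntervalIntegrable (fun s => Q (L s z)) volume a (a + T) :=
    hQi (hF.int_coupling continuousOn_const ha haT)
  have iy : IntervalIntegrable (fun s => Q (L s (y s - z))) volume a (a + T) :=
    hQi (hF.int_coupling (z := fun s => y s - z) (hF.cont_y.sub continuousOn_const) ha haT)
  have ib : IntervalIntegrable (fun s => Q (b s)) volume a (a + T) :=
    hQi (hF.int_b a _ ha haT)
  have g1 : slow Q γ y v (a + T) = (z - (α / γ) • J) +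
      ∫ s in a..(a + T), (-((α / γ) • Q (L s (y s - z))) + (1 / γ) • Q (b s)) := by
    rw [hF.slow_eq hγ ha haT, sub_add, sub_eq_add_neg, ← hz]
    congr 1
    have iy' : IntervalIntegrable (fun s => -((α / γ) • Q (L s (y s - z))) + (1 / γ) • Q (b s))
        volume a (a + T) := (iy.smul (α / γ)).neg.add (ib.smul (1 / γ))
    have iz' : IntervalIntegrable (fun s => (α / γ) • Q (L s z)) volume a (a + T) := iz.smul _
    rw [neg_sub, hJ, ← intervalIntegral.integral_smul, ← intervalIntegral.integral_sub iy' iz']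
    refine intervalIntegral.integral_congr fun s _ => ?_
    simp only [map_sub, smul_sub]
    abel
  have g2 : ‖z - (α / γ) • J‖ ≤ (1 - 7 / 8 * (α / γ * (μ * T))) * ‖z‖ := by
    refine norm_sub_smul_le_of_inner (K := Λ * T) (by positivity) ?_ (hPE a ha z)
      (by linarith) ?_
    · have : ∀ s ∈ Set.uIoc a (a + T), ‖Q (L s z)‖ ≤ Λ * ‖z‖ := fun s _ =>
        (hF.norm_Q_le _).trans ((L s).le_of_opNorm_le (hF.norm_L_le s) _)
      have h := intervalIntegral.norm_integral_le_of_norm_le_const this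
      rw [add_sub_cancel_left, abs_of_pos hT] at h
      linarith
    · have e1 : (α / γ * (Λ * T)) ^ 2 = (e * T) ^ 2 := by rw [he]; ring
      rw [e1]
      have : 0 ≤ e ^ 2 * T / γ + e / γ := by positivity
      linarith [sq_nonneg (e * T)]
  have iexp : IntervalIntegrable (fun s => Real.exp (-γ * (s - a))) volume a (a + T) :=
    Continuous.intervalIntegrable (by fun_prop) _ _
  have hexp : ∫ s in a..(a + T), Real.exp (-γ * (s - a)) ≤ 1 / γ := by
    have hd : ∀ s ∈ Set.uIcc a (a + T), HasDerivAt (fun s => -(Real.exp (-γ * (s - a)) / γ))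
        (Real.exp (-γ * (s - a))) s := by
      intro s _
      have h1 : HasDerivAt (fun s : ℝ => -γ * (s - a)) (-γ) s := by
        simpa using ((hasDerivAt_id s).sub_const a).const_mul (-γ)
      refine (h1.exp.div_const γ).neg.congr_deriv ?_
      field_simp
    rw [intervalIntegral.integral_eq_sub_of_hasDerivAt hd iexp]
    have : 0 < Real.exp (-γ * (a + T - a)) / γ := by positivity
    simp only [sub_self, mul_zero, Real.exp_zero]
    linarith
  have g3 : ‖∫ s in a..(a + T), (-((α / γ) • Q (L s (y s - z))) + (1 / γ) • Q (b s))‖ ≤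
      e * (T * (e * T * S + β) + (‖v a‖ / γ) / γ + T * (e * S / γ + β)) + β := by
    set c1 := e * T * S + β with hc1
    set c2 := e * S / γ + β with hc2
    have hb : ∀ s ∈ Set.Ioc a (a + T),
        ‖-((α / γ) • Q (L s (y s - z))) + (1 / γ) • Q (b s)‖ ≤
        (e * (c1 + c2) + e * (‖v a‖ / γ) * Real.exp (-γ * (s - a))) + ‖b s‖ / γ := by
      intro s hs
      have hs' : s ∈ Set.Icc a (a + T) := ⟨hs.1.le, hs.2⟩
      refine (hF.norm_drift_le hα hγ s (y s - z)).trans ?_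
      have n1 : ‖y s - z‖ ≤ c1 + (Real.exp (-γ * (s - a)) * (‖v a‖ / γ) + c2) := by
        have e1 : y s - z = (slow Q γ y v s - z) - (1 / γ) • Q (v s) := by
          simp only [slow]; abel
        rw [e1]
        refine (norm_sub_le _ _).trans (add_le_add (f1 s hs') (le_trans ?_ (f2 s hs')))
        exact hF.norm_smul_Q_le hγ _
      have := mul_le_mul_of_nonneg_left n1 he0
      linarith
    have hint : IntervalIntegrable (fun s => (e * (c1 + c2) +
        e * (‖v a‖ / γ) * Real.exp (-γ * (s - a)))) volume a (a + T) :=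
      intervalIntegrable_const.add (iexp.const_mul _)
    refine (intervalIntegral.norm_integral_le_of_norm_le haT (ae_of_all _ hb)
      (hint.add (hF.int_norm_b ha haT))).trans ?_
    rw [intervalIntegral.integral_add hint (hF.int_norm_b ha haT),
      intervalIntegral.integral_add intervalIntegrable_const (iexp.const_mul _),
      intervalIntegral.integral_const, intervalIntegral.integral_const_mul, smul_eq_mul,
      add_sub_cancel_left, ← hβ]
    have : e * (‖v a‖ / γ) * ∫ s in a..(a + T), Real.exp (-γ * (s - a)) ≤
        e * (‖v a‖ / γ) * (1 / γ) := by gcongr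
    have e2 : e * (‖v a‖ / γ) * (1 / γ) = e * (‖v a‖ / γ / γ) := by ring
    rw [e2] at this
    linarith
  have g4 : ‖slow Q γ y v (a + T)‖ ≤ (1 - 7 / 8 * (α / γ * (μ * T))) * ‖z‖ +
      (e * (T * (e * T * S + β) + (‖v a‖ / γ) / γ + T * (e * S / γ + β)) + β) := by
    rw [g1]
    exact (norm_add_le _ _).trans (add_le_add g2 g3)
  have g5 := f2 (a + T) ⟨haT, le_rfl⟩
  rw [add_sub_cancel_left] at g5
  have hW0 : 0 ≤ ‖v a‖ / γ := by positivity
  have hsz : size Q γ y v a = ‖z‖ + ‖v a‖ / γ := rfl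
  have hszT : size Q γ y v (a + T) = ‖slow Q γ y v (a + T)‖ + ‖v (a + T)‖ / γ := rfl
  set W := ‖v a‖ / γ with hW
  set Y := ‖z‖ with hY
  have hY0 : 0 ≤ Y := norm_nonneg _
  set c := α / γ * (μ * T) with hc
  have hc0 : 0 ≤ c := by positivity
  set δ := (e * T) ^ 2 + e ^ 2 * T / γ + e / γ with hδ
  have hδ0 : 0 ≤ δ := by positivity
  have k1 : Real.exp (-γ * T) * W ≤ 1 / 2 * W := by gcongr
  have k2 : e / γ * W ≤ 1 / 16 * W := by gcongr
  have k3 : δ * S ≤ c / 16 * S := by gcongr; linarith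
  have k4 : e * T * β ≤ 1 / 4 * β := by gcongr
  have k5 : c * W ≤ 1 / 4 * W := by gcongr
  have k6 : c * β ≤ 1 / 4 * β := by gcongr
  have k7 : e * (T * (e * T * S + β) + W / γ + T * (e * S / γ + β)) + β + (e * S / γ + β) =
      δ * S + e / γ * W + 2 * (e * T * β) + 2 * β := by
    rw [hδ]; ring
  have k8 : c / 16 * S = c / 8 * Y + c / 8 * W + c / 4 * β := by rw [hS, hsz]; ring
  rw [hszT, hsz]
  linarith

include hF hα hγ in
/-- Chaining the windows: the state is bounded by the envelope of the input with the rate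
`(3/4) (α/γ) μ`. -/
theorem size_le_envelope (hT : 0 < T) (hμ : 0 < μ)
    (hPE : ∀ t, t₀ ≤ t → ∀ z, μ * T * ‖z‖ ^ 2 ≤ inner ℝ z (∫ s in t..(t + T), Q (L s z)))
    (h1 : α / γ * Λ * T ≤ 1 / 4)
    (h2 : 16 * ((α / γ * Λ * T) ^ 2 + (α / γ * Λ) ^ 2 * T / γ + α / γ * Λ / γ) ≤ α / γ * (μ * T))
    (h3 : α / γ * Λ / γ ≤ 1 / 16) (h4 : Real.exp (-γ * T) ≤ 1 / 2)
    (h5 : α / γ * (μ * T) ≤ 1 / 4) {t : ℝ} (ht : t₀ ≤ t) :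
    size Q γ y v t ≤ 4 * envelope (3 / 4 * (α / γ * μ)) t₀ (size Q γ y v t₀)
      (fun s => 8 * (‖b s‖ / γ)) t := by
  set lam := 3 / 4 * (α / γ * μ) with hlam
  have hlam0 : 0 < lam := by positivity
  set f : ℝ → ℝ := fun s => 8 * (‖b s‖ / γ) with hf
  have hf0 : ∀ s, 0 ≤ f s := fun s => by positivity
  have hfi : ∀ {a t}, t₀ ≤ a → a ≤ t → IntervalIntegrable f volume a t := fun ha hat =>
    (hF.int_norm_b ha hat).const_mul 8
  have hlT : lam * T = 3 / 4 * (α / γ * (μ * T)) := by rw [hlam]; ring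
  have hexp2 : Real.exp (lam * T) ≤ 2 := by
    have h : lam * T ≤ 1 / 2 := by rw [hlT]; linarith
    refine (Real.exp_le_exp.2 h).trans ?_
    have := Real.exp_one_lt_d9
    have e : Real.exp (1 / 2) ^ 2 = Real.exp 1 := by rw [← Real.exp_nat_mul]; norm_num
    nlinarith [Real.exp_pos (1 / 2)]
  -- over one window the exponential weight is at least one half
  have hconv : ∀ {a t}, t₀ ≤ a → a ≤ t → t ≤ a + T →
      4 * ∫ s in a..t, ‖b s‖ / γ ≤ expConv lam a f t := by
    intro a t ha hat htT
    rw [← intervalIntegral.integral_const_mul]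
    refine intervalIntegral.integral_mono_on hat ((hF.int_norm_b ha hat).const_mul 4)
      (intervalIntegrable_exp_mul (hfi ha hat)) fun s hs => ?_
    have h : 1 / 2 ≤ Real.exp (-lam * (t - s)) := by
      have : Real.exp (-(lam * T)) ≤ Real.exp (-lam * (t - s)) := by
        refine Real.exp_le_exp.2 ?_
        nlinarith [hs.1]
      refine le_trans ?_ this
      rw [Real.exp_neg, one_div]
      exact inv_anti₀ (Real.exp_pos _) hexp2
    have hb0 : 0 ≤ ‖b s‖ / γ := by positivity
    calc 4 * (‖b s‖ / γ) = 1 / 2 * (8 * (‖b s‖ / γ)) := by ring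
      _ ≤ _ := by gcongr
  have hn : ∀ n : ℕ, size Q γ y v (t₀ + n * T) ≤
      envelope lam t₀ (size Q γ y v t₀) f (t₀ + n * T) := by
    intro n
    induction n with
    | zero => simp [envelope, expConv]
    | succ n ih =>
      have hn0 : t₀ ≤ t₀ + n * T := by have : 0 ≤ n * T := by positivity
                                       linarith
      have e1 : t₀ + (n + 1 : ℕ) * T = (t₀ + n * T) + T := by push_cast; ring
      rw [e1, ← envelope_eq (hfi le_rfl hn0) (hfi hn0 (by linarith)), add_sub_cancel_left]
      refine (hF.size_window_le hα hγ hT hμ hPE h1 h2 h3 h4 h5 hn0).trans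
        (add_le_add ?_ (hconv hn0 (by linarith) le_rfl))
      rw [← hlT]
      have h6 : 1 - lam * T ≤ Real.exp (-lam * T) := by
        have := Real.add_one_le_exp (-lam * T); linarith
      exact mul_le_mul h6 ih (size_nonneg hγ _) (Real.exp_pos _).le
  set n := ⌊(t - t₀) / T⌋₊ with hnd
  set a := t₀ + n * T with ha
  have ha0 : t₀ ≤ a := by have : 0 ≤ n * T := by positivity
                          linarith
  have hat : a ≤ t := by
    have := Nat.floor_le (div_nonneg (sub_nonneg.2 ht) hT.le)
    rw [le_div_iff₀ hT] at this
    linarith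
  have htT : t ≤ a + T := by
    have := (Nat.lt_floor_add_one ((t - t₀) / T)).le
    rw [div_le_iff₀ hT] at this
    linarith
  have m1 := hF.size_le_of_window hα hγ h1 ha0 hat htT (s := t) ⟨hat, le_rfl⟩
  have m2 := hconv ha0 hat htT
  have m3 := hn n
  rw [← ha] at m3
  have m4 := envelope_eq (ν := lam) (X := size Q γ y v t₀) (hfi le_rfl ha0) (hfi ha0 hat)
  have hE0 := envelope_nonneg (ν := lam) (size_nonneg (Q := Q) (y := y) (v := v) hγ t₀) hf0 ha0
  have hC0 := expConv_nonneg (ν := lam) hf0 hat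
  have m5 : 1 / 2 ≤ Real.exp (-lam * (t - a)) := by
    have : Real.exp (-(lam * T)) ≤ Real.exp (-lam * (t - a)) := by
      refine Real.exp_le_exp.2 ?_
      nlinarith
    refine le_trans ?_ this
    rw [Real.exp_neg, one_div]
    exact inv_anti₀ (Real.exp_pos _) hexp2
  have m6 := mul_le_mul_of_nonneg_right m5 hE0
  linarith

end IsDampedFlow

/-! ### Switching signals -/

section Switching

variable {m : ℕ} {σ : ℝ → Fin m} {t₀ : ℝ} {ts : ℕ → ℝ}

theorem IsSwitchingSequence.start_le (h : IsSwitchingSequence σ t₀ ts) (k : ℕ) : t₀ ≤ ts k :=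
  h.start ▸ h.strictMono.monotone (Nat.zero_le k)

theorem IsSwitchingSequence.exists_mem_Ico (h : IsSwitchingSequence σ t₀ ts) {t : ℝ}
    (ht : t₀ ≤ t) : ∃ k, t ∈ Set.Ico (ts k) (ts (k + 1)) := by
  classical
  have hex : ∃ k, t < ts k := (h.unbounded.eventually (eventually_gt_atTop t)).exists
  obtain ⟨k, hk⟩ : ∃ k, Nat.find hex = k + 1 := by
    refine Nat.exists_eq_succ_of_ne_zero fun h0 => ?_
    have := Nat.find_spec hex
    rw [h0, h.start] at this
    exact absurd ht (not_le.2 this)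
  refine ⟨k, not_lt.1 (Nat.find_min hex (by lia)), ?_⟩
  rw [← hk]
  exact Nat.find_spec hex

/-- Every function of the mode is locally integrable along the switching signal. -/
theorem IsSwitchingSequence.intervalIntegrable {F : Type*} [NormedAddCommGroup F]
    (h : IsSwitchingSequence σ t₀ ts) (f : Fin m → F) {a t : ℝ} (ha : t₀ ≤ a) (hat : a ≤ t) :
    IntervalIntegrable (fun s => f (σ s)) volume a t := by
  have hm : AEStronglyMeasurable (fun s => f (σ s))
      (volume.restrict (⋃ k, Set.Ico (ts k) (ts (k + 1)))) := by
    rw [aestronglyMeasurable_iUnion_iff]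
    intro k
    refine (aestronglyMeasurable_const (b := f (σ (ts k)))).congr ?_
    refine (ae_restrict_iff' measurableSet_Ico).2 (ae_of_all _ fun s hs => ?_)
    change _ = f (σ s)
    rw [h.const k s hs]
  have hsub : Set.uIoc a t ⊆ ⋃ k, Set.Ico (ts k) (ts (k + 1)) := by
    rw [Set.uIoc_of_le hat]
    intro s hs
    exact Set.mem_iUnion.2 (h.exists_mem_Ico (ha.trans hs.1.le))
  refine IntervalIntegrable.mono_fun (f := fun _ => ∑ q, ‖f q‖) intervalIntegrable_const
    (hm.mono_measure (Measure.restrict_mono hsub le_rfl)) (ae_of_all _ fun s => ?_)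
  have h0 : ‖f (σ s)‖ ≤ ∑ q, ‖f q‖ :=
    Finset.single_le_sum (f := fun q => ‖f q‖) (fun q _ => norm_nonneg _) (Finset.mem_univ _)
  exact h0.trans (le_abs_self _)

end Switching

/-! ### Coordinate maps and the Laplacians -/

/-- Reindexing of a Euclidean vector along a map of the index types. -/
noncomputable def pull {ι κ : Type*} [Fintype ι] [Fintype κ] (f : ι → κ) :
    EuclideanSpace ℝ κ →L[ℝ] EuclideanSpace ℝ ι :=
  LinearMap.toContinuousLinearMap
    { toFun := fun x => WithLp.toLp 2 fun a => x (f a)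
      map_add' := fun _ _ => rfl
      map_smul' := fun _ _ => rfl }

@[simp] theorem pull_apply {ι κ : Type*} [Fintype ι] [Fintype κ] (f : ι → κ)
    (x : EuclideanSpace ℝ κ) (a : ι) : pull f x a = x (f a) := rfl

theorem norm_pull_le {ι κ : Type*} [Fintype ι] [Fintype κ] {f : ι → κ}
    (hf : Function.Injective f) (x : EuclideanSpace ℝ κ) : ‖pull f x‖ ≤ ‖x‖ := by
  classical
  rw [EuclideanSpace.norm_eq, EuclideanSpace.norm_eq]
  refine Real.sqrt_le_sqrt ?_
  simp only [pull_apply]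
  rw [← Finset.sum_image (f := fun b => ‖x b‖ ^ 2) (s := Finset.univ) (g := f)
    (fun a _ b _ h => hf h)]
  exact Finset.sum_le_sum_of_subset_of_nonneg (Finset.subset_univ _) fun _ _ _ => by positivity

theorem restr_eq_pull {N : ℕ} (S : Finset (Fin N)) (x : EuclideanSpace ℝ (Fin N ⊕ Fin N)) :
    restr S x = pull (Sum.map Subtype.val Subtype.val) x := rfl

theorem norm_restr_le {N : ℕ} (S : Finset (Fin N)) (x : EuclideanSpace ℝ (Fin N ⊕ Fin N)) :
    ‖restr S x‖ ≤ ‖x‖ :=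
  norm_pull_le (Sum.map_injective.2 ⟨Subtype.val_injective, Subtype.val_injective⟩) x

/-- The positions in a state. -/
noncomputable def pos {ι : Type*} [Fintype ι] :
    EuclideanSpace ℝ (ι ⊕ ι) →L[ℝ] EuclideanSpace ℝ ι := pull Sum.inl

/-- The velocities in a state. -/
noncomputable def vel {ι : Type*} [Fintype ι] :
    EuclideanSpace ℝ (ι ⊕ ι) →L[ℝ] EuclideanSpace ℝ ι := pull Sum.inr

theorem norm_pos_le {ι : Type*} [Fintype ι] (x : EuclideanSpace ℝ (ι ⊕ ι)) : ‖pos x‖ ≤ ‖x‖ :=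
  norm_pull_le Sum.inl_injective x

theorem norm_vel_le {ι : Type*} [Fintype ι] (x : EuclideanSpace ℝ (ι ⊕ ι)) : ‖vel x‖ ≤ ‖x‖ :=
  norm_pull_le Sum.inr_injective x

theorem act_eq {m n : Type*} [Fintype m] [Fintype n] [DecidableEq n] (M : Matrix m n ℝ)
    (x : EuclideanSpace ℝ n) : act M x = actL M x := rfl

theorem opNorm_eq {m n : Type*} [Fintype m] [Fintype n] [DecidableEq n] (M : Matrix m n ℝ) :
    opNorm M = ‖actL M‖ := rfl

theorem actL_apply {m n : Type*} [Fintype m] [Fintype n] [DecidableEq n] (M : Matrix m n ℝ)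
    (x : EuclideanSpace ℝ n) (i : m) : actL M x i = ∑ j, M i j * x j := rfl

theorem actL_mul {l m n : Type*} [Fintype l] [Fintype m] [Fintype n] [DecidableEq m]
    [DecidableEq n] (M : Matrix l m ℝ) (M' : Matrix m n ℝ) (x : EuclideanSpace ℝ n) :
    actL (M * M') x = actL M (actL M' x) := by
  ext i
  have := congrFun (Matrix.mulVec_mulVec (WithLp.ofLp x) M M').symm i
  exact this

theorem actL_one {n : Type*} [Fintype n] [DecidableEq n] (x : EuclideanSpace ℝ n) :
    actL (1 : Matrix n n ℝ) x = x := by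
  ext i
  exact congrFun (Matrix.one_mulVec (WithLp.ofLp x)) i

theorem actL_sub {m n : Type*} [Fintype m] [Fintype n] [DecidableEq n] (M M' : Matrix m n ℝ)
    (x : EuclideanSpace ℝ n) : actL (M - M') x = actL M x - actL M' x := by
  ext i
  exact congrFun (Matrix.sub_mulVec M M' (WithLp.ofLp x)) i

theorem actL_smul {m n : Type*} [Fintype m] [Fintype n] [DecidableEq n] (c : ℝ)
    (M : Matrix m n ℝ) : actL (c • M) = c • actL M := by
  unfold actL
  rw [map_smul, map_smul]

section SysMat

variable {ι : Type*} [Fintype ι] [DecidableEq ι]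

theorem pos_sysMat (α γ : ℝ) (L : Matrix ι ι ℝ) (x : EuclideanSpace ℝ (ι ⊕ ι)) :
    pos (actL (sysMat α γ L) x) = vel x := by
  ext i
  simp [pos, vel, actL_apply, sysMat, Matrix.one_apply]

theorem vel_sysMat (α γ : ℝ) (L : Matrix ι ι ℝ) (x : EuclideanSpace ℝ (ι ⊕ ι)) :
    vel (actL (sysMat α γ L) x) = -(γ • vel x) + -(α • actL L (pos x)) := by
  ext i
  simp [pos, vel, actL_apply, sysMat, Matrix.one_apply, Finset.mul_sum, mul_assoc]
  ring

end SysMat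

theorem lap_mulVec_const {ι : Type*} [Fintype ι] (G : SimpleGraph ι) (c : ℝ) :
    (lap G).mulVec (fun _ => c) = 0 := by
  classical
  have h : (lap G).mulVec (fun _ => 1) = 0 := by
    unfold lap
    convert! G.lapMatrix_mulVec_const_eq_zero (R := ℝ)
  have e : (fun _ : ι => c) = c • fun _ => (1 : ℝ) := by ext; simp
  rw [e, Matrix.mulVec_smul, h, smul_zero]

section Disagreement

variable {N : ℕ} {Q : Matrix (Fin (N - 1)) (Fin N) ℝ}

theorem IsDisagreementMatrix.inner_transpose (z : EuclideanSpace ℝ (Fin (N - 1)))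
    (x : EuclideanSpace ℝ (Fin N)) :
    inner ℝ (actL Q.transpose z) x = inner ℝ z (actL Q x) := by
  simp only [PiLp.inner_apply, actL_apply, Matrix.transpose_apply, RCLike.inner_apply,
    conj_trivial, Finset.mul_sum, Finset.sum_mul]
  rw [Finset.sum_comm]
  exact Finset.sum_congr rfl fun a _ => Finset.sum_congr rfl fun b _ => by ring

theorem IsDisagreementMatrix.norm_transpose (hQ : IsDisagreementMatrix Q)
    (z : EuclideanSpace ℝ (Fin (N - 1))) : ‖actL Q.transpose z‖ = ‖z‖ := by
  have h : ‖actL Q.transpose z‖ ^ 2 = ‖z‖ ^ 2 := by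
    rw [← real_inner_self_eq_norm_sq, IsDisagreementMatrix.inner_transpose, ← actL_mul,
      hQ.mul_transpose, actL_one, real_inner_self_eq_norm_sq]
  exact (sq_eq_sq₀ (norm_nonneg _) (norm_nonneg _)).1 h

theorem IsDisagreementMatrix.norm_le (hQ : IsDisagreementMatrix Q)
    (x : EuclideanSpace ℝ (Fin N)) : ‖actL Q x‖ ≤ ‖x‖ := by
  have h1 : ‖actL Q x‖ ^ 2 = inner ℝ (actL Q.transpose (actL Q x)) x := by
    rw [IsDisagreementMatrix.inner_transpose, real_inner_self_eq_norm_sq]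
  have h2 := real_inner_le_norm (actL Q.transpose (actL Q x)) x
  rw [hQ.norm_transpose] at h2
  rcases eq_or_lt_of_le (norm_nonneg (actL Q x)) with h | h
  · rw [← h]; exact norm_nonneg _
  · nlinarith

/-- The projection `Qᵀ Q` removes the mean. -/
theorem IsDisagreementMatrix.exists_transpose_mul (hQ : IsDisagreementMatrix Q)
    (x : EuclideanSpace ℝ (Fin N)) :
    ∃ c : ℝ, x = actL Q.transpose (actL Q x) + WithLp.toLp 2 fun _ => c := by
  refine ⟨(1 / (N : ℝ)) * ∑ j, x j, ?_⟩
  rw [← actL_mul, hQ.transpose_mul]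
  ext i
  simp [actL_apply, Matrix.one_apply, sub_mul, Finset.sum_sub_distrib, Finset.mul_sum]

theorem IsDisagreementMatrix.lap_transpose (hQ : IsDisagreementMatrix Q)
    (G : SimpleGraph (Fin N)) (x : EuclideanSpace ℝ (Fin N)) :
    actL (lap G) (actL Q.transpose (actL Q x)) = actL (lap G) x := by
  obtain ⟨c, hc⟩ := hQ.exists_transpose_mul x
  conv_rhs => rw [hc, map_add]
  have : actL (lap G) (WithLp.toLp 2 fun _ => c) = 0 := by
    ext i
    exact congrFun (lap_mulVec_const G c) i
  rw [this, add_zero]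

/-- The coupling terms that the local model of agent `i` omits depend on the disagreement only. -/
theorem IsDisagreementMatrix.norm_restr_sysMat_sub_le (hQ : IsDisagreementMatrix Q)
    {α γ Λ : ℝ} (hα : 0 ≤ α) (G : SimpleGraph (Fin N)) (i : Fin N) (h1 : opNorm (lap G) ≤ Λ)
    (h2 : opNorm (lap (proxGraph G i)) ≤ Λ) (x : EuclideanSpace ℝ (Fin N ⊕ Fin N)) :
    ‖restr (hood2 G i) (act (sysMat α γ (lap G)) x) -
      act (locMat α γ G i) (restr (hood2 G i) x)‖ ≤ α * (2 * Λ) * ‖act Q (pos x)‖ := by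
  set z := restr (hood2 G i) (act (sysMat α γ (lap G)) x) -
      act (locMat α γ G i) (restr (hood2 G i) x) with hz
  have hpr : ∀ w : EuclideanSpace ℝ (Fin N ⊕ Fin N), pos (restr (hood2 G i) w) =
      pull (Subtype.val : hood2 G i → Fin N) (pos w) := fun w => rfl
  have hvr : ∀ w : EuclideanSpace ℝ (Fin N ⊕ Fin N), vel (restr (hood2 G i) w) =
      pull (Subtype.val : hood2 G i → Fin N) (vel w) := fun w => rfl
  have hp : pos z = 0 := by
    rw [hz, map_sub, hpr, act_eq, act_eq, pos_sysMat, locMat, pos_sysMat, hvr, sub_self]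
  set p' := actL Q.transpose (actL Q (pos x)) with hp'
  have hprox : actL (lap (proxGraph G i)) (pull (Subtype.val : hood2 G i → Fin N) (pos x)) =
      actL (lap (proxGraph G i)) (pull (Subtype.val : hood2 G i → Fin N) p') := by
    obtain ⟨c, hc⟩ := hQ.exists_transpose_mul (pos x)
    conv_lhs => rw [hc, map_add, map_add]
    have : actL (lap (proxGraph G i)) (pull (Subtype.val : hood2 G i → Fin N)
        (WithLp.toLp 2 fun _ => c)) = 0 := by
      ext j
      exact congrFun (lap_mulVec_const (proxGraph G i) c) j
    rw [this, add_zero]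
  have hv : vel z = -(α • (pull (Subtype.val : hood2 G i → Fin N) (actL (lap G) p') -
      actL (lap (proxGraph G i)) (pull (Subtype.val : hood2 G i → Fin N) p'))) := by
    rw [hz, map_sub, hvr, act_eq, act_eq, vel_sysMat, locMat, vel_sysMat, hvr, hpr,
      ← hQ.lap_transpose G, ← hp', hprox, map_add, map_neg, map_neg, map_smul, map_smul, smul_sub]
    abel
  have hnorm : ‖z‖ = ‖vel z‖ := by
    have h0 : ∀ a, z (Sum.inl a) = 0 := fun a =>
      congrFun (congrArg WithLp.ofLp hp) a
    rw [EuclideanSpace.norm_eq, EuclideanSpace.norm_eq, Fintype.sum_sum_type]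
    simp [h0, vel]
  have hpn : ‖p'‖ = ‖act Q (pos x)‖ := hQ.norm_transpose _
  rw [hnorm, hv, norm_neg, norm_smul, Real.norm_of_nonneg hα, mul_assoc, ← hpn]
  gcongr
  refine (norm_sub_le _ _).trans ?_
  have k1 : ‖pull (Subtype.val : hood2 G i → Fin N) (actL (lap G) p')‖ ≤ Λ * ‖p'‖ :=
    (norm_pull_le Subtype.val_injective _).trans ((actL (lap G)).le_of_opNorm_le h1 _)
  have k2 : ‖actL (lap (proxGraph G i)) (pull (Subtype.val : hood2 G i → Fin N) p')‖ ≤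
      Λ * ‖p'‖ := by
    have hΛ : 0 ≤ Λ := (norm_nonneg _).trans h1
    refine ((actL (lap (proxGraph G i))).le_of_opNorm_le h2 _).trans ?_
    gcongr
    exact norm_pull_le Subtype.val_injective _
  linarith

end Disagreement

/-- All Laplacians of graphs on `N` vertices and of their proximity graphs have a common bound. -/
theorem exists_opNorm_lap_le (N : ℕ) : ∃ Λ : ℝ, 0 < Λ ∧ ∀ G : SimpleGraph (Fin N),
    opNorm (lap G) ≤ Λ ∧ ∀ i, opNorm (lap (proxGraph G i)) ≤ Λ := by
  obtain ⟨B, hB⟩ := (Set.finite_range fun G : SimpleGraph (Fin N) => opNorm (lap G)).bddAbove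
  obtain ⟨B', hB'⟩ := (Set.finite_range fun a : SimpleGraph (Fin N) × Fin N =>
    opNorm (lap (proxGraph a.1 a.2))).bddAbove
  refine ⟨max (max B B') 1, lt_max_of_lt_right one_pos, fun G => ⟨?_, fun i => ?_⟩⟩
  · exact (hB ⟨G, rfl⟩).trans ((le_max_left _ _).trans (le_max_left _ _))
  · exact (hB' ⟨(G, i), rfl⟩).trans ((le_max_right _ _).trans (le_max_left _ _))

theorem norm_inputMat_le {N : ℕ} (A : Finset (Fin N)) (u : EuclideanSpace ℝ A) :
    ‖act (inputMat A) u‖ ≤ ‖u‖ := by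
  have h0 : ∀ j, act (inputMat A) u (Sum.inl j) = 0 := fun j => by
    rw [act_eq, actL_apply]; simp [inputMat]
  have h1 : ∀ j, act (inputMat A) u (Sum.inr j) = if h : j ∈ A then u ⟨j, h⟩ else 0 := fun j => by
    rw [act_eq, actL_apply]
    simp only [inputMat, Matrix.fromRows_apply_inr, Matrix.of_apply, ite_mul, one_mul, zero_mul]
    split_ifs with h
    · rw [Finset.sum_eq_single ⟨j, h⟩]
      · simp
      · intro b _ hb
        exact if_neg fun h' => hb (Subtype.ext h'.symm)
      · simp
    · exact Finset.sum_eq_zero fun a _ => if_neg fun h' : j = (a : Fin N) => h (h' ▸ a.2)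
  rw [EuclideanSpace.norm_eq, EuclideanSpace.norm_eq, Fintype.sum_sum_type]
  refine Real.sqrt_le_sqrt (le_of_eq ?_)
  simp only [h0, h1, norm_zero]
  rw [Finset.sum_eq_zero (fun _ _ => by simp), zero_add, ← Finset.sum_subset (Finset.subset_univ A),
    ← Finset.sum_coe_sort A]
  · exact Finset.sum_congr rfl fun a _ => by simp
  · intro j _ hj
    simp [hj]

/-! ### The plant as a damped flow -/

theorem InLpe.intervalIntegrable {E : Type*} [NormedAddCommGroup E] {p : ℝ≥0∞} {t₀ : ℝ}
    {u : ℝ → E} (hu : InLpe p t₀ u) (hp : 1 ≤ p) {a t : ℝ} (ha : t₀ ≤ a) (hat : a ≤ t) :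
    IntervalIntegrable u volume a t := by
  have h : IntegrableOn u (Set.Icc t₀ t) volume := (hu t).integrable hp
  exact (intervalIntegrable_iff_integrableOn_Icc_of_le hat).2
    (h.mono_set (Set.Icc_subset_Icc_left ha))

theorem _root_.IntervalIntegrable.clm_comp {E F : Type*} [NormedAddCommGroup E] [NormedSpace ℝ E]
    [NormedAddCommGroup F] [NormedSpace ℝ F] (L : E →L[ℝ] F) {u : ℝ → E} {a t : ℝ}
    (hu : IntervalIntegrable u volume a t) : IntervalIntegrable (fun s => L (u s)) volume a t :=
  ⟨L.integrable_comp hu.1, L.integrable_comp hu.2⟩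

section Plant

variable {N m : ℕ} {α γ μ T Λ t₀ : ℝ} {G : Fin m → SimpleGraph (Fin N)} {σ : ℝ → Fin m}
  {ts : ℕ → ℝ} {A : Finset (Fin N)} {p : ℝ≥0∞} {u : ℝ → EuclideanSpace ℝ A}
  {x : ℝ → EuclideanSpace ℝ (Fin N ⊕ Fin N)} {Q : Matrix (Fin (N - 1)) (Fin N) ℝ}

theorem intervalIntegrable_plant (hσ : IsSwitchingSequence σ t₀ ts) (hp : 1 ≤ p)
    (hu : InLpe p t₀ u) (hx : IsPlantSolution α γ G σ A t₀ u x) {a t : ℝ} (ha : t₀ ≤ a)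
    (hat : a ≤ t) : IntervalIntegrable (fun s => act (sysMat α γ (lap (G (σ s)))) (x s) +
      act (inputMat A) (u s)) volume a t := by
  refine IntervalIntegrable.add ?_ ((hu.intervalIntegrable hp ha hat).clm_comp (actL (inputMat A)))
  refine intervalIntegrable_clm_apply (L := fun s => actL (sysMat α γ (lap (G (σ s)))))
    (K := ∑ q, ‖actL (sysMat α γ (lap (G q)))‖)
    (hσ.intervalIntegrable (fun q => actL (sysMat α γ (lap (G q)))) ha hat) (fun s => ?_)
    (hx.cont.intervalIntegrable_of_Ici ha hat)
  exact Finset.single_le_sum (f := fun q => ‖actL (sysMat α γ (lap (G q)))‖)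
    (fun q _ => norm_nonneg _) (Finset.mem_univ _)

theorem IsPlantSolution.eqn_sub (hx : IsPlantSolution α γ G σ A t₀ u x)
    (hσ : IsSwitchingSequence σ t₀ ts) (hp : 1 ≤ p) (hu : InLpe p t₀ u) {a t : ℝ} (ha : t₀ ≤ a)
    (hat : a ≤ t) : x t = x a + ∫ s in a..t,
      (act (sysMat α γ (lap (G (σ s)))) (x s) + act (inputMat A) (u s)) := by
  rw [hx.eqn t (ha.trans hat), hx.eqn a ha, add_assoc,
    intervalIntegral.integral_add_adjacent_intervals
      (intervalIntegrable_plant hσ hp hu hx le_rfl ha)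
      (intervalIntegrable_plant hσ hp hu hx ha hat)]

theorem IsPlantSolution.isDampedFlow (hx : IsPlantSolution α γ G σ A t₀ u x)
    (hσ : IsSwitchingSequence σ t₀ ts) (hp : 1 ≤ p) (hu : InLpe p t₀ u)
    (hQ : IsDisagreementMatrix Q) (hΛ : ∀ G : SimpleGraph (Fin N), opNorm (lap G) ≤ Λ) :
    IsDampedFlow (actL Q) (fun s => actL (lap (G (σ s)) * Q.transpose)) α γ Λ t₀
      (fun s => act Q (pos (x s))) (fun s => vel (x s))
      (fun s => vel (act (inputMat A) (u s))) where
  norm_Q_le := hQ.norm_le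
  norm_L_le s := by
    refine ContinuousLinearMap.opNorm_le_bound _ ((norm_nonneg _).trans (hΛ ⊥)) fun z => ?_
    rw [actL_mul, ← hQ.norm_transpose z]
    exact (actL (lap (G (σ s)))).le_of_opNorm_le (hΛ _) _
  cont_y := (actL Q).continuous.comp_continuousOn (pos.continuous.comp_continuousOn hx.cont)
  cont_v := vel.continuous.comp_continuousOn hx.cont
  int_L a t ha hat := hσ.intervalIntegrable (fun q => actL (lap (G q) * Q.transpose)) ha hat
  int_b a t ha hat :=
    ((hu.intervalIntegrable hp ha hat).clm_comp (actL (inputMat A))).clm_comp vel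
  eqn_y a t ha hat := by
    have h := congrArg (fun z => actL Q (pos z)) (hx.eqn_sub hσ hp hu ha hat)
    have hi := intervalIntegrable_plant hσ hp hu hx ha hat
    simp only [map_add] at h
    rw [← pos.intervalIntegral_comp_comm hi,
      ← (actL Q).intervalIntegral_comp_comm (hi.clm_comp pos)] at h
    refine h.trans ?_
    congr 1
    refine intervalIntegral.integral_congr fun s _ => ?_
    have hB : pos (actL (inputMat A) (u s)) = 0 := by
      ext j
      simp [pos, actL_apply, inputMat]
    simp only [map_add, hB, act_eq, pos_sysMat, add_zero]
  eqn_v a t ha hat := by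
    have h := congrArg vel (hx.eqn_sub hσ hp hu ha hat)
    have hi := intervalIntegrable_plant hσ hp hu hx ha hat
    simp only [map_add] at h
    rw [← vel.intervalIntegral_comp_comm hi] at h
    refine h.trans ?_
    congr 1
    refine intervalIntegral.integral_congr fun s _ => ?_
    simp only [map_add, act_eq, vel_sysMat, actL_mul, hQ.lap_transpose, add_assoc]

theorem IsPEConnected.le_inner (hPE : IsPEConnected G σ Q μ T) (hT : 0 < T)
    (hσ : IsSwitchingSequence σ t₀ ts) (h0 : 0 ≤ t₀) {t : ℝ} (ht : t₀ ≤ t)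
    (z : EuclideanSpace ℝ (Fin (N - 1))) : μ * T * ‖z‖ ^ 2 ≤
      inner ℝ z (∫ s in t..(t + T), actL Q (actL (lap (G (σ s)) * Q.transpose) z)) := by
  have htT : t ≤ t + T := by linarith
  have hpsd := (hPE t (h0.trans ht)).dotProduct_mulVec_nonneg (WithLp.ofLp z)
  have hint : ∀ a b, IntervalIntegrable
      (fun τ => (Q * lap (G (σ τ)) * Q.transpose) a b) volume t (t + T) := fun a b =>
    hσ.intervalIntegrable (fun q => (Q * lap (G q) * Q.transpose) a b) ht htT
  have e0 : ∀ s, actL Q (actL (lap (G (σ s)) * Q.transpose) z) =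
      actL (Q * lap (G (σ s)) * Q.transpose) z := fun s => by
    rw [← actL_mul, Matrix.mul_assoc]
  have e1 : inner ℝ z (∫ s in t..(t + T), actL Q (actL (lap (G (σ s)) * Q.transpose) z)) =
      ∑ a, z a * ∑ b, (∫ τ in t..(t + T), (Q * lap (G (σ τ)) * Q.transpose) a b) * z b := by
    have hL : IntervalIntegrable (fun s => actL (Q * lap (G (σ s)) * Q.transpose) z)
        volume t (t + T) :=
      hσ.intervalIntegrable (fun q => actL (Q * lap (G q) * Q.transpose) z) ht htT
    simp only [e0]
    have h := (innerSL ℝ z).intervalIntegral_comp_comm hL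
    simp only [innerSL_apply_apply] at h
    rw [← h]
    simp only [PiLp.inner_apply, actL_apply, RCLike.inner_apply, conj_trivial]
    rw [intervalIntegral.integral_finsetSum]
    · refine Finset.sum_congr rfl fun a _ => ?_
      rw [intervalIntegral.integral_mul_const, intervalIntegral.integral_finsetSum, mul_comm]
      · simp only [intervalIntegral.integral_mul_const]
      · exact fun b _ => (hint a b).mul_const _
    · intro a _
      refine IntervalIntegrable.mul_const ?_ _
      have h := IntervalIntegrable.sum Finset.univ
        (f := fun b τ => (Q * lap (G (σ τ)) * Q.transpose) a b * z b)
        (fun b _ => (hint a b).mul_const (z b))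
      convert! h using 1
      ext τ
      simp
  have e2 : (1 / T) * inner ℝ z
      (∫ s in t..(t + T), actL Q (actL (lap (G (σ s)) * Q.transpose) z)) - μ * ‖z‖ ^ 2 =
      star (WithLp.ofLp z) ⬝ᵥ (((1 / T) • (Matrix.of fun a b =>
        ∫ τ in t..(t + T), (Q * lap (G (σ τ)) * Q.transpose) a b) - μ • 1).mulVec
          (WithLp.ofLp z)) := by
    rw [e1, Matrix.sub_mulVec, Matrix.smul_mulVec, Matrix.smul_mulVec, Matrix.one_mulVec,
      dotProduct_sub, dotProduct_smul, dotProduct_smul, EuclideanSpace.norm_sq_eq]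
    simp [dotProduct, Matrix.mulVec, pow_two]
  rw [← e2] at hpsd
  have h3 : μ * ‖z‖ ^ 2 ≤ (1 / T) * inner ℝ z
      (∫ s in t..(t + T), actL Q (actL (lap (G (σ s)) * Q.transpose) z)) := by linarith
  rw [one_div_mul_eq_div, le_div_iff₀ hT] at h3
  linarith

end Plant

theorem envelope_mono {ν t₀ X X' t : ℝ} {f g : ℝ → ℝ} (hX : X ≤ X') (h : t₀ ≤ t)
    (hf : IntervalIntegrable f volume t₀ t) (hg : IntervalIntegrable g volume t₀ t)
    (hfg : ∀ s, f s ≤ g s) : envelope ν t₀ X f t ≤ envelope ν t₀ X' g t :=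
  add_le_add (mul_le_mul_of_nonneg_right hX (Real.exp_pos _).le)
    (expConv_mono h hf hg fun s _ => hfg s)

/-- The smallness conditions on `1/γ` under which the slow and fast modes separate. -/
structure IsLargeDamping (α μ T Λ γ : ℝ) : Prop where
  one_le : 1 ≤ γ
  window : α / γ * Λ * T ≤ 1 / 4
  second_order : 16 * ((α / γ * Λ * T) ^ 2 + (α / γ * Λ) ^ 2 * T / γ + α / γ * Λ / γ) ≤
    α / γ * (μ * T)
  cross : α / γ * Λ / γ ≤ 1 / 16
  fast : Real.exp (-γ * T) ≤ 1 / 2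
  rate : α / γ * (μ * T) ≤ 1 / 4

theorem exists_isLargeDamping {α μ T Λ : ℝ} (hα : 0 < α) (hμ : 0 < μ) (hT : 0 < T) (hΛ : 0 < Λ) :
    ∃ γ₀ : ℝ, 0 < γ₀ ∧ ∀ γ, γ₀ ≤ γ → IsLargeDamping α μ T Λ γ := by
  refine ⟨1 + 4 * α * Λ * T + 16 * (α * Λ ^ 2 * T ^ 2 + α * Λ ^ 2 * T + Λ) / (μ * T) +
    16 * α * Λ + 1 / T + 4 * α * μ * T, by positivity, fun γ hγ => ?_⟩
  have p1 : 0 < 4 * α * Λ * T := by positivity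
  have p2 : 0 < 16 * (α * Λ ^ 2 * T ^ 2 + α * Λ ^ 2 * T + Λ) / (μ * T) := by positivity
  have p3 : 0 < 16 * α * Λ := by positivity
  have p4 : 0 < 1 / T := by positivity
  have p5 : 0 < 4 * α * μ * T := by positivity
  have g1 : 1 ≤ γ := by linarith
  have g0 : 0 < γ := by linarith
  have gi : 1 / γ ≤ 1 := by rw [div_le_one g0]; exact g1
  refine ⟨g1, ?_, ?_, ?_, ?_, ?_⟩
  · have e : α / γ * Λ * T = α * Λ * T / γ := by ring
    rw [e, div_le_iff₀ g0]
    linarith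
  · have h : 16 * (α * Λ ^ 2 * T ^ 2 + α * Λ ^ 2 * T + Λ) / (μ * T) ≤ γ := by linarith
    rw [div_le_iff₀ (by positivity)] at h
    have k : α * Λ ^ 2 * T * (1 / γ) ≤ α * Λ ^ 2 * T * 1 := by gcongr
    have e : 16 * ((α / γ * Λ * T) ^ 2 + (α / γ * Λ) ^ 2 * T / γ + α / γ * Λ / γ) =
        α / γ * (16 * (α * Λ ^ 2 * T ^ 2 + α * Λ ^ 2 * T * (1 / γ) + Λ) / γ) := by
      field_simp
    rw [e]
    refine mul_le_mul_of_nonneg_left ?_ (by positivity)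
    rw [div_le_iff₀ g0]
    nlinarith
  · have h : 16 * α * Λ ≤ γ := by linarith
    rw [div_le_iff₀ g0, show α / γ * Λ = α * Λ / γ by ring, div_le_iff₀ g0]
    nlinarith
  · have h : 1 / T ≤ γ := by linarith
    rw [div_le_iff₀ hT] at h
    have h2 : Real.exp (-γ * T) ≤ Real.exp (-1) := Real.exp_le_exp.2 (by linarith)
    refine h2.trans ?_
    rw [Real.exp_neg, one_div]
    refine inv_anti₀ (by norm_num) ?_
    have := Real.add_one_le_exp (1 : ℝ)
    linarith
  · have e : α / γ * (μ * T) = α * μ * T / γ := by ring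
    rw [e, div_le_iff₀ g0]
    linarith

section PlantBound

variable {N m : ℕ} {α γ μ T Λ t₀ : ℝ} {G : Fin m → SimpleGraph (Fin N)} {σ : ℝ → Fin m}
  {ts : ℕ → ℝ} {A : Finset (Fin N)} {p : ℝ≥0∞} {u : ℝ → EuclideanSpace ℝ A}
  {x : ℝ → EuclideanSpace ℝ (Fin N ⊕ Fin N)} {Q : Matrix (Fin (N - 1)) (Fin N) ℝ}

/-- Under persistent excitation and large damping the disagreement and the velocities are bounded by
an envelope whose constants do not grow with `γ`, except for the factor `γ` in front of the
velocities. -/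
theorem IsPlantSolution.norm_le (hx : IsPlantSolution α γ G σ A t₀ u x)
    (hσ : IsSwitchingSequence σ t₀ ts) (h0 : 0 ≤ t₀) (hp : 1 ≤ p) (hu : InLpe p t₀ u)
    (hQ : IsDisagreementMatrix Q) (hΛ : ∀ G : SimpleGraph (Fin N), opNorm (lap G) ≤ Λ)
    (hPE : IsPEConnected G σ Q μ T) (hα : 0 < α) (hμ : 0 < μ) (hT : 0 < T)
    (hγ : IsLargeDamping α μ T Λ γ) {t : ℝ} (ht : t₀ ≤ t) :
    ‖act Q (pos (x t))‖ ≤ 4 * envelope (3 / 4 * (α / γ * μ)) t₀ (3 * ‖x t₀‖)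
      (fun s => 8 * (‖u s‖ / γ)) t ∧
    ‖vel (x t)‖ ≤ γ * (4 * envelope (3 / 4 * (α / γ * μ)) t₀ (3 * ‖x t₀‖)
      (fun s => 8 * (‖u s‖ / γ)) t) := by
  have g0 : 0 < γ := by linarith [hγ.one_le]
  have hF := hx.isDampedFlow hσ hp hu hQ hΛ
  have h := hF.size_le_envelope hα g0 hT hμ (fun t ht z => hPE.le_inner hT hσ h0 ht z)
    hγ.window hγ.second_order hγ.cross hγ.fast hγ.rate ht
  set sz := IsDampedFlow.size (actL Q) γ (fun s => act Q (pos (x s))) (fun s => vel (x s)) with hsz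
  have hsz0 : sz t₀ ≤ 3 * ‖x t₀‖ := by
    have h1 : ‖act Q (pos (x t₀))‖ ≤ ‖x t₀‖ := (hQ.norm_le _).trans (norm_pos_le _)
    have h2 : ‖vel (x t₀)‖ / γ ≤ ‖x t₀‖ :=
      (div_le_self (norm_nonneg _) hγ.one_le).trans (norm_vel_le _)
    have h3 := hF.norm_smul_Q_le g0 (vel (x t₀))
    have h4 : ‖act Q (pos (x t₀)) + (1 / γ) • actL Q (vel (x t₀))‖ ≤ _ := norm_add_le _ _
    have h5 : sz t₀ = ‖act Q (pos (x t₀)) + (1 / γ) • actL Q (vel (x t₀))‖ +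
      ‖vel (x t₀)‖ / γ := rfl
    linarith
  have hmono : envelope (3 / 4 * (α / γ * μ)) t₀ (sz t₀)
      (fun s => 8 * (‖vel (act (inputMat A) (u s))‖ / γ)) t ≤
      envelope (3 / 4 * (α / γ * μ)) t₀ (3 * ‖x t₀‖) (fun s => 8 * (‖u s‖ / γ)) t := by
    refine envelope_mono hsz0 ht ((hF.int_norm_b le_rfl ht).const_mul 8)
      (((hu.intervalIntegrable hp le_rfl ht).norm.div_const γ).const_mul 8) fun s => ?_
    gcongr
    exact (norm_vel_le _).trans (norm_inputMat_le A (u s))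
  have h' : sz t ≤ 4 * envelope (3 / 4 * (α / γ * μ)) t₀ (3 * ‖x t₀‖)
      (fun s => 8 * (‖u s‖ / γ)) t := h.trans (by gcongr)
  refine ⟨(hF.norm_y_le g0 t).trans h', ?_⟩
  have h6 : ‖vel (x t)‖ / γ ≤ sz t := le_add_of_nonneg_left (norm_nonneg _)
  rw [div_le_iff₀ g0] at h6
  calc ‖vel (x t)‖ ≤ sz t * γ := h6
    _ ≤ _ := by rw [mul_comm]; gcongr

end PlantBound

/-! ### The constants of the detection threshold -/

theorem lamChi_le {N : ℕ} {α γ μ T : ℝ} (hα : 0 < α) (hμ : 0 < μ) (hT : 0 < T) (hγ : 0 < γ)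
    (h : α / γ * (μ * T) ≤ 1 / 4) : lamChi N α γ μ T ≤ 3 / 4 * (α / γ * μ) := by
  set s := (α / γ) * μ * T / (1 + (α / γ) ^ 2 * (N : ℝ) ^ 2 * T ^ 2) with hs
  have hs0 : 0 < s := by positivity
  have hs1 : s ≤ α / γ * μ * T := div_le_self (by positivity) (by
    have : 0 ≤ (α / γ) ^ 2 * (N : ℝ) ^ 2 * T ^ 2 := by positivity
    linarith)
  have hs2 : s ≤ 1 / 4 := by linarith
  have hlog : -Real.log (1 - s) ≤ 3 / 2 * s := by
    have h1 := Real.one_sub_inv_le_log_of_pos (x := 1 - s) (by linarith)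
    have h2 : (1 - s)⁻¹ ≤ 1 + 3 / 2 * s := by
      rw [inv_le_iff_one_le_mul₀ (by linarith)]
      nlinarith
    linarith
  have hlog0 : Real.log (1 - s) ≤ 0 := Real.log_nonpos (by linarith) (by linarith)
  have e : eta N α γ μ T = 1 / (2 * T) * -Real.log (1 - s) := by
    unfold eta; rw [← hs]; ring
  have he0 : 0 ≤ eta N α γ μ T := by
    rw [e]; exact mul_nonneg (by positivity) (by linarith)
  have he1 : eta N α γ μ T ≤ 3 / 4 * (α / γ * μ) := by
    rw [e]
    calc 1 / (2 * T) * -Real.log (1 - s) ≤ 1 / (2 * T) * (3 / 2 * (α / γ * μ * T)) := by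
          gcongr; linarith
      _ = _ := by field_simp; ring
  unfold lamChi
  refine (mul_le_of_le_one_right he0 (Real.exp_le_one_iff.2 ?_)).trans he1
  have : 0 ≤ eta N α γ μ T * T := by positivity
  linarith

/-- `κ_x` is at least `γ`: the factor under the root is at least one, `‖C‖ ≥ 1` and
`‖C⁻¹‖ ≥ γ`. -/
theorem le_kappaX {N : ℕ} (hN : 2 ≤ N) {α γ μ T β : ℝ} (hα : 0 < α) (hγ : 0 < γ) (hβ : 0 < β)
    (Q : Matrix (Fin (N - 1)) (Fin N) ℝ) : γ ≤ kappaX α γ μ T β Q := by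
  have hNpos : (0 : ℝ) < N := by positivity
  set C := coordMat γ Q with hC
  set C' : Matrix (Fin (N - 1) ⊕ Fin N) (Fin (N - 1) ⊕ Fin N) ℝ :=
    Matrix.fromBlocks (γ • 1) Q 0 1 with hC'
  have hinv : C⁻¹ = C' := by
    refine Matrix.inv_eq_right_inv ?_
    rw [hC, coordMat, hC', Matrix.fromBlocks_multiply]
    simp [smul_smul, hγ.ne', ← Matrix.fromBlocks_one]
  have h1 : 1 ≤ opNorm C := by
    set v : EuclideanSpace ℝ (Fin (N - 1) ⊕ Fin N) :=
      EuclideanSpace.single (Sum.inr ⟨0, by lia⟩) 1 with hv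
    have hvn : ‖v‖ = 1 := by simp [hv]
    have h := (actL C).le_opNorm v
    rw [hvn, mul_one] at h
    refine le_trans ?_ h
    have h2 := PiLp.norm_apply_le (actL C v) (Sum.inr ⟨0, by lia⟩)
    refine le_trans (le_of_eq ?_) h2
    rw [actL_apply]
    simp [hC, coordMat, hv]
  have h2 : γ ≤ opNorm C⁻¹ := by
    rw [hinv]
    set v : EuclideanSpace ℝ (Fin (N - 1) ⊕ Fin N) :=
      EuclideanSpace.single (Sum.inl ⟨0, by lia⟩) 1 with hv
    have hvn : ‖v‖ = 1 := by simp [hv]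
    have h := (actL C').le_opNorm v
    rw [hvn, mul_one] at h
    refine le_trans ?_ h
    have h2 := PiLp.norm_apply_le (actL C' v) (Sum.inl ⟨0, by lia⟩)
    refine le_trans (le_of_eq ?_) h2
    rw [actL_apply]
    simp [hC', hv, abs_of_pos hγ]
  have h3 : 1 ≤ Real.sqrt (max (lamChi N α γ μ T)⁻¹ β / min (γ / (α * N)) β) := by
    rw [Real.one_le_sqrt, one_le_div (lt_min (by positivity) hβ)]
    exact (min_le_right _ _).trans (le_max_right _ _)
  unfold kappaX
  rw [← hC]
  calc γ = 1 * 1 * γ := by ring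
    _ ≤ _ := by gcongr

/-! ### The error system within one mode -/

theorem norm_exp_apply_le {E : Type*} [NormedAddCommGroup E] [NormedSpace ℝ E] [CompleteSpace E]
    {A : E →L[ℝ] E} {e d : ℝ → E} {D : ℝ → ℝ} {a b κ lam M : ℝ} (hab : a ≤ b)
    (hA : ∀ s : ℝ, 0 ≤ s → ‖NormedSpace.exp (s • A)‖ ≤ κ * Real.exp (-lam * s))
    (hM : ∀ s : ℝ, 0 ≤ s → ‖NormedSpace.exp (s • A) (e a)‖ ≤ M * Real.exp (-lam * s))
    (hc : ContinuousOn e (Set.Icc a b)) (hd : IntervalIntegrable d volume a b)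
    (he : ∀ t ∈ Set.Icc a b, e t = e a + ∫ s in a..t, (A (e s) + d s))
    (hD : IntervalIntegrable D volume a b) (hdD : ∀ s ∈ Set.Icc a b, ‖d s‖ ≤ D s)
    {s : ℝ} (hs : 0 ≤ s) :
    ‖NormedSpace.exp (s • A) (e b)‖ ≤
      (Real.exp (-lam * (b - a)) * M + κ * expConv lam a D b) * Real.exp (-lam * s) := by
  let _ : NormedAlgebra ℚ (E →L[ℝ] E) := NormedAlgebra.restrictScalars ℚ ℝ _
  have hadd : ∀ (r : ℝ) (z : E), NormedSpace.exp (s • A) (NormedSpace.exp (r • A) z) =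
      NormedSpace.exp ((s + r) • A) z := fun r z => by
    rw [add_smul, NormedSpace.exp_add_of_commute (((Commute.refl A).smul_left s).smul_right r)]
    rfl
  have hΦd : IntervalIntegrable (fun r => NormedSpace.exp ((b - r) • A) (d r)) volume a b := by
    obtain ⟨K, hK⟩ := isCompact_Icc.exists_bound_of_continuousOn
      (s := Set.uIcc a b) (continuous_exp_sub_smul A b).continuousOn
    refine IntervalIntegrable.mono_fun (hd.norm.const_mul K) ?_ ?_
    · exact (ContinuousLinearMap.id ℝ (E →L[ℝ] E)).aestronglyMeasurable_comp₂
        (continuous_exp_sub_smul A b).aestronglyMeasurable hd.def'.aestronglyMeasurable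
    · refine (ae_restrict_iff' measurableSet_uIoc).2 (ae_of_all _ fun s hs => ?_)
      have hs' := hK s (Set.uIoc_subset_uIcc hs)
      have : 0 ≤ K := (norm_nonneg _).trans hs'
      simp only [norm_mul, norm_norm, Real.norm_of_nonneg this]
      exact ContinuousLinearMap.le_of_opNorm_le _ hs' _
  rw [eq_exp_add_integral hab hc hd he, map_add, hadd,
    ← (NormedSpace.exp (s • A)).intervalIntegral_comp_comm hΦd]
  simp only [hadd]
  refine (norm_add_le _ _).trans ?_
  rw [add_mul]
  refine add_le_add ?_ ?_
  · refine (hM _ (by linarith)).trans (le_of_eq ?_)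
    rw [mul_comm (Real.exp _) M, mul_assoc, ← Real.exp_add]
    ring_nf
  · have h1 : ∀ r ∈ Set.Ioc a b, ‖NormedSpace.exp ((s + (b - r)) • A) (d r)‖ ≤
        κ * Real.exp (-lam * s) * (Real.exp (-lam * (b - r)) * D r) := by
      intro r hr
      have h2 := hA (s + (b - r)) (by linarith [hr.2])
      have h3 := hdD r ⟨hr.1.le, hr.2⟩
      calc _ ≤ κ * Real.exp (-lam * (s + (b - r))) * ‖d r‖ :=
            ContinuousLinearMap.le_of_opNorm_le _ h2 _
        _ ≤ κ * Real.exp (-lam * (s + (b - r))) * D r :=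
            mul_le_mul_of_nonneg_left h3 ((norm_nonneg _).trans h2)
        _ = _ := by rw [mul_add, Real.exp_add]; ring
    refine (intervalIntegral.norm_integral_le_of_norm_le hab (ae_of_all _ h1)
      ((intervalIntegrable_exp_mul hD).const_mul _)).trans (le_of_eq ?_)
    rw [intervalIntegral.integral_const_mul]
    unfold expConv
    ring

/-- The unforced error flow of mode `q` takes the error of the state difference `z` to zero at the
rate `lam`, starting below `M`. Measuring errors by such bounds instead of the Euclidean norm
makes the constant `κ` of the modes enter at switches only. -/
def FlowBound {N m : ℕ} (α γ : ℝ) (G : Fin m → SimpleGraph (Fin N)) (i : Fin N)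
    (H : ∀ q, Matrix (hood2 (G q) i) (hood2 (G q) i) ℝ) (h : Fin m → ℝ) (lam : ℝ) (q : Fin m)
    (z : EuclideanSpace ℝ (Fin N ⊕ Fin N)) (M : ℝ) : Prop :=
  ∀ s : ℝ, 0 ≤ s → ‖act (NormedSpace.exp (s • errMat α γ (G q) i (H q) (h q)))
    (restr (hood2 (G q) i) z)‖ ≤ M * Real.exp (-lam * s)

/-- `restr S` as a continuous linear map. -/
noncomputable abbrev restrL {N : ℕ} (S : Finset (Fin N)) :
    EuclideanSpace ℝ (Fin N ⊕ Fin N) →L[ℝ] EuclideanSpace ℝ (S ⊕ S) :=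
  pull (Sum.map Subtype.val Subtype.val)

section Error

variable {N m : ℕ} {α γ μ T Λ t₀ κ lam : ℝ} {Q : Matrix (Fin (N - 1)) (Fin N) ℝ}
  {G : Fin m → SimpleGraph (Fin N)} {i : Fin N}
  {H : ∀ q, Matrix (hood2 (G q) i) (hood2 (G q) i) ℝ} {h : Fin m → ℝ} {σ : ℝ → Fin m}
  {ts : ℕ → ℝ} {A : Finset (Fin N)} {p : ℝ≥0∞} {u : ℝ → EuclideanSpace ℝ A}
  {x xh : ℝ → EuclideanSpace ℝ (Fin N ⊕ Fin N)} {q : Fin m}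

theorem err_eq (t : ℝ) : err G i q x xh t = restr (hood2 (G q) i) (x t - xh t) := rfl

theorem actL_exp_smul {ι : Type*} [Fintype ι] [DecidableEq ι] (s : ℝ) (M : Matrix ι ι ℝ) :
    actL (NormedSpace.exp (s • M)) = NormedSpace.exp (s • actL M) := by
  rw [actL_exp, actL_smul]

theorem ModeDecay.norm_exp_le (hq : ModeDecay α γ G i H h q κ lam) (s : ℝ) (hs : 0 ≤ s) :
    ‖NormedSpace.exp (s • actL (errMat α γ (G q) i (H q) (h q)))‖ ≤ κ * Real.exp (-lam * s) := by
  rw [← actL_exp_smul]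
  exact hq.bound s hs

theorem ModeDecay.one_le (hq : ModeDecay α γ G i H h q κ lam) : 1 ≤ κ := by
  have h1 := hq.bound 0 le_rfl
  have : Nonempty (hood2 (G q) i) := ⟨self (G q) i⟩
  rw [zero_smul, NormedSpace.exp_zero, opNorm_eq,
    show actL (1 : Matrix (hood2 (G q) i ⊕ hood2 (G q) i) _ ℝ) = 1 from
      ContinuousLinearMap.ext fun z => actL_one z, norm_one, mul_zero, Real.exp_zero,
    mul_one] at h1
  exact h1

theorem ModeDecay.flowBound (hq : ModeDecay α γ G i H h q κ lam)
    (z : EuclideanSpace ℝ (Fin N ⊕ Fin N)) :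
    FlowBound α γ G i H h lam q z (κ * ‖restr (hood2 (G q) i) z‖) := fun s hs => by
  rw [mul_right_comm]
  exact ContinuousLinearMap.le_of_opNorm_le _ (hq.bound s hs) _

theorem FlowBound.norm_le {z : EuclideanSpace ℝ (Fin N ⊕ Fin N)} {M : ℝ}
    (hz : FlowBound α γ G i H h lam q z M) : ‖restr (hood2 (G q) i) z‖ ≤ M := by
  have := hz 0 le_rfl
  simpa [NormedSpace.exp_zero, act_eq, actL_one] using this

theorem FlowBound.mono {z : EuclideanSpace ℝ (Fin N ⊕ Fin N)} {M M' : ℝ}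
    (hz : FlowBound α γ G i H h lam q z M) (hM : M ≤ M') : FlowBound α γ G i H h lam q z M' :=
  fun s hs => (hz s hs).trans (by gcongr)

/-- The equation of the estimation error within a mode. The forcing consists of the couplings
missing in the local model and of the attack. -/
theorem IsRun.err_eqn (hr : IsRun α γ μ T Q G i H h σ t₀ ts A p u x xh) (k : ℕ) {t : ℝ}
    (ht : t ∈ Set.Ico (ts k) (ts (k + 1))) :
    err G i (σ (ts k)) x xh t = err G i (σ (ts k)) x xh (ts k) + ∫ s in (ts k)..t,
      (actL (errMat α γ (G (σ (ts k))) i (H (σ (ts k))) (h (σ (ts k))))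
        (err G i (σ (ts k)) x xh s) +
      (restr (hood2 (G (σ (ts k))) i) (act (sysMat α γ (lap (G (σ (ts k))))) (x s)) -
        act (locMat α γ (G (σ (ts k))) i) (restr (hood2 (G (σ (ts k))) i) (x s)) +
        restr (hood2 (G (σ (ts k))) i) (act (inputMat A) (u s)))) := by
  have hk := hr.switching.start_le k
  set q := σ (ts k) with hq
  have hpl := congrArg (restr (hood2 (G q) i))
    (hr.plant.eqn_sub hr.switching hr.one_le hr.input hk ht.1)
  have hi := intervalIntegrable_plant hr.switching hr.one_le hr.input hr.plant hk ht.1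
  have hpl' : restr (hood2 (G q) i) (x t) = restr (hood2 (G q) i) (x (ts k)) +
      ∫ s in (ts k)..t, restr (hood2 (G q) i)
        (act (sysMat α γ (lap (G (σ s)))) (x s) + act (inputMat A) (u s)) := by
    rw [hpl, restr_eq_pull, map_add]
    simp only [restr_eq_pull]
    rw [← (restrL (hood2 (G q) i)).intervalIntegral_comp_comm hi]
  have hi' : IntervalIntegrable (fun s => restr (hood2 (G q) i)
      (act (sysMat α γ (lap (G (σ s)))) (x s) + act (inputMat A) (u s))) volume (ts k) t :=
    hi.clm_comp (restrL _)
  have hcx : ContinuousOn (fun s => restr (hood2 (G q) i) (x s)) (Set.uIcc (ts k) t) := by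
    refine (restrL _).continuous.comp_continuousOn
      (hr.plant.cont.mono ?_)
    rw [Set.uIcc_of_le ht.1]
    exact fun s hs => hk.trans hs.1
  have hcxh : ContinuousOn (fun s => restr (hood2 (G q) i) (xh s)) (Set.uIcc (ts k) t) := by
    refine (hr.observer.cont k).mono ?_
    rw [Set.uIcc_of_le ht.1]
    exact fun s hs => ⟨hs.1, hs.2.trans_lt ht.2⟩
  have hio : IntervalIntegrable (fun s =>
      (act (locMat α γ (G q) i) (restr (hood2 (G q) i) (xh s)) +
          act (gainMat (G q) i (H q) (h q))
            (act (outMat (G q) i) (restr (hood2 (G q) i) (x s)) -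
              act (outMat (G q) i) (restr (hood2 (G q) i) (xh s))))) volume (ts k) t := by
    refine ContinuousOn.intervalIntegrable (ContinuousOn.add ?_ ?_)
    · exact (actL _).continuous.comp_continuousOn hcxh
    · exact (actL _).continuous.comp_continuousOn
        (((actL _).continuous.comp_continuousOn hcx).sub
          ((actL _).continuous.comp_continuousOn hcxh))
  unfold err
  rw [hpl', hr.observer.eqn k t ht, add_sub_add_comm, ← intervalIntegral.integral_sub hi' hio]
  congr 1
  refine intervalIntegral.integral_congr fun s hs => ?_
  rw [Set.uIcc_of_le ht.1] at hs
  have hσ : σ s = q := hr.switching.const k s ⟨hs.1, hs.2.trans_lt ht.2⟩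
  simp only [hσ, errMat, actL_sub, actL_mul, act_eq, restr_eq_pull, map_add, map_sub]
  abel

theorem IsRun.continuousOn_err (hr : IsRun α γ μ T Q G i H h σ t₀ ts A p u x xh) (k : ℕ) :
    ContinuousOn (err G i (σ (ts k)) x xh) (Set.Ico (ts k) (ts (k + 1))) := by
  refine ContinuousOn.sub ?_ (hr.observer.cont k)
  exact (restrL _).continuous.comp_continuousOn
    (hr.plant.cont.mono fun s hs => (hr.switching.start_le k).trans hs.1)

theorem norm_residual_le (t : ℝ) : ‖residual G i q x xh t‖ ≤ ‖err G i q x xh t‖ := by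
  have e : residual G i q x xh t = actL (outMat (G q) i) (err G i q x xh t) := by
    simp only [residual, err, act_eq, map_sub]
  have e2 : actL (outMat (G q) i) (err G i q x xh t) =
      pull (Sum.map id fun _ : Unit => self (G q) i) (err G i q x xh t) := by
    ext a
    rcases a with a | a
    · simp [actL_apply, outMat, Matrix.one_apply]
    · simp [actL_apply, outMat]
  rw [e, e2]
  exact norm_pull_le (Sum.map_injective.2 ⟨Function.injective_id, fun _ _ _ => rfl⟩) _

theorem abs_residual_le (t : ℝ) (j) : |residual G i q x xh t j| ≤ ‖err G i q x xh t‖ :=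
  (PiLp.norm_apply_le (residual G i q x xh t) j).trans (norm_residual_le t)

/-- Propagation of a flow bound within a mode, for a bound `D` of the forcing. -/
theorem IsRun.flowBound_of_mem_Ico (hr : IsRun α γ μ T Q G i H h σ t₀ ts A p u x xh)
    (hQ : IsDisagreementMatrix Q) (hα : 0 ≤ α)
    (hΛ : ∀ G : SimpleGraph (Fin N), opNorm (lap G) ≤ Λ ∧
      ∀ i, opNorm (lap (proxGraph G i)) ≤ Λ) {k : ℕ} {t M : ℝ}
    (ht : t ∈ Set.Ico (ts k) (ts (k + 1))) (hq : ModeDecay α γ G i H h (σ (ts k)) κ lam)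
    (hM : FlowBound α γ G i H h lam (σ (ts k)) (x (ts k) - xh (ts k)) M) {D : ℝ → ℝ}
    (hD : IntervalIntegrable D volume (ts k) t)
    (hdD : ∀ s ∈ Set.Icc (ts k) t, α * (2 * Λ) * ‖act Q (pos (x s))‖ + ‖u s‖ ≤ D s) :
    FlowBound α γ G i H h lam (σ (ts k)) (x t - xh t)
      (Real.exp (-lam * (t - ts k)) * M + κ * expConv lam (ts k) D t) := by
  intro s hs
  have hk := hr.switching.start_le k
  have hM' : ∀ s : ℝ, 0 ≤ s → ‖NormedSpace.exp
      (s • actL (errMat α γ (G (σ (ts k))) i (H (σ (ts k))) (h (σ (ts k)))))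
      (err G i (σ (ts k)) x xh (ts k))‖ ≤ M * Real.exp (-lam * s) := fun s hs => by
    rw [← actL_exp_smul]
    exact hM s hs
  rw [act_eq, actL_exp_smul, ← err_eq]
  refine norm_exp_apply_le ht.1 hq.norm_exp_le hM'
    ((hr.continuousOn_err k).mono fun s hs => ⟨hs.1, hs.2.trans_lt ht.2⟩) ?_
    (fun r hrt => hr.err_eqn k ⟨hrt.1, hrt.2.trans_lt ht.2⟩) hD (fun r hrt => ?_) hs
  · have hcx : ContinuousOn x (Set.uIcc (ts k) t) := hr.plant.cont.mono (by
      rw [Set.uIcc_of_le ht.1]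
      exact fun s hs => hk.trans hs.1)
    refine IntervalIntegrable.add (ContinuousOn.intervalIntegrable (ContinuousOn.sub ?_ ?_)) ?_
    · exact (restrL _).continuous.comp_continuousOn
        ((actL _).continuous.comp_continuousOn hcx)
    · exact (actL _).continuous.comp_continuousOn
        ((restrL _).continuous.comp_continuousOn hcx)
    · exact ((hr.input.intervalIntegrable hr.one_le hk ht.1).clm_comp
        (actL (inputMat A))).clm_comp (restrL _)
  · refine (norm_add_le _ _).trans (le_trans (add_le_add ?_ ?_) (hdD r hrt))
    · exact hQ.norm_restr_sysMat_sub_le hα _ i (hΛ _).1 ((hΛ _).2 i) (x r)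
    · exact (norm_restr_le _ _).trans (norm_inputMat_le A (u r))

/-- At a switching time without reset the bound passes to the limit. -/
theorem IsRun.flowBound_of_noReset (hr : IsRun α γ μ T Q G i H h σ t₀ ts A p u x xh)
    (hQ : IsDisagreementMatrix Q) (hα : 0 ≤ α)
    (hΛ : ∀ G : SimpleGraph (Fin N), opNorm (lap G) ≤ Λ ∧
      ∀ i, opNorm (lap (proxGraph G i)) ≤ Λ) {k : ℕ} {M : ℝ}
    (hq : ModeDecay α γ G i H h (σ (ts k)) κ lam)
    (hM : FlowBound α γ G i H h lam (σ (ts k)) (x (ts k) - xh (ts k)) M) {D : ℝ → ℝ}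
    (hD : IntervalIntegrable D volume (ts k) (ts (k + 1)))
    (hdD : ∀ s, t₀ ≤ s → α * (2 * Λ) * ‖act Q (pos (x s))‖ + ‖u s‖ ≤ D s)
    (hnr : activeHood G i σ (ts (k + 1)) = activeHood G i σ (ts k)) :
    FlowBound α γ G i H h lam (σ (ts k)) (x (ts (k + 1)) - xh (ts (k + 1)))
      (Real.exp (-lam * (ts (k + 1) - ts k)) * M + κ * expConv lam (ts k) D (ts (k + 1))) := by
  intro s hs
  have hlt : ts k < ts (k + 1) := hr.switching.strictMono (Nat.lt_succ_self k)
  have hk := hr.switching.start_le k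
  have hmem : Set.Ico (ts k) (ts (k + 1)) ∈ 𝓝[<] (ts (k + 1)) := Ico_mem_nhdsLT hlt
  have hxh : Tendsto (fun t => restr (hood2 (G (σ (ts k))) i) (xh t)) (𝓝[<] (ts (k + 1)))
      (𝓝 (restr (hood2 (G (σ (ts k))) i) (xh (ts (k + 1))))) := by
    have := hr.observer.noReset k hnr
    rw [hnr] at this
    exact this
  have hx : Tendsto (fun t => restr (hood2 (G (σ (ts k))) i) (x t)) (𝓝[<] (ts (k + 1)))
      (𝓝 (restr (hood2 (G (σ (ts k))) i) (x (ts (k + 1))))) := by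
    have h1 : ContinuousAt x (ts (k + 1)) :=
      hr.plant.cont.continuousAt (Ici_mem_nhds (hk.trans_lt hlt))
    have h2 : Tendsto (pull (Sum.map Subtype.val Subtype.val :
        hood2 (G (σ (ts k))) i ⊕ hood2 (G (σ (ts k))) i → Fin N ⊕ Fin N))
        (𝓝 (x (ts (k + 1)))) (𝓝 (pull (Sum.map Subtype.val Subtype.val) (x (ts (k + 1))))) :=
      (pull _).continuous.continuousAt
    exact (h2.comp h1).mono_left nhdsWithin_le_nhds
  have hz : Tendsto (fun t => restr (hood2 (G (σ (ts k))) i) (x t - xh t)) (𝓝[<] (ts (k + 1)))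
      (𝓝 (restr (hood2 (G (σ (ts k))) i) (x (ts (k + 1)) - xh (ts (k + 1))))) := hx.sub hxh
  have hL := (((actL (NormedSpace.exp (s • errMat α γ (G (σ (ts k))) i (H (σ (ts k)))
    (h (σ (ts k)))))).continuous.tendsto _).comp hz).norm
  have hcE : Tendsto (expConv lam (ts k) D) (𝓝[<] (ts (k + 1)))
      (𝓝 (expConv lam (ts k) D (ts (k + 1)))) := by
    have h1 := (continuousOn_expConv (ν := lam) hD hlt.le) (ts (k + 1)) ⟨hlt.le, le_rfl⟩
    refine h1.tendsto.mono_left ?_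
    rw [← nhdsWithin_Ico_eq_nhdsLT hlt]
    exact nhdsWithin_mono _ Set.Ico_subset_Icc_self
  have hR : Tendsto (fun t => (Real.exp (-lam * (t - ts k)) * M + κ * expConv lam (ts k) D t) *
      Real.exp (-lam * s)) (𝓝[<] (ts (k + 1))) (𝓝 ((Real.exp (-lam * (ts (k + 1) - ts k)) * M +
        κ * expConv lam (ts k) D (ts (k + 1))) * Real.exp (-lam * s))) := by
    refine Tendsto.mul_const _ (Tendsto.add ?_ (hcE.const_mul κ))
    have h1 : Continuous fun t => Real.exp (-lam * (t - ts k)) * M := by fun_prop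
    exact (h1.tendsto _).mono_left nhdsWithin_le_nhds
  refine le_of_tendsto_of_tendsto hL hR ?_
  filter_upwards [hmem] with t ht
  refine hr.flowBound_of_mem_Ico hQ hα hΛ ht hq hM (hD.mono_set ?_)
    (fun s hs => hdD s (hk.trans hs.1)) s hs
  rw [Set.uIcc_of_le ht.1, Set.uIcc_of_le hlt.le]
  exact Set.Icc_subset_Icc_right ht.2.le

/-- After a reset only velocities of other agents contribute to the error. -/
theorem IsRun.norm_err_reset_le (hr : IsRun α γ μ T Q G i H h σ t₀ ts A p u x xh) {k : ℕ}
    (hk : k = 0 ∨ activeHood G i σ (ts k) ≠ activeHood G i σ (ts (k - 1))) :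
    ‖restr (hood2 (G (σ (ts k))) i) (x (ts k) - xh (ts k))‖ ≤ ‖vel (x (ts k))‖ := by
  set q := σ (ts k) with hq
  set w := restr (hood2 (G q) i) (x (ts k)) with hw
  have e : restr (hood2 (G q) i) (x (ts k) - xh (ts k)) = w - actL (resetMat (G q) i) w := by
    have := hr.observer.reset k hk
    rw [← hq] at this
    rw [restr_eq_pull, map_sub, ← restr_eq_pull, ← restr_eq_pull, this, act_eq]
  have h1 : ∀ a, (w - actL (resetMat (G q) i) w) (Sum.inl a) = 0 := fun a => by
    simp [actL_apply, resetMat, Matrix.one_apply]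
  have h2 : ∀ a, |(w - actL (resetMat (G q) i) w) (Sum.inr a)| ≤ |w (Sum.inr a)| := fun a => by
    have : actL (resetMat (G q) i) w (Sum.inr a) =
        if a = self (G q) i then w (Sum.inr a) else 0 := by
      rw [actL_apply]
      by_cases ha : a = self (G q) i <;> simp [resetMat, ha]
    rw [PiLp.sub_apply, this]
    split_ifs <;> simp
  rw [e]
  refine le_trans ?_ (norm_pull_le (f := (Subtype.val : hood2 (G q) i → Fin N))
    Subtype.val_injective (vel (x (ts k))))
  rw [EuclideanSpace.norm_eq, EuclideanSpace.norm_eq, Fintype.sum_sum_type]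
  refine Real.sqrt_le_sqrt ?_
  simp only [h1, norm_zero]
  rw [Finset.sum_eq_zero (fun _ _ => by simp), zero_add]
  refine Finset.sum_le_sum fun a _ => ?_
  exact pow_le_pow_left₀ (norm_nonneg _) (h2 a) 2

end Error

/-! ### Bounds over the whole time axis -/

/-- The bound of the forcing of the error system in terms of the plant state and the input. -/
noncomputable def forcingBound {N : ℕ} (α Λ : ℝ) (Q : Matrix (Fin (N - 1)) (Fin N) ℝ)
    {A : Finset (Fin N)} (u : ℝ → EuclideanSpace ℝ A)
    (x : ℝ → EuclideanSpace ℝ (Fin N ⊕ Fin N)) (s : ℝ) : ℝ :=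
  α * (2 * Λ) * ‖act Q (pos (x s))‖ + ‖u s‖

/-- A common decay rate of the plant and of exponentials of rate `lam`. -/
structure IsCommonRate (α γ μ lam ν : ℝ) : Prop where
  pos : 0 < ν
  le_plant : ν ≤ 3 / 4 * (α / γ * μ)
  lt : ν < lam

theorem exists_isCommonRate {α γ μ lam : ℝ} (hα : 0 < α) (hγ : 0 < γ) (hμ : 0 < μ)
    (hlam : 0 < lam) : ∃ ν, IsCommonRate α γ μ lam ν :=
  ⟨min (3 / 4 * (α / γ * μ)) (lam / 2), lt_min (by positivity) (by positivity), min_le_left _ _,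
    (min_le_right _ _).trans_lt (by linarith)⟩

section Global

variable {N m : ℕ} {α γ μ T Λ t₀ κ lam ν : ℝ} {Q : Matrix (Fin (N - 1)) (Fin N) ℝ}
  {G : Fin m → SimpleGraph (Fin N)} {i : Fin N}
  {H : ∀ q, Matrix (hood2 (G q) i) (hood2 (G q) i) ℝ} {h : Fin m → ℝ} {σ : ℝ → Fin m}
  {ts : ℕ → ℝ} {A : Finset (Fin N)} {p : ℝ≥0∞} {u : ℝ → EuclideanSpace ℝ A}
  {x xh : ℝ → EuclideanSpace ℝ (Fin N ⊕ Fin N)}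

theorem forcingBound_nonneg (hα : 0 ≤ α) (hΛ : 0 ≤ Λ) (s : ℝ) : 0 ≤ forcingBound α Λ Q u x s := by
  unfold forcingBound
  positivity

theorem IsRun.intervalIntegrable_norm_input (hr : IsRun α γ μ T Q G i H h σ t₀ ts A p u x xh)
    {a t : ℝ} (ha : t₀ ≤ a) (hat : a ≤ t) : IntervalIntegrable (fun s => ‖u s‖) volume a t :=
  (hr.input.intervalIntegrable hr.one_le ha hat).norm

theorem IsRun.intervalIntegrable_forcingBound
    (hr : IsRun α γ μ T Q G i H h σ t₀ ts A p u x xh) (Λ : ℝ) {a t : ℝ} (ha : t₀ ≤ a)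
    (hat : a ≤ t) : IntervalIntegrable (forcingBound α Λ Q u x) volume a t := by
  refine IntervalIntegrable.add (ContinuousOn.intervalIntegrable ?_)
    (hr.intervalIntegrable_norm_input ha hat)
  refine continuousOn_const.mul (ContinuousOn.norm ?_)
  exact (actL Q).continuous.comp_continuousOn ((pull Sum.inl).continuous.comp_continuousOn
    (hr.plant.cont.mono (by
      rw [Set.uIcc_of_le hat]
      exact fun s hs => ha.trans hs.1)))

/-- With all constants absorbed into the factor `32`, the plant stays below the envelope of the
initial state and the input. -/
theorem IsRun.plant_le (hr : IsRun α γ μ T Q G i H h σ t₀ ts A p u x xh)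
    (hQ : IsDisagreementMatrix Q) (hΛ : ∀ G : SimpleGraph (Fin N), opNorm (lap G) ≤ Λ)
    (hα : 0 < α) (hμ : 0 < μ) (hT : 0 < T) (hγ : IsLargeDamping α μ T Λ γ)
    (hν : ν ≤ 3 / 4 * (α / γ * μ)) {t : ℝ} (ht : t₀ ≤ t) :
    ‖act Q (pos (x t))‖ ≤ 32 * envelope ν t₀ ‖x t₀‖ (fun s => ‖u s‖) t ∧
    ‖vel (x t)‖ ≤ 32 * γ * envelope ν t₀ ‖x t₀‖ (fun s => ‖u s‖) t := by
  have h1 := hr.plant.norm_le hr.switching hr.nonneg hr.one_le hr.input hQ hΛ hr.pe hα hμ hT hγ ht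
  have g0 : 0 < γ := by linarith [hγ.one_le]
  have hi := hr.intervalIntegrable_norm_input le_rfl ht
  have h2 : envelope (3 / 4 * (α / γ * μ)) t₀ (3 * ‖x t₀‖) (fun s => 8 * (‖u s‖ / γ)) t ≤
      8 * envelope ν t₀ ‖x t₀‖ (fun s => ‖u s‖) t := by
    refine (envelope_anti (by positivity) (fun s => by positivity) hν ht
      ((hi.div_const γ).const_mul 8)).trans ?_
    refine (envelope_mono (X' := 8 * ‖x t₀‖) (g := fun s => 8 * ‖u s‖)
      (by linarith [norm_nonneg (x t₀)]) ht ((hi.div_const γ).const_mul 8) (hi.const_mul 8)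
      fun s => ?_).trans (le_of_eq ?_)
    · gcongr
      exact div_le_self (norm_nonneg _) hγ.one_le
    · unfold envelope
      rw [expConv_const_mul]
      ring
  exact ⟨h1.1.trans (by linarith), h1.2.trans (by nlinarith)⟩

/-- The response of a mode to the forcing stays below the same envelope, as the mode decays at the
rate `lam > ν`. -/
theorem IsRun.expConv_forcingBound_le (hr : IsRun α γ μ T Q G i H h σ t₀ ts A p u x xh)
    (hQ : IsDisagreementMatrix Q) (hΛ : ∀ G : SimpleGraph (Fin N), opNorm (lap G) ≤ Λ)
    (hΛ0 : 0 ≤ Λ) (hα : 0 < α) (hμ : 0 < μ) (hT : 0 < T) (hγ : IsLargeDamping α μ T Λ γ)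
    (hν : IsCommonRate α γ μ lam ν) {a t : ℝ} (ha : t₀ ≤ a) (hat : a ≤ t) :
    expConv lam a (forcingBound α Λ Q u x) t ≤
      (α * (2 * Λ) * 32 * (lam - ν)⁻¹ + 1) * envelope ν t₀ ‖x t₀‖ (fun s => ‖u s‖) t := by
  set E := envelope ν t₀ ‖x t₀‖ (fun s => ‖u s‖) with hE
  have hi := hr.intervalIntegrable_norm_input ha hat
  have hi0 := hr.intervalIntegrable_norm_input le_rfl (ha.trans hat)
  have hEi : IntervalIntegrable E volume a t := ContinuousOn.intervalIntegrable (by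
    rw [Set.uIcc_of_le hat]
    exact (continuousOn_envelope hi0 (ha.trans hat)).mono (Set.Icc_subset_Icc_left ha))
  have hc : 0 ≤ α * (2 * Λ) * 32 := by positivity
  have h1 : expConv lam a (forcingBound α Λ Q u x) t ≤
      expConv lam a (fun s => α * (2 * Λ) * 32 * E s + ‖u s‖) t := by
    refine expConv_mono hat (hr.intervalIntegrable_forcingBound Λ ha hat)
      ((hEi.const_mul _).add hi) fun s hs => ?_
    refine add_le_add ?_ le_rfl
    rw [mul_assoc (α * (2 * Λ))]
    exact mul_le_mul_of_nonneg_left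
      (hr.plant_le hQ hΛ hα hμ hT hγ hν.le_plant (ha.trans hs.1)).1 (by positivity)
  rw [expConv_add (hEi.const_mul _) hi, expConv_const_mul] at h1
  have h2 := expConv_envelope_le (norm_nonneg (x t₀)) (fun s => norm_nonneg (u s)) hν.lt ha hat hi0
  have h3 : expConv lam a (fun s => ‖u s‖) t ≤ E t := by
    refine (expConv_anti (fun s => norm_nonneg (u s)) hν.lt.le ha hat hi0).trans ?_
    exact le_add_of_nonneg_left (mul_nonneg (norm_nonneg _) (Real.exp_pos _).le)
  have h4 := mul_le_mul_of_nonneg_left h2 hc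
  linarith

open Classical in
/-- Number of changes of the label `lab` of the mode at the switching times of index in
`(a, b]`. -/
noncomputable def labelChanges {β : Type*} (lab : Fin m → β) (σ : ℝ → Fin m) (ts : ℕ → ℝ)
    (a b : ℕ) : ℕ :=
  ((Finset.Ioc a b).filter fun l => lab (σ (ts l)) ≠ lab (σ (ts (l - 1)))).card

open Classical in
theorem labelChanges_succ {β : Type*} (lab : Fin m → β) {a b : ℕ} (hab : a ≤ b) :
    labelChanges lab σ ts a (b + 1) = labelChanges lab σ ts a b +
      if lab (σ (ts (b + 1))) = lab (σ (ts b)) then 0 else 1 := by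
  unfold labelChanges
  have : Finset.Ioc a (b + 1) = insert (b + 1) (Finset.Ioc a b) := by
    ext l
    simp only [Finset.mem_insert, Finset.mem_Ioc]
    lia
  rw [this, Finset.filter_insert]
  split_ifs with h1 h2 h2
  · exact absurd h2 h1
  · rw [Finset.card_insert_of_notMem (by simp)]
  · rfl
  · exact absurd h2 (by simpa using h1)

theorem labelChanges_eq_zero {β : Type*} (lab : Fin m → β) {a b : ℕ}
    (h : ∀ l ∈ Finset.Ioc a b, lab (σ (ts l)) = lab (σ (ts (l - 1)))) :
    labelChanges lab σ ts a b = 0 := by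
  classical
  rw [labelChanges, Finset.card_eq_zero, Finset.filter_eq_empty_iff]
  exact fun l hl => not_not.2 (h l hl)

theorem labelChanges_self {β : Type*} (lab : Fin m → β) (a : ℕ) :
    labelChanges lab σ ts a a = 0 := by
  simp [labelChanges]

/-- The observer of agent `i` is not reset at the switching times of index in `(a, b]`. -/
def NoReset (G : Fin m → SimpleGraph (Fin N)) (i : Fin N) (σ : ℝ → Fin m) (ts : ℕ → ℝ)
    (a b : ℕ) : Prop :=
  ∀ l ∈ Finset.Ioc a b, activeHood G i σ (ts l) = activeHood G i σ (ts (l - 1))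

/-- Modes with equal labels have interchangeable error flows. -/
def IsFlowLabel {β : Type*} (α γ : ℝ) (G : Fin m → SimpleGraph (Fin N)) (i : Fin N)
    (H : ∀ q, Matrix (hood2 (G q) i) (hood2 (G q) i) ℝ) (h : Fin m → ℝ) (lam : ℝ)
    (lab : Fin m → β) : Prop :=
  ∀ q q' z M, lab q = lab q' → FlowBound α γ G i H h lam q z M →
    FlowBound α γ G i H h lam q' z M

theorem norm_restr_congr {S S' : Finset (Fin N)} (hS : S = S')
    (z : EuclideanSpace ℝ (Fin N ⊕ Fin N)) : ‖restr S z‖ = ‖restr S' z‖ := by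
  subst hS
  rfl

/-- Switching without reset costs a factor `κ` at a change of the label, which part of the decay
between the switches has to make up for. The number `B` is the logarithm of what is not yet made
up: it grows by `log κ` at each change, decreases at the rate `ω` in between, and stops at zero, so
that it is controlled by the changes since some time `ts j`. -/
theorem IsRun.exists_flowBound (hr : IsRun α γ μ T Q G i H h σ t₀ ts A p u x xh)
    (hQ : IsDisagreementMatrix Q) (hα : 0 ≤ α) (hΛ0 : 0 ≤ Λ)
    (hΛ : ∀ G : SimpleGraph (Fin N), opNorm (lap G) ≤ Λ ∧
      ∀ i, opNorm (lap (proxGraph G i)) ≤ Λ)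
    (hq : ∀ q, ModeDecay α γ G i H h q κ lam) {β : Type*} {lab : Fin m → β}
    (hlab : IsFlowLabel α γ G i H h lam lab) {ω : ℝ} (hω : 0 ≤ ω) (k : ℕ) :
    ∃ a B, a ≤ k ∧ NoReset G i σ ts a k ∧ 0 ≤ B ∧
      (∃ j, a ≤ j ∧ j ≤ k ∧
        B ≤ labelChanges lab σ ts j k * Real.log κ - ω * (ts k - ts j)) ∧
      FlowBound α γ G i H h lam (σ (ts k)) (x (ts k) - xh (ts k))
        (Real.exp B * envelope (lam - ω) (ts a) (κ * ‖vel (x (ts a))‖)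
          (fun s => κ ^ 2 * forcingBound α Λ Q u x s) (ts k)) := by
  classical
  have hκ1 : 1 ≤ κ := (hq (σ t₀)).one_le
  have hκ0 : 0 < κ := by linarith
  have hlog : 0 ≤ Real.log κ := Real.log_nonneg hκ1
  have hreset : ∀ k, (k = 0 ∨ activeHood G i σ (ts k) ≠ activeHood G i σ (ts (k - 1))) →
      ∃ a B, a ≤ k ∧ NoReset G i σ ts a k ∧ 0 ≤ B ∧
      (∃ j, a ≤ j ∧ j ≤ k ∧
        B ≤ labelChanges lab σ ts j k * Real.log κ - ω * (ts k - ts j)) ∧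
      FlowBound α γ G i H h lam (σ (ts k)) (x (ts k) - xh (ts k))
        (Real.exp B * envelope (lam - ω) (ts a) (κ * ‖vel (x (ts a))‖)
          (fun s => κ ^ 2 * forcingBound α Λ Q u x s) (ts k)) := by
    intro k hk
    refine ⟨k, 0, le_rfl, fun l hl => by simp at hl, le_rfl, ⟨k, le_rfl, le_rfl, ?_⟩, ?_⟩
    · simp [labelChanges_self]
    · refine ((hq (σ (ts k))).flowBound _).mono ?_
      have h1 := mul_le_mul_of_nonneg_left (hr.norm_err_reset_le hk) hκ0.le
      simpa [envelope, expConv] using h1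
  induction k with
  | zero => exact hreset 0 (Or.inl rfl)
  | succ k ih =>
    by_cases hnr : activeHood G i σ (ts (k + 1)) = activeHood G i σ (ts k)
    swap
    · exact hreset (k + 1) (Or.inr hnr)
    obtain ⟨a, B, hak, hnra, hB, ⟨j, haj, hjk, hBj⟩, hF⟩ := ih
    have hk := hr.switching.start_le k
    have hta := hr.switching.start_le a
    have hmono := hr.switching.strictMono.monotone
    have hΔ : ts k ≤ ts (k + 1) := hmono (Nat.le_succ k)
    set Δ := ts (k + 1) - ts k with hΔe
    set D := forcingBound α Λ Q u x with hD
    have hD0 : ∀ s, 0 ≤ D s := forcingBound_nonneg hα hΛ0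
    have hDi : ∀ {a t}, t₀ ≤ a → a ≤ t → IntervalIntegrable D volume a t :=
      fun h1 h2 => hr.intervalIntegrable_forcingBound Λ h1 h2
    have hF' := hr.flowBound_of_noReset hQ hα hΛ (hq (σ (ts k))) hF (hDi hk hΔ)
      (fun s _ => le_rfl) hnr
    set env := envelope (lam - ω) (ts a) (κ * ‖vel (x (ts a))‖) (fun s => κ ^ 2 * D s) with henv
    have hE0 : 0 ≤ env (ts k) := envelope_nonneg (by positivity)
      (fun s => mul_nonneg (by positivity) (hD0 s)) (hmono hak)
    have henv1 : Real.exp (-(lam - ω) * Δ) * env (ts k) +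
        κ ^ 2 * expConv (lam - ω) (ts k) D (ts (k + 1)) = env (ts (k + 1)) := by
      rw [← expConv_const_mul]
      exact envelope_eq ((hDi hta (hmono hak)).const_mul _) ((hDi hk hΔ).const_mul _)
    have hconv : expConv lam (ts k) D (ts (k + 1)) ≤
        expConv (lam - ω) (ts k) D (ts (k + 1)) :=
      expConv_anti hD0 (by linarith) le_rfl hΔ (hDi hk hΔ)
    have hconv0 : 0 ≤ expConv (lam - ω) (ts k) D (ts (k + 1)) := expConv_nonneg hD0 hΔ
    -- the bound before and after paying for a change of the label
    have hstep : ∀ c B' : ℝ, 0 ≤ c → c ≤ Real.log κ → 0 ≤ B' → B + c - ω * Δ ≤ B' →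
        Real.exp c * (Real.exp (-lam * Δ) * (Real.exp B * env (ts k)) +
          κ * expConv lam (ts k) D (ts (k + 1))) ≤ Real.exp B' * env (ts (k + 1)) := by
      intro c B' hc0 hc hB' hBB
      have h1 : Real.exp c ≤ κ := by
        rw [← Real.exp_log hκ0]
        exact Real.exp_le_exp.2 hc
      have h2 : Real.exp c * (Real.exp (-lam * Δ) * Real.exp B) ≤
          Real.exp B' * Real.exp (-(lam - ω) * Δ) := by
        rw [← Real.exp_add, ← Real.exp_add, ← Real.exp_add]
        exact Real.exp_le_exp.2 (by linarith)
      have h3 : Real.exp c * (κ * expConv lam (ts k) D (ts (k + 1))) ≤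
          Real.exp B' * (κ ^ 2 * expConv (lam - ω) (ts k) D (ts (k + 1))) := by
        have h4 : κ * expConv lam (ts k) D (ts (k + 1)) ≤
            κ * expConv (lam - ω) (ts k) D (ts (k + 1)) := mul_le_mul_of_nonneg_left hconv hκ0.le
        have h5 : 0 ≤ κ * expConv (lam - ω) (ts k) D (ts (k + 1)) := by positivity
        calc _ ≤ κ * (κ * expConv (lam - ω) (ts k) D (ts (k + 1))) :=
              (mul_le_mul_of_nonneg_left h4 (Real.exp_pos c).le).trans
                (mul_le_mul_of_nonneg_right h1 h5)
          _ = κ ^ 2 * expConv (lam - ω) (ts k) D (ts (k + 1)) := by ring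
          _ ≤ _ := le_mul_of_one_le_left (by positivity) (Real.one_le_exp hB')
      have h6 := mul_le_mul_of_nonneg_right h2 hE0
      rw [← henv1]
      nlinarith
    have hnra' : NoReset G i σ ts a (k + 1) := by
      intro l hl
      rcases eq_or_ne l (k + 1) with rfl | hl'
      · exact hnr
      · exact hnra l (by simp only [Finset.mem_Ioc] at hl ⊢; lia)
    have hcount : ∀ c : ℝ,
        c = (if lab (σ (ts (k + 1))) = lab (σ (ts k)) then 0 else Real.log κ) →
        ∃ j, a ≤ j ∧ j ≤ k + 1 ∧ max 0 (B + c - ω * Δ) ≤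
          labelChanges lab σ ts j (k + 1) * Real.log κ - ω * (ts (k + 1) - ts j) := by
      intro c hc
      rcases le_total (B + c - ω * Δ) 0 with hneg | hpos
      · exact ⟨k + 1, by lia, le_rfl, by rw [max_eq_left hneg]; simp [labelChanges_self]⟩
      · refine ⟨j, haj, by lia, ?_⟩
        rw [max_eq_right hpos, labelChanges_succ lab hjk, hc]
        split_ifs <;> push_cast <;> linarith
    by_cases hl : lab (σ (ts (k + 1))) = lab (σ (ts k))
    · refine ⟨a, max 0 (B + 0 - ω * Δ), by lia, hnra', le_max_left _ _,
        hcount 0 (by rw [if_pos hl]), ?_⟩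
      refine hlab _ _ _ _ hl.symm (hF'.mono ?_)
      have := hstep 0 _ le_rfl hlog (le_max_left 0 (B + 0 - ω * Δ)) (le_max_right _ _)
      rwa [Real.exp_zero, one_mul] at this
    · refine ⟨a, max 0 (B + Real.log κ - ω * Δ), by lia, hnra', le_max_left _ _,
        hcount _ (by rw [if_neg hl]), ?_⟩
      have h1 := hF'.norm_le
      rw [norm_restr_congr (show hood2 (G (σ (ts k))) i = hood2 (G (σ (ts (k + 1)))) i from
        hnr.symm)] at h1
      refine ((hq (σ (ts (k + 1)))).flowBound _).mono ?_
      have := hstep (Real.log κ) _ hlog le_rfl (le_max_left 0 (B + Real.log κ - ω * Δ))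
        (le_max_right _ _)
      rw [Real.exp_log hκ0] at this
      exact (mul_le_mul_of_nonneg_left h1 hκ0.le).trans this

/-- The dwell time turns the logarithmic debt of `IsRun.exists_flowBound` into the constant
`n * log κ`. -/
theorem IsRun.norm_err_le_envelope (hr : IsRun α γ μ T Q G i H h σ t₀ ts A p u x xh)
    (hQ : IsDisagreementMatrix Q) (hα : 0 ≤ α) (hΛ0 : 0 ≤ Λ)
    (hΛ : ∀ G : SimpleGraph (Fin N), opNorm (lap G) ≤ Λ ∧
      ∀ i, opNorm (lap (proxGraph G i)) ≤ Λ)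
    (hq : ∀ q, ModeDecay α γ G i H h q κ lam) {β : Type*} {lab : Fin m → β}
    (hlab : IsFlowLabel α γ G i H h lam lab) {n : ℕ} {τ : ℝ} (hτ : 0 < τ)
    (hdwell : ∀ a b : ℕ, a ≤ b → NoReset G i σ ts a b →
      (labelChanges lab σ ts a b : ℝ) ≤ n + (ts b - ts a) / τ) {t : ℝ} (ht : t₀ ≤ t) :
    ∃ a, t₀ ≤ a ∧ a ≤ t ∧ ‖err G i (σ t) x xh t‖ ≤ Real.exp (n * Real.log κ) *
      envelope (lam - Real.log κ / τ) a (κ * ‖vel (x a)‖)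
        (fun s => κ ^ 2 * forcingBound α Λ Q u x s) t := by
  obtain ⟨k, hk⟩ := hr.switching.exists_mem_Ico ht
  have hκ1 : 1 ≤ κ := (hq (σ t₀)).one_le
  have hlog : 0 ≤ Real.log κ := Real.log_nonneg hκ1
  obtain ⟨a, B, hak, hnr, hB, ⟨j, haj, hjk, hBj⟩, hF⟩ :=
    hr.exists_flowBound hQ hα hΛ0 hΛ hq hlab (ω := Real.log κ / τ) (by positivity) k
  set ω := Real.log κ / τ with hω
  have hω0 : 0 ≤ ω := by positivity
  have hBn : B ≤ n * Real.log κ := by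
    have h1 := hdwell j k hjk fun l hl => hnr l (by simp only [Finset.mem_Ioc] at hl ⊢; lia)
    have h2 := mul_le_mul_of_nonneg_right h1 hlog
    have h3 : (n + (ts k - ts j) / τ) * Real.log κ = n * Real.log κ + ω * (ts k - ts j) := by
      rw [hω]; ring
    linarith
  have hmono := hr.switching.strictMono.monotone
  have hta := hr.switching.start_le a
  have htk := hr.switching.start_le k
  refine ⟨ts a, hta, (hmono hak).trans hk.1, ?_⟩
  rw [hr.switching.const k t hk]
  set D := forcingBound α Λ Q u x with hD
  have hD0 : ∀ s, 0 ≤ D s := forcingBound_nonneg hα hΛ0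
  have hDi : ∀ {a t}, t₀ ≤ a → a ≤ t → IntervalIntegrable D volume a t :=
    fun h1 h2 => hr.intervalIntegrable_forcingBound Λ h1 h2
  have h1 := (hr.flowBound_of_mem_Ico hQ hα hΛ hk (hq _) hF (hDi htk hk.1)
    (fun s _ => le_rfl)).norm_le
  refine h1.trans ?_
  set env := envelope (lam - ω) (ts a) (κ * ‖vel (x (ts a))‖) (fun s => κ ^ 2 * D s) with henv
  have hE0 : 0 ≤ env (ts k) := envelope_nonneg (by positivity)
    (fun s => mul_nonneg (by positivity) (hD0 s)) (hmono hak)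
  have henv1 : Real.exp (-(lam - ω) * (t - ts k)) * env (ts k) +
      κ ^ 2 * expConv (lam - ω) (ts k) D t = env t := by
    rw [← expConv_const_mul]
    exact envelope_eq ((hDi hta (hmono hak)).const_mul _) ((hDi htk hk.1).const_mul _)
  have hconv : expConv lam (ts k) D t ≤ expConv (lam - ω) (ts k) D t :=
    expConv_anti hD0 (by linarith) le_rfl hk.1 (hDi htk hk.1)
  have hconv0 : 0 ≤ expConv (lam - ω) (ts k) D t := expConv_nonneg hD0 hk.1
  have h2 : Real.exp (-lam * (t - ts k)) ≤ Real.exp (-(lam - ω) * (t - ts k)) :=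
    Real.exp_le_exp.2 (by nlinarith [hk.1])
  have h3 : Real.exp B ≤ Real.exp (n * Real.log κ) := Real.exp_le_exp.2 hBn
  have h4 : 1 ≤ Real.exp (n * Real.log κ) := Real.one_le_exp (by positivity)
  rw [← henv1, mul_add]
  refine add_le_add ?_ ?_
  · calc _ ≤ Real.exp (-(lam - ω) * (t - ts k)) * (Real.exp (n * Real.log κ) * env (ts k)) := by
          gcongr
      _ = _ := by ring
  · calc κ * expConv lam (ts k) D t ≤ κ ^ 2 * expConv (lam - ω) (ts k) D t := by
          have h5 : κ * 1 ≤ κ * κ := mul_le_mul_of_nonneg_left hκ1 (by linarith)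
          exact mul_le_mul (by nlinarith) hconv (expConv_nonneg hD0 hk.1) (by positivity)
      _ ≤ _ := le_mul_of_one_le_left (by positivity) h4

/-- If the changes of the label without reset are slow on average, then the error stays below a
multiple of the envelope of the initial state and the input. -/
theorem exists_norm_err_le (hQ : IsDisagreementMatrix Q) (hα : 0 < α) (hμ : 0 < μ) (hT : 0 < T)
    (hΛ0 : 0 ≤ Λ) (hΛ : ∀ G : SimpleGraph (Fin N), opNorm (lap G) ≤ Λ ∧
      ∀ i, opNorm (lap (proxGraph G i)) ≤ Λ) (hγ : IsLargeDamping α μ T Λ γ)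
    (hq : ∀ q, ModeDecay α γ G i H h q κ lam) {β : Type*} {lab : Fin m → β}
    (hlab : IsFlowLabel α γ G i H h lam lab) (n : ℕ) {τ : ℝ} (hτ : 0 < τ)
    (hκτ : Real.log κ < lam * τ) :
    ∃ K ν : ℝ, 0 < K ∧ 0 < ν ∧ ∀ σ t₀ ts A p u x xh,
      (∀ a b : ℕ, a ≤ b → NoReset G i σ ts a b →
        (labelChanges lab σ ts a b : ℝ) ≤ n + (ts b - ts a) / τ) →
      IsRun α γ μ T Q G i H h σ t₀ ts A p u x xh → ∀ t, t₀ ≤ t →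
        ‖err G i (σ t) x xh t‖ ≤ K * envelope ν t₀ ‖x t₀‖ (fun s => ‖u s‖) t := by
  have g0 : 0 < γ := by linarith [hγ.one_le]
  set lam' := lam - Real.log κ / τ with hlam'
  have hlam0 : 0 < lam' := by
    rw [hlam', sub_pos, div_lt_iff₀ hτ]
    exact hκτ
  obtain ⟨ν, hν⟩ := exists_isCommonRate hα g0 hμ hlam0
  set c := α * (2 * Λ) * 32 * (lam' - ν)⁻¹ + 1 with hc
  have hc0 : 0 < c := by
    have := inv_pos.2 (sub_pos.2 hν.lt)
    positivity
  refine ⟨Real.exp (n * Real.log κ) * (|κ| * (32 * γ) + κ ^ 2 * c + 1), ν, by positivity, hν.pos,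
    fun σ t₀ ts A p u x xh hd hr t ht => ?_⟩
  have hκ1 : 1 ≤ κ := (hq (σ t₀)).one_le
  obtain ⟨a, ha, hat, hle⟩ := hr.norm_err_le_envelope hQ hα.le hΛ0 hΛ hq hlab hτ hd ht
  rw [mul_assoc]
  refine hle.trans (mul_le_mul_of_nonneg_left ?_ (Real.exp_pos _).le)
  have hi := hr.intervalIntegrable_norm_input ha hat
  have hi0 := hr.intervalIntegrable_norm_input le_rfl ha
  set E := envelope ν t₀ ‖x t₀‖ (fun s => ‖u s‖) with hE
  have hEt : 0 ≤ E t := envelope_nonneg (norm_nonneg _) (fun s => norm_nonneg _) ht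
  have hEa : 0 ≤ E a := envelope_nonneg (norm_nonneg _) (fun s => norm_nonneg _) ha
  have h1 : ‖vel (x a)‖ * Real.exp (-lam' * (t - a)) ≤ 32 * γ * E t := by
    have h2 := (hr.plant_le hQ (fun G => (hΛ G).1) hα hμ hT hγ hν.le_plant ha).2
    have h3 : Real.exp (-lam' * (t - a)) ≤ Real.exp (-ν * (t - a)) :=
      Real.exp_le_exp.2 (by nlinarith [hν.lt])
    have h4 : Real.exp (-ν * (t - a)) * E a ≤ E t :=
      exp_mul_envelope_le (fun s => norm_nonneg (u s)) hi0 hi hat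
    calc _ ≤ 32 * γ * E a * Real.exp (-ν * (t - a)) :=
          mul_le_mul h2 h3 (Real.exp_pos _).le (by positivity)
      _ = 32 * γ * (Real.exp (-ν * (t - a)) * E a) := by ring
      _ ≤ _ := by gcongr
  have h5 := hr.expConv_forcingBound_le hQ (fun G => (hΛ G).1) hΛ0 hα hμ hT hγ hν ha hat
  unfold envelope
  rw [expConv_const_mul, abs_of_nonneg (by linarith), add_mul, add_mul]
  have h6 := mul_le_mul_of_nonneg_left h1 (show 0 ≤ κ by linarith)
  have h7 := mul_le_mul_of_nonneg_left h5 (sq_nonneg κ)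
  linarith

/-- Bounds by the envelope of the initial state and the input are stability bounds. -/
theorem GloballyStable.of_norm_err_le {S : (ℝ → Fin m) → (ℕ → ℝ) → Prop} {K : ℝ} (hK : 0 < K)
    (hν : 0 < ν)
    (hb : ∀ σ t₀ ts A p u x xh, S σ ts → IsRun α γ μ T Q G i H h σ t₀ ts A p u x xh →
      ∀ t, t₀ ≤ t → ‖err G i (σ t) x xh t‖ ≤ K * envelope ν t₀ ‖x t₀‖ (fun s => ‖u s‖) t) :
    GloballyStable α γ μ T Q G i H h S := by
  refine ⟨fun p hp => ?_, K, ν, hK, hν, fun σ t₀ ts p u x xh hS hr t ht => ?_⟩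
  · obtain ⟨B, hB, H⟩ := exists_eLpNorm_envelope_le hν hp
    refine ⟨K * (1 / ν), K * B, by positivity, by positivity,
      fun σ t₀ ts A u x xh hS hr Td hTd => ?_⟩
    have hi := hr.intervalIntegrable_norm_input le_rfl hTd
    have hE : ENNReal.ofReal K * eLpNorm (envelope ν t₀ ‖x t₀‖ fun s => ‖u s‖) p
        (volume.restrict (Set.Icc t₀ Td)) ≤ ENNReal.ofReal (K * (1 / ν)) *
          eLpNorm u p (volume.restrict (Set.Icc t₀ Td)) + ENNReal.ofReal (K * B * ‖x t₀‖) := by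
      refine (mul_le_mul_right (H t₀ Td _ _ (norm_nonneg _) hTd hi) _).trans (le_of_eq ?_)
      rw [mul_add, ← mul_assoc, ← ENNReal.ofReal_mul hK.le, ← ENNReal.ofReal_mul hK.le,
        eLpNorm_norm, mul_assoc]
    have key : ∀ f : ℝ → ℝ, (∀ t, t₀ ≤ t → ‖f t‖ ≤ ‖err G i (σ t) x xh t‖) →
        eLpNorm f p (volume.restrict (Set.Icc t₀ Td)) ≤ ENNReal.ofReal (K * (1 / ν)) *
          eLpNorm u p (volume.restrict (Set.Icc t₀ Td)) + ENNReal.ofReal (K * B * ‖x t₀‖) := by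
      intro f hf
      refine le_trans ?_ hE
      refine eLpNorm_le_mul_eLpNorm_of_ae_le_mul ?_ p
      refine (ae_restrict_iff' measurableSet_Icc).2 (ae_of_all _ fun t ht => ?_)
      refine ((hf t ht.1).trans (hb σ t₀ ts A p u x xh hS hr t ht.1)).trans ?_
      exact mul_le_mul_of_nonneg_left (Real.le_norm_self _) hK.le
    exact ⟨key _ fun t _ => by rw [norm_norm], key _ fun t _ => by
      rw [norm_norm]; exact norm_residual_le t⟩
  · refine (hb σ t₀ ts ∅ p u x xh hS hr t ht).trans (le_of_eq ?_)
    have hu : ∀ s, ‖u s‖ = 0 := fun s => by rw [Subsingleton.elim (u s) 0, norm_zero]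
    simp [envelope, expConv, hu, mul_assoc]

end Global

/-! ### Gains for arbitrary switching -/

/-- A common error matrix of all graphs in which `S` is the `2`-hop neighbourhood of `i`, for the
gains `commonGain α k G i` and `1`. -/
def commonErrMat {N : ℕ} (γ k : ℝ) (S : Finset (Fin N)) (i : Fin N) :
    Matrix (S ⊕ S) (S ⊕ S) ℝ :=
  Matrix.fromBlocks 0 1 (-(k • (1 : Matrix S S ℝ) + Matrix.of fun _ _ => 1))
    (-(γ • (1 : Matrix S S ℝ) +
      Matrix.of fun a b : S => if (a : Fin N) = i ∧ (b : Fin N) = i then 1 else 0))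

/-- The gain that cancels the Laplacian of the proximity graph in the error dynamics. The
all-ones matrix makes its entries positive. -/
noncomputable def commonGain {N : ℕ} (α k : ℝ) (G : SimpleGraph (Fin N)) (i : Fin N) :
    Matrix (hood2 G i) (hood2 G i) ℝ :=
  (k • 1 - α • lap (proxGraph G i)) + Matrix.of fun _ _ => 1

theorem errMat_commonGain {N : ℕ} (α γ k : ℝ) (G : SimpleGraph (Fin N)) (i : Fin N) :
    errMat α γ G i (commonGain α k G i) 1 = commonErrMat γ k (hood2 G i) i := by
  have hs : ∀ a : hood2 G i, a = self G i ↔ (a : Fin N) = i := fun a => Subtype.ext_iff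
  unfold errMat locMat sysMat gainMat outMat commonErrMat commonGain
  rw [Matrix.fromBlocks_multiply, sub_eq_add_neg, Matrix.fromBlocks_neg, Matrix.fromBlocks_add]
  congr 1
  · simp
  · simp
  · simp only [Matrix.mul_one, Matrix.mul_zero, add_zero]
    abel
  · ext a b
    simp only [Matrix.mul_zero, zero_add, neg_add, Matrix.add_apply, Matrix.neg_apply,
      Matrix.mul_apply, Matrix.of_apply, Finset.univ_unique, Finset.sum_singleton, hs]
    by_cases ha : (a : Fin N) = i <;> by_cases hb : (b : Fin N) = i <;> simp [ha, hb]

theorem lap_isHermitian {ι : Type*} [Fintype ι] (G : SimpleGraph ι) : (lap G).IsHermitian := by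
  rw [Matrix.IsHermitian, Matrix.conjTranspose_eq_transpose_of_trivial]
  classical
  exact G.isSymm_lapMatrix (R := ℝ)

theorem lap_apply_nonpos {ι : Type*} [Fintype ι] (G : SimpleGraph ι) {a b : ι} (hab : a ≠ b) :
    lap G a b ≤ 0 := by
  classical
  rw [lap, SimpleGraph.lapMatrix, SimpleGraph.degMatrix, Matrix.sub_apply,
    Matrix.diagonal_apply_ne _ hab, SimpleGraph.adjMatrix_apply]
  split_ifs <;> simp

theorem commonGain_posDef {N : ℕ} {α k Λ : ℝ} (hα : 0 ≤ α) {G : SimpleGraph (Fin N)} {i : Fin N}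
    (hΛ : opNorm (lap (proxGraph G i)) ≤ Λ) (hk : α * Λ < k) : (commonGain α k G i).PosDef := by
  refine Matrix.PosDef.add_posSemidef ?_ ?_
  · refine Matrix.PosDef.of_dotProduct_mulVec_pos ?_ fun v hv => ?_
    · refine Matrix.IsHermitian.sub ?_ ?_
      · simp [Matrix.IsHermitian]
      · rw [Matrix.IsHermitian, Matrix.conjTranspose_smul, (lap_isHermitian _).eq, star_trivial]
    · set L := lap (proxGraph G i) with hL
      set w : EuclideanSpace ℝ (hood2 G i) := WithLp.toLp 2 v with hw
      have hw0 : 0 < ‖w‖ := norm_pos_iff.2 fun h0 => hv (congrArg WithLp.ofLp h0)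
      have h1 : v ⬝ᵥ (L.mulVec v) ≤ Λ * ‖w‖ ^ 2 := by
        have h2 := real_inner_le_norm (actL L w) w
        have h3 := ContinuousLinearMap.le_of_opNorm_le (actL L) hΛ w
        have h4 : inner ℝ (actL L w) w = v ⬝ᵥ (L.mulVec v) := by
          rw [EuclideanSpace.inner_eq_star_dotProduct]
          rfl
        rw [← h4]
        nlinarith
      have h5 : v ⬝ᵥ v = ‖w‖ ^ 2 := by
        rw [← real_inner_self_eq_norm_sq, EuclideanSpace.inner_eq_star_dotProduct]
        rfl
      have h6 : star v ⬝ᵥ ((k • (1 : Matrix _ _ ℝ) - α • L).mulVec v) =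
          k * ‖w‖ ^ 2 - α * (v ⬝ᵥ (L.mulVec v)) := by
        rw [star_trivial, Matrix.sub_mulVec, Matrix.smul_mulVec, Matrix.smul_mulVec,
          Matrix.one_mulVec, dotProduct_sub, dotProduct_smul, dotProduct_smul, h5]
        rfl
      rw [h6]
      nlinarith [mul_le_mul_of_nonneg_left h1 hα, pow_pos hw0 2]
  · refine Matrix.PosSemidef.of_dotProduct_mulVec_nonneg ?_ fun v => ?_
    · ext a b
      simp
    · have : star v ⬝ᵥ ((Matrix.of fun _ _ => (1 : ℝ)).mulVec v) = (∑ a, v a) * ∑ a, v a := by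
        simp [dotProduct, Matrix.mulVec, Finset.sum_mul]
      rw [this]
      exact mul_self_nonneg _

theorem commonGain_pos {N : ℕ} {α k : ℝ} (hα : 0 ≤ α) {G : SimpleGraph (Fin N)} {i : Fin N}
    (h : (commonGain α k G i).PosDef) (a b) : 0 < commonGain α k G i a b := by
  rcases eq_or_ne a b with rfl | hab
  · exact h.diag_pos
  · have h1 := lap_apply_nonpos (proxGraph G i) hab
    have h2 := mul_nonneg hα (neg_nonneg.2 h1)
    simp only [commonGain, Matrix.add_apply, Matrix.sub_apply, Matrix.smul_apply,
      Matrix.one_apply_ne hab, smul_eq_mul, mul_zero, Matrix.of_apply]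
    linarith

/-- A quadratic polynomial with positive coefficients is Hurwitz. -/
theorem re_neg_of_quadratic {a d k : ℝ} (ha : 0 < a) (hd : 0 < d) (hk : 0 < k) {z : ℂ}
    (hz : z ^ 2 * a + z * d + k = 0) : z.re < 0 := by
  have h1 := congrArg Complex.re hz
  have h2 := congrArg Complex.im hz
  simp only [pow_two, Complex.add_re, Complex.mul_re, Complex.mul_im, Complex.ofReal_re,
    Complex.ofReal_im, Complex.zero_re, mul_zero, sub_zero, Complex.add_im, Complex.zero_im,
    zero_add, add_zero] at h1 h2
  by_contra! hr
  have h3 : z.im * (2 * a * z.re + d) = 0 := by linarith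
  have h4 : 0 < 2 * a * z.re + d := by positivity
  have h5 : z.im = 0 := by
    rcases mul_eq_zero.1 h3 with h | h
    · exact h
    · linarith
  rw [h5] at h1
  have : 0 ≤ z.re * z.re * a + z.re * d := by positivity
  linarith

theorem isHurwitz_commonErrMat {N : ℕ} {γ k : ℝ} (hγ : 0 < γ) (hk : 0 < k) (S : Finset (Fin N))
    (i : Fin N) : IsHurwitz (commonErrMat γ k S i) := by
  classical
  intro z hz
  rw [spectrum.mem_iff, Matrix.isUnit_iff_isUnit_det, isUnit_iff_ne_zero, not_not,
    ← Matrix.exists_mulVec_eq_zero_iff] at hz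
  obtain ⟨w, hw0, hw⟩ := hz
  have hw' : ∀ c, z * w c = ∑ d, (algebraMap ℝ ℂ) (commonErrMat γ k S i c d) * w d := by
    intro c
    have h1 := congrFun hw c
    rw [Matrix.sub_mulVec, Algebra.algebraMap_eq_smul_one, Matrix.smul_mulVec,
      Matrix.one_mulVec] at h1
    exact sub_eq_zero.1 h1
  set P : S → ℂ := fun a => w (Sum.inl a) with hP
  have hv : ∀ a, w (Sum.inr a) = z * P a := fun a => by
    have h1 := hw' (Sum.inl a)
    simp only [Fintype.sum_sum_type, commonErrMat, Matrix.fromBlocks_apply₁₁,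
      Matrix.fromBlocks_apply₁₂, Matrix.zero_apply, map_zero, zero_mul, Finset.sum_const_zero,
      zero_add, Matrix.one_apply] at h1
    rw [h1]
    simp
  have hP0 : ∃ a, P a ≠ 0 := by
    by_contra! h0
    refine hw0 (funext fun c => ?_)
    rcases c with a | a
    · exact h0 a
    · rw [hv, h0, mul_zero]
      rfl
  have heq : ∀ a, z * (z * P a) = -(k * P a + ∑ b, P b) -
      (γ * (z * P a) + if (a : Fin N) = i then ∑ b : S, if (b : Fin N) = i then z * P b else 0
        else 0) := by
    intro a
    have h1 := hw' (Sum.inr a)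
    simp only [Fintype.sum_sum_type, commonErrMat, Matrix.fromBlocks_apply₂₁,
      Matrix.fromBlocks_apply₂₂, Matrix.neg_apply, Matrix.add_apply, Matrix.smul_apply,
      Matrix.one_apply, Matrix.of_apply, smul_eq_mul, mul_ite, mul_one, mul_zero, hv] at h1
    rw [h1]
    simp only [neg_add, map_neg, map_add, add_mul, neg_mul, Finset.sum_add_distrib,
      Finset.sum_neg_distrib]
    have e1 : ∀ (c : ℝ) (f : S → ℂ),
        ∑ b, (algebraMap ℝ ℂ) (if a = b then c else 0) * f b = c * f a := fun c f => by
      simp [apply_ite, ite_mul]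
    have e2 : ∑ b : S, (algebraMap ℝ ℂ) (if (a : Fin N) = i ∧ (b : Fin N) = i then 1 else 0) *
        (z * P b) = if (a : Fin N) = i then ∑ b : S, if (b : Fin N) = i then z * P b else 0
        else 0 := by
      by_cases ha : (a : Fin N) = i <;> simp [ha, apply_ite, ite_mul]
    rw [e1, e1, e2]
    simp
    ring
  set n : ℝ := ∑ a, Complex.normSq (P a) with hn
  have hn0 : 0 < n := by
    obtain ⟨a, ha⟩ := hP0
    exact Finset.sum_pos' (fun _ _ => Complex.normSq_nonneg _)
      ⟨a, Finset.mem_univ _, Complex.normSq_pos.2 ha⟩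
  set g : ℝ := Complex.normSq (∑ b : S, if (b : Fin N) = i then P b else 0) with hg
  have hconj : ∀ c : ℂ, (starRingEnd ℂ) c * c = (Complex.normSq c : ℂ) := fun c => by
    rw [mul_comm, Complex.mul_conj]
  have hsum : z ^ 2 * n + z * ((γ * n + g : ℝ) : ℂ) +
      ((k * n + Complex.normSq (∑ b, P b) : ℝ) : ℂ) = 0 := by
    have h1 : ∑ a, (starRingEnd ℂ) (P a) * (z * (z * P a)) = z ^ 2 * n := by
      rw [hn, Complex.ofReal_sum, Finset.mul_sum]
      refine Finset.sum_congr rfl fun a _ => ?_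
      rw [← hconj]
      ring
    have h2 : ∑ a, (starRingEnd ℂ) (P a) * (-(k * P a + ∑ b, P b) -
        (γ * (z * P a) + if (a : Fin N) = i then ∑ b : S, if (b : Fin N) = i then z * P b else 0
          else 0)) = -(k * n) - Complex.normSq (∑ b, P b) - z * (γ * n) - z * g := by
      have h3 : ∀ a : S, (starRingEnd ℂ) (P a) * (-(k * P a + ∑ b, P b) -
          (γ * (z * P a) + if (a : Fin N) = i then ∑ b : S, if (b : Fin N) = i then z * P b else 0
            else 0)) = -(k * (Complex.normSq (P a) : ℂ)) - (starRingEnd ℂ) (P a) * ∑ b, P b -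
          z * (γ * (Complex.normSq (P a) : ℂ)) -
          (starRingEnd ℂ) (if (a : Fin N) = i then P a else 0) *
            (z * ∑ b : S, if (b : Fin N) = i then P b else 0) := by
        intro a
        rw [← hconj]
        have h4 : (∑ b : S, if (b : Fin N) = i then z * P b else 0) =
            z * ∑ b : S, if (b : Fin N) = i then P b else 0 := by
          rw [Finset.mul_sum]
          exact Finset.sum_congr rfl fun b _ => by split_ifs <;> simp
        rw [h4]
        split_ifs
        · ring
        · rw [map_zero]
          ring
      simp only [h3, Finset.sum_sub_distrib, Finset.sum_neg_distrib, ← Finset.mul_sum,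
        ← Finset.sum_mul, ← map_sum]
      rw [hconj, mul_left_comm _ z, hconj, hn, Complex.ofReal_sum]
    have h5 := Finset.sum_congr (s₁ := Finset.univ) rfl fun a (_ : a ∈ Finset.univ) =>
      congrArg ((starRingEnd ℂ) (P a) * ·) (heq a)
    rw [h1, h2] at h5
    rw [h5]
    push_cast
    ring
  refine re_neg_of_quadratic hn0 ?_ ?_ hsum
  · have := Complex.normSq_nonneg (∑ b : S, if (b : Fin N) = i then P b else 0)
    positivity
  · have := Complex.normSq_nonneg (∑ b, P b)
    positivity

/-! ### Decay of the modes -/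

section Modes

variable {N m : ℕ} {α γ : ℝ} {G : Fin m → SimpleGraph (Fin N)} {i : Fin N}
  {H : ∀ q, Matrix (hood2 (G q) i) (hood2 (G q) i) ℝ} {h : Fin m → ℝ}

theorem AdmissibleGains.exists_modeDecay (hH : AdmissibleGains α γ G i H h) (q : Fin m) :
    ∃ κ lam, ModeDecay α γ G i H h q κ lam := by
  have : Nonempty (hood2 (G q) i) := ⟨self (G q) i⟩
  obtain ⟨κ, lam, h1, h2, h3⟩ := (hH.hurwitz q).exists_opNorm_exp_le
  exact ⟨κ, lam, h1, h2, h3⟩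

theorem AdmissibleGains.exists_uniform_modeDecay (hH : AdmissibleGains α γ G i H h) :
    ∃ κ lam, 0 < κ ∧ 0 < lam ∧ ∀ q, ModeDecay α γ G i H h q κ lam := by
  choose κ lam hd using hH.exists_modeDecay
  have hκ : ∀ q, 0 ≤ κ q := fun q => (hd q).pos_const.le
  have hlam : ∀ q, 0 ≤ (lam q)⁻¹ := fun q => (inv_pos.2 (hd q).pos_rate).le
  have h1 : 0 < 1 + ∑ q, κ q := by
    linarith [Finset.sum_nonneg fun q (_ : q ∈ Finset.univ) => hκ q]
  have h2 : 0 < 1 + ∑ q, (lam q)⁻¹ := by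
    linarith [Finset.sum_nonneg fun q (_ : q ∈ Finset.univ) => hlam q]
  refine ⟨1 + ∑ q, κ q, (1 + ∑ q, (lam q)⁻¹)⁻¹, h1, inv_pos.2 h2, fun q =>
    ⟨h1, inv_pos.2 h2, fun s hs => ((hd q).bound s hs).trans ?_⟩⟩
  have h3 : κ q ≤ 1 + ∑ q, κ q := by
    linarith [Finset.single_le_sum (fun q _ => hκ q) (Finset.mem_univ q)]
  have h4 : (1 + ∑ q, (lam q)⁻¹)⁻¹ ≤ lam q := by
    rw [inv_le_comm₀ h2 (hd q).pos_rate]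
    linarith [Finset.single_le_sum (fun q _ => hlam q) (Finset.mem_univ q)]
  have h5 : -lam q * s ≤ -(1 + ∑ q, (lam q)⁻¹)⁻¹ * s := by nlinarith
  exact mul_le_mul h3 (Real.exp_le_exp.2 h5) (Real.exp_pos _).le h1.le

/-- For the common gains the error flow is determined by the `2`-hop neighbourhood. -/
theorem isFlowLabel_commonGain {k lam : ℝ} :
    IsFlowLabel α γ G i (fun q => commonGain α k (G q) i) (fun _ => 1) lam
      fun q => hood2 (G q) i := by
  intro q q' z M hl hF s hs
  have key : ∀ S S' : Finset (Fin N), S = S' →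
      ‖act (NormedSpace.exp (s • commonErrMat γ k S i)) (restr S z)‖ ≤ M * Real.exp (-lam * s) →
      ‖act (NormedSpace.exp (s • commonErrMat γ k S' i)) (restr S' z)‖ ≤
        M * Real.exp (-lam * s) := by
    rintro S _ rfl h
    exact h
  have h1 := hF s hs
  rw [errMat_commonGain] at h1 ⊢
  exact key _ _ hl h1

end Modes

/-! ### Bounds within one mode -/

section OneMode

variable {N m : ℕ} {α γ μ T Λ t₀ κ lam : ℝ} {Q : Matrix (Fin (N - 1)) (Fin N) ℝ}
  {G : Fin m → SimpleGraph (Fin N)} {i : Fin N}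
  {H : ∀ q, Matrix (hood2 (G q) i) (hood2 (G q) i) ℝ} {h : Fin m → ℝ} {σ : ℝ → Fin m}
  {ts : ℕ → ℝ} {A : Finset (Fin N)} {p : ℝ≥0∞} {u : ℝ → EuclideanSpace ℝ A}
  {x xh : ℝ → EuclideanSpace ℝ (Fin N ⊕ Fin N)}

theorem IsRun.norm_err_le (hr : IsRun α γ μ T Q G i H h σ t₀ ts A p u x xh)
    (hQ : IsDisagreementMatrix Q) (hα : 0 ≤ α)
    (hΛ : ∀ G : SimpleGraph (Fin N), opNorm (lap G) ≤ Λ ∧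
      ∀ i, opNorm (lap (proxGraph G i)) ≤ Λ) {k : ℕ} {t : ℝ}
    (ht : t ∈ Set.Ico (ts k) (ts (k + 1))) (hq : ModeDecay α γ G i H h (σ (ts k)) κ lam) :
    ‖err G i (σ (ts k)) x xh t‖ ≤
      κ * ‖err G i (σ (ts k)) x xh (ts k)‖ * Real.exp (-lam * (t - ts k)) +
        κ * expConv lam (ts k) (forcingBound α Λ Q u x) t := by
  have h1 := (hr.flowBound_of_mem_Ico hQ hα hΛ ht hq (hq.flowBound _)
    (hr.intervalIntegrable_forcingBound Λ (hr.switching.start_le k) ht.1)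
    (fun s _ => le_rfl)).norm_le
  rwa [mul_comm (Real.exp _)] at h1

/-- The `L_p` bounds of the error in the modes. -/
theorem exists_eLpNorm_err_mode_le (hQ : IsDisagreementMatrix Q) (hα : 0 < α) (hμ : 0 < μ)
    (hT : 0 < T) (hΛ0 : 0 ≤ Λ) (hΛ : ∀ G : SimpleGraph (Fin N), opNorm (lap G) ≤ Λ ∧
      ∀ i, opNorm (lap (proxGraph G i)) ≤ Λ) (hγ : IsLargeDamping α μ T Λ γ) (hκ : 0 < κ)
    (hlam : 0 < lam) (hq : ∀ q, ModeDecay α γ G i H h q κ lam) (hp : 1 ≤ p) :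
    ∃ c b b' : ℝ, 0 ≤ c ∧ 0 ≤ b ∧ 0 ≤ b' ∧
      ∀ σ t₀ ts A u x xh, IsRun α γ μ T Q G i H h σ t₀ ts A p u x xh →
      ∀ (k : ℕ) (w : ℝ), ‖err G i (σ (ts k)) x xh (ts k)‖ < w →
      ∀ Td, ts k ≤ Td → Td < ts (k + 1) →
        eLpNorm (fun t => ‖err G i (σ (ts k)) x xh t‖) p
            (volume.restrict (Set.Icc (ts k) Td)) ≤
          ENNReal.ofReal c * eLpNorm u p (volume.restrict (Set.Icc t₀ Td)) +
            ENNReal.ofReal (b * ‖x t₀‖ + b' * w) := by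
  have g0 : 0 < γ := by linarith [hγ.one_le]
  obtain ⟨ν, hν⟩ := exists_isCommonRate hα g0 hμ hlam
  obtain ⟨B, hB, HB⟩ := exists_eLpNorm_envelope_le hν.pos hp
  obtain ⟨B', hB', HB'⟩ := exists_eLpNorm_exp_le hlam p
  obtain ⟨c, hc⟩ : ∃ c, c = κ * (α * (2 * Λ) * 32 * (lam - ν)⁻¹ + 1) := ⟨_, rfl⟩
  have hc0 : 0 < c := by
    have := inv_pos.2 (sub_pos.2 hν.lt)
    rw [hc]
    positivity
  have hν0 := hν.pos
  refine ⟨c * (1 / ν), c * B, κ * B', by positivity, by positivity, by positivity,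
    fun σ t₀ ts A u x xh hr k w hw Td hk hTd => ?_⟩
  have htk := hr.switching.start_le k
  have hw0 : 0 ≤ w := (norm_nonneg _).trans hw.le
  have hi := hr.intervalIntegrable_norm_input le_rfl (htk.trans hk)
  set E := envelope ν t₀ ‖x t₀‖ (fun s => ‖u s‖) with hE
  have hEc : ContinuousOn E (Set.Icc (ts k) Td) :=
    (continuousOn_envelope hi (htk.trans hk)).mono (Set.Icc_subset_Icc_left htk)
  have h1 : eLpNorm (fun t => ‖err G i (σ (ts k)) x xh t‖) p
      (volume.restrict (Set.Icc (ts k) Td)) ≤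
      eLpNorm ((fun t => κ * w * Real.exp (-lam * (t - ts k))) + fun t => c * E t) p
        (volume.restrict (Set.Icc (ts k) Td)) := by
    refine eLpNorm_mono_ae_real ?_
    refine (ae_restrict_iff' measurableSet_Icc).2 (ae_of_all _ fun t ht => ?_)
    rw [norm_norm]
    change _ ≤ κ * w * Real.exp (-lam * (t - ts k)) + c * E t
    refine (hr.norm_err_le hQ hα.le hΛ ⟨ht.1, ht.2.trans_lt hTd⟩ (hq _)).trans
      (add_le_add ?_ ?_)
    · gcongr
    · rw [hc, mul_assoc κ]
      exact mul_le_mul_of_nonneg_left (hr.expConv_forcingBound_le hQ (fun G => (hΛ G).1) hΛ0 hα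
        hμ hT hγ hν htk ht.1) hκ.le
  have h2 : eLpNorm (fun t => κ * w * Real.exp (-lam * (t - ts k))) p
      (volume.restrict (Set.Icc (ts k) Td)) ≤ ENNReal.ofReal (κ * B' * w) := by
    refine (eLpNorm_le_mul_eLpNorm_of_ae_le_mul (c := κ * w)
      (g := fun t => Real.exp (-lam * (t - ts k))) (ae_of_all _ fun t => ?_) p).trans ?_
    · rw [norm_mul, Real.norm_of_nonneg (by positivity : 0 ≤ κ * w)]
    · refine (mul_le_mul_right (HB' (ts k) Td) _).trans (le_of_eq ?_)
      rw [← ENNReal.ofReal_mul (by positivity)]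
      ring_nf
  have h3 : eLpNorm (fun t => c * E t) p (volume.restrict (Set.Icc (ts k) Td)) ≤
      ENNReal.ofReal (c * (1 / ν)) * eLpNorm u p (volume.restrict (Set.Icc t₀ Td)) +
        ENNReal.ofReal (c * B * ‖x t₀‖) := by
    refine (eLpNorm_le_mul_eLpNorm_of_ae_le_mul (c := c) (g := E)
      (ae_of_all _ fun t => ?_) p).trans ?_
    · rw [norm_mul, Real.norm_of_nonneg hc0.le]
    · refine (mul_le_mul_right ((eLpNorm_mono_measure E (Measure.restrict_mono
        (Set.Icc_subset_Icc_left htk) le_rfl)).trans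
        (HB t₀ Td _ _ (norm_nonneg _) (htk.trans hk) hi)) _).trans (le_of_eq ?_)
      rw [mul_add, ← mul_assoc, ← ENNReal.ofReal_mul hc0.le, ← ENNReal.ofReal_mul hc0.le,
        eLpNorm_norm, mul_assoc c B]
  refine h1.trans ((eLpNorm_add_le (by fun_prop)
    ((hEc.aestronglyMeasurable measurableSet_Icc).const_mul c) hp).trans ?_)
  refine (add_le_add h2 h3).trans (le_of_eq ?_)
  rw [ENNReal.ofReal_add (by positivity) (by positivity), add_comm, add_assoc]

/-- The explicit bound of the error in a mode, for a constant `K` above the couplings that are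
missing in the local model. -/
theorem IsRun.norm_err_le_explicit (hr : IsRun α γ μ T Q G i H h σ t₀ ts A p u x xh)
    (hQ : IsDisagreementMatrix Q) (hα : 0 < α) (hμ : 0 < μ) (hT : 0 < T) (hΛ0 : 0 ≤ Λ)
    (hΛ : ∀ G : SimpleGraph (Fin N), opNorm (lap G) ≤ Λ ∧
      ∀ i, opNorm (lap (proxGraph G i)) ≤ Λ) (hγ : IsLargeDamping α μ T Λ γ) {lx K : ℝ}
    (hlx : lx ≤ 3 / 4 * (α / γ * μ)) (hK1 : 24 * Λ ≤ K) (hK2 : 1 + 256 / 3 * Λ / μ ≤ α * K)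
    {k : ℕ} {t U : ℝ} (hu : ∀ s ∈ Set.Icc t₀ t, ‖u s‖ ≤ U)
    (ht : t ∈ Set.Ico (ts k) (ts (k + 1))) (hq : ModeDecay α γ G i H h (σ (ts k)) κ lam) :
    ‖err G i (σ (ts k)) x xh t‖ ≤
      κ * ‖err G i (σ (ts k)) x xh (ts k)‖ * Real.exp (-lam * (t - ts k)) +
      (α * K * κ / lam * ‖x t₀‖ * Real.exp (-lx * (ts k - t₀))) *
        (1 - Real.exp (-lam * (t - ts k))) +
      (1 + α * K * κ) / lam * U * (1 - Real.exp (-lam * (t - ts k))) := by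
  have g0 : 0 < γ := by linarith [hγ.one_le]
  have hκ0 := hq.pos_const
  have hlam0 := hq.pos_rate
  have htk := hr.switching.start_le k
  have hU0 : 0 ≤ U := (norm_nonneg _).trans (hu t₀ ⟨le_rfl, htk.trans ht.1⟩)
  set rate := 3 / 4 * (α / γ * μ) with hrate
  have hrate0 : 0 < rate := by positivity
  set X := ‖x t₀‖ * Real.exp (-lx * (ts k - t₀)) with hX
  have hX0 : 0 ≤ X := by positivity
  -- the trace of the initial state is frozen at `ts k`, and the input is replaced by its bound
  have hpos : ∀ s ∈ Set.Icc (ts k) t, ‖act Q (pos (x s))‖ ≤ 12 * X + 128 / (3 * (α * μ)) * U := by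
    intro s hs
    have hts : t₀ ≤ s := htk.trans hs.1
    refine (hr.plant.norm_le hr.switching hr.nonneg hr.one_le hr.input hQ (fun G => (hΛ G).1)
      hr.pe hα hμ hT hγ hts).1.trans ?_
    have h1 : expConv rate t₀ (fun s => 8 * (‖u s‖ / γ)) s ≤ 8 * (U / γ) / rate := by
      refine (expConv_le_of_le hrate0.ne' hts
        (((hr.intervalIntegrable_norm_input le_rfl hts).div_const γ).const_mul 8)
        (U := 8 * (U / γ)) fun r hrr => ?_).trans ?_
      · have := hu r ⟨hrr.1, hrr.2.trans hs.2⟩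
        gcongr
      · rw [← mul_div_assoc]
        refine div_le_div_of_nonneg_right (mul_le_of_le_one_right (by positivity) ?_) hrate0.le
        linarith [Real.exp_pos (-rate * (s - t₀))]
    have h2 : 8 * (U / γ) / rate = 32 / (3 * (α * μ)) * U := by
      rw [hrate]
      field_simp
      ring
    have h3 : ‖x t₀‖ * Real.exp (-rate * (s - t₀)) ≤ X := by
      refine mul_le_mul_of_nonneg_left (Real.exp_le_exp.2 ?_) (norm_nonneg _)
      have h4 : rate * (ts k - t₀) ≤ rate * (s - t₀) :=
        mul_le_mul_of_nonneg_left (by linarith [hs.1]) hrate0.le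
      have h5 : lx * (ts k - t₀) ≤ rate * (ts k - t₀) :=
        mul_le_mul_of_nonneg_right hlx (by linarith)
      linarith
    have h6 : 128 / (3 * (α * μ)) * U = 4 * (32 / (3 * (α * μ)) * U) := by ring
    unfold envelope
    rw [h6]
    linarith
  set V := α * (2 * Λ) * (12 * X + 128 / (3 * (α * μ)) * U) + U with hV
  have hconv := expConv_le_of_le (U := V) hlam0.ne' ht.1
    (hr.intervalIntegrable_forcingBound Λ htk ht.1) fun s hs =>
      add_le_add (mul_le_mul_of_nonneg_left (hpos s hs) (by positivity))
        (hu s ⟨htk.trans hs.1, hs.2⟩)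
  refine (hr.norm_err_le hQ hα.le hΛ ht hq).trans ?_
  rw [add_assoc]
  refine add_le_add le_rfl ?_
  set δ := 1 - Real.exp (-lam * (t - ts k)) with hδ
  have hδ0 : 0 ≤ δ := by
    rw [hδ, sub_nonneg, Real.exp_le_one_iff]
    nlinarith [ht.1]
  have hκV : κ * V ≤ α * K * κ * X + (1 + α * K * κ) * U := by
    have e : κ * V = α * (24 * Λ) * κ * X + κ * (1 + 256 / 3 * Λ / μ) * U := by
      rw [hV]
      field_simp
      ring
    rw [e]
    have h1 : α * (24 * Λ) * κ * X ≤ α * K * κ * X := by gcongr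
    have h2 : κ * (1 + 256 / 3 * Λ / μ) * U ≤ κ * (α * K) * U := by gcongr
    nlinarith
  calc κ * expConv lam (ts k) (forcingBound α Λ Q u x) t ≤ κ * (V * (δ / lam)) :=
        mul_le_mul_of_nonneg_left hconv hκ0.le
    _ = κ * V * (δ / lam) := by ring
    _ ≤ (α * K * κ * X + (1 + α * K * κ) * U) * (δ / lam) :=
        mul_le_mul_of_nonneg_right hκV (by positivity)
    _ = _ := by rw [hX]; ring

end OneMode

end MultiAgent

open MultiAgent in
theorem theorem2 (N : ℕ) (hN : 3 ≤ N) (α μ T : ℝ) (hα : 0 < α) (hμ : 0 < μ) (hμN : μ ≤ N)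
    (hT : 0 < T) :
    ∃ γ₀ : ℝ, 0 < γ₀ ∧ ∀ γ : ℝ, γ₀ ≤ γ →
    ∀ Q : Matrix (Fin (N - 1)) (Fin N) ℝ, IsDisagreementMatrix Q →
    ∀ (m : ℕ) (G : Fin m → SimpleGraph (Fin N)) (i : Fin N),
    -- every admissible choice of the observer gains
    (∀ (H : ∀ q, Matrix (hood2 (G q) i) (hood2 (G q) i) ℝ) (h : Fin m → ℝ),
      AdmissibleGains α γ G i H h →
      -- the unforced error system is exponentially stable in every mode
      (∀ q, ∃ κe le, ModeDecay α γ G i H h q κe le) ∧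
      -- finite-gain stability in every mode, with constants that do not depend on the run
      (∀ p : ℝ≥0∞, 1 ≤ p → ∃ c b b' : ℝ, 0 ≤ c ∧ 0 ≤ b ∧ 0 ≤ b' ∧
        ∀ σ t₀ ts A u x xh, IsRun α γ μ T Q G i H h σ t₀ ts A p u x xh →
        ∀ (k : ℕ) (w : ℝ), ‖err G i (σ (ts k)) x xh (ts k)‖ < w →
        ∀ Td, ts k ≤ Td → Td < ts (k + 1) →
          eLpNorm (fun t => ‖err G i (σ (ts k)) x xh t‖) p
              (volume.restrict (Set.Icc (ts k) Td)) ≤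
            ENNReal.ofReal c * eLpNorm u p (volume.restrict (Set.Icc t₀ Td)) +
              ENNReal.ofReal (b * ‖x t₀‖ + b' * w) ∧
          eLpNorm (fun t => ‖residual G i (σ (ts k)) x xh t‖) p
              (volume.restrict (Set.Icc (ts k) Td)) ≤
            ENNReal.ofReal c * eLpNorm u p (volume.restrict (Set.Icc t₀ Td)) +
              ENNReal.ofReal (b * ‖x t₀‖ + b' * w)) ∧
      -- the bounds on the residual components and, without attackers, on the error
      (∀ β lx : ℝ, 0 < β → 0 < lx → lx < lamChi N α γ μ T →
        ∀ σ t₀ ts A p u x xh, IsRun α γ μ T Q G i H h σ t₀ ts A p u x xh →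
        ∀ (k : ℕ) (w : ℝ), ‖err G i (σ (ts k)) x xh (ts k)‖ < w →
        ∀ κe le : ℝ, ModeDecay α γ G i H h (σ (ts k)) κe le →
          (∀ Td U : ℝ, (∀ s ∈ Set.Icc t₀ Td, ‖u s‖ ≤ U) →
            ∀ t ∈ Set.Ico (ts k) (ts (k + 1)), t ≤ Td → ∀ j,
              |residual G i (σ (ts k)) x xh t j| ≤
                κe * w * Real.exp (-le * (t - ts k)) +
                (α * kappaX α γ μ T β Q * κe / le * ‖x t₀‖ * Real.exp (-lx * (ts k - t₀))) *
                  (1 - Real.exp (-le * (t - ts k))) +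
                (1 + α * kappaX α γ μ T β Q * κe) / le * U *
                  (1 - Real.exp (-le * (t - ts k)))) ∧
          (A = ∅ → ∀ t ∈ Set.Ico (ts k) (ts (k + 1)),
            (∀ j, |residual G i (σ (ts k)) x xh t j| ≤
                κe * w * Real.exp (-le * (t - ts k)) +
                (α * kappaX α γ μ T β Q * κe / le * ‖x t₀‖ * Real.exp (-lx * (ts k - t₀))) *
                  (1 - Real.exp (-le * (t - ts k)))) ∧
            ‖err G i (σ (ts k)) x xh t‖ ≤
                κe * ‖err G i (σ (ts k)) x xh (ts k)‖ * Real.exp (-le * (t - ts k)) +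
                (α * kappaX α γ μ T β Q * κe / le * ‖x t₀‖ * Real.exp (-lx * (ts k - t₀))) *
                  (1 - Real.exp (-le * (t - ts k))))) ∧
      -- stability over the whole time axis, if mode changes without reset are slow on average
      (∀ κe le : ℝ, (∀ q, ModeDecay α γ G i H h q κe le) →
        ∀ (n : ℕ) (τ : ℝ), 0 < τ → Real.log κe < le * τ →
          GloballyStable α γ μ T Q G i H h (HasAverageDwellTime G i n τ))) ∧
    -- for suitable admissible gains, stability over the whole time axis for arbitrary switching
    (∃ (H : ∀ q, Matrix (hood2 (G q) i) (hood2 (G q) i) ℝ) (h : Fin m → ℝ),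
      AdmissibleGains α γ G i H h ∧ (∀ q a b, 0 < H q a b) ∧
      GloballyStable α γ μ T Q G i H h (fun _ _ => True)) := by
  obtain ⟨Λ, hΛ0, hΛ⟩ := exists_opNorm_lap_le N
  obtain ⟨γ₁, hγ₁, hlarge⟩ := exists_isLargeDamping hα hμ hT hΛ0
  -- the last two summands make `kappaX ≥ γ` large enough for the explicit bounds
  refine ⟨γ₁ + 24 * Λ + (1 + 256 / 3 * Λ / μ) / α, by positivity, fun γ hγ Q hQ m G i => ?_⟩
  have c1 : 0 < 24 * Λ := by positivity
  have c2 : 0 < (1 + 256 / 3 * Λ / μ) / α := by positivity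
  have hL : IsLargeDamping α μ T Λ γ := hlarge γ (by linarith)
  have g0 : 0 < γ := by linarith
  refine ⟨fun H h hH => ⟨hH.exists_modeDecay, fun p hp => ?_, ?_, ?_⟩, ?_⟩
  · obtain ⟨κ, lam, hκ, hlam, hq⟩ := hH.exists_uniform_modeDecay
    obtain ⟨c, b, b', hc, hb, hb', hle⟩ :=
      exists_eLpNorm_err_mode_le hQ hα hμ hT hΛ0.le hΛ hL hκ hlam hq hp
    refine ⟨c, b, b', hc, hb, hb', fun σ t₀ ts A u x xh hr k w hw Td h1 h2 => ?_⟩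
    have h3 := hle σ t₀ ts A u x xh hr k w hw Td h1 h2
    refine ⟨h3, le_trans (eLpNorm_mono fun t => ?_) h3⟩
    rw [norm_norm, norm_norm]
    exact norm_residual_le t
  · intro β lx hβ hlx0 hlx σ t₀ ts A p u x xh hr k w hw κ lam hq
    have hK := le_kappaX (μ := μ) (T := T) (by lia : 2 ≤ N) hα g0 hβ Q
    have hlx' := hlx.le.trans (lamChi_le (N := N) hα hμ hT g0 hL.rate)
    have hK1 : 24 * Λ ≤ kappaX α γ μ T β Q := by linarith
    have hK2 : 1 + 256 / 3 * Λ / μ ≤ α * kappaX α γ μ T β Q := by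
      rw [← div_le_iff₀' hα]
      linarith
    have hw' : ∀ t, κ * ‖err G i (σ (ts k)) x xh (ts k)‖ * Real.exp (-lam * (t - ts k)) ≤
        κ * w * Real.exp (-lam * (t - ts k)) := fun t =>
      mul_le_mul_of_nonneg_right (mul_le_mul_of_nonneg_left hw.le hq.pos_const.le)
        (Real.exp_pos _).le
    refine ⟨fun Td U hU t ht htd j => ?_, fun hA t ht => ?_⟩
    · have h1 := hr.norm_err_le_explicit hQ hα hμ hT hΛ0.le hΛ hL hlx' hK1 hK2
        (fun s hs => hU s ⟨hs.1, hs.2.trans htd⟩) ht hq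
      have h2 : |residual G i (σ (ts k)) x xh t j| ≤ _ := abs_residual_le t j
      have h3 := hw' t
      linarith
    · subst hA
      have h1 := hr.norm_err_le_explicit hQ hα hμ hT hΛ0.le hΛ hL hlx' hK1 hK2 (U := 0)
        (fun s _ => by rw [Subsingleton.elim (u s) 0, norm_zero]) ht hq
      rw [mul_zero, zero_mul, add_zero] at h1
      refine ⟨fun j => ?_, h1⟩
      have h2 : |residual G i (σ (ts k)) x xh t j| ≤ _ := abs_residual_le t j
      have h3 := hw' t
      linarith
  · intro κ lam hq n τ hτ hκτ
    obtain ⟨K, ν, hK, hν, hle⟩ := exists_norm_err_le (lab := id) hQ hα hμ hT hΛ0.le hΛ hL hq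
      (fun q q' z M hl hF => by rwa [← show q = q' from hl]) n hτ hκτ
    refine GloballyStable.of_norm_err_le hK hν fun σ t₀ ts A p u x xh hS hr =>
      hle σ t₀ ts A p u x xh (fun a b hab hnr => ?_) hr
    have := hS a b hab hnr
    unfold labelChanges
    convert this <;> rfl
  · set k := α * Λ + 1 with hk
    have hk0 : 0 < k := by positivity
    have hpd : ∀ q, (commonGain α k (G q) i).PosDef := fun q =>
      commonGain_posDef hα.le ((hΛ (G q)).2 i) (by linarith)
    have hH : AdmissibleGains α γ G i (fun q => commonGain α k (G q) i) (fun _ => 1) :=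
      ⟨hpd, fun _ => one_pos, fun q => by
        rw [errMat_commonGain]
        exact isHurwitz_commonErrMat g0 hk0 _ i⟩
    refine ⟨_, _, hH, fun q => commonGain_pos hα.le (hpd q), ?_⟩
    obtain ⟨κ, lam, hκ, hlam, hq⟩ := hH.exists_uniform_modeDecay
    -- the label never changes without a reset, so any dwell time bound holds
    obtain ⟨K, ν, hK, hν, hle⟩ := exists_norm_err_le (n := 0) (τ := (|Real.log κ| + 1) / lam)
      hQ hα hμ hT hΛ0.le hΛ hL hq isFlowLabel_commonGain (by positivity) (by
        rw [mul_div_cancel₀ _ hlam.ne']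
        linarith [le_abs_self (Real.log κ)])
    refine GloballyStable.of_norm_err_le hK hν fun σ t₀ ts A p u x xh _ hr =>
      hle σ t₀ ts A p u x xh (fun a b hab hnr => ?_) hr
    have h0 : labelChanges (fun q => hood2 (G q) i) σ ts a b = 0 := labelChanges_eq_zero _ hnr
    rw [h0, Nat.cast_zero, zero_add]
    exact div_nonneg (sub_nonneg.2 (hr.switching.strictMono.monotone hab)) (by positivity)
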